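/- **Conventions.** For positive integer weights on the variables, the weight of a power series is the least weight of a monomial occurring in it ($\infty$ for $0$), and the multiplicity $\operatorname{mult}$ is the weight for the weights $(1,\dots,1)$. For positive weights $\mathbf w=(w_1,\dots,w_N)$ let $T=(\mathbb C^{N+1}\setminus\{x=0\})/\mathbb C^*$ for the action $\lambda\cdot(u,x_1,\dots,x_N)=(\lambda^{-1}u,\lambda^{w_1}x_1,\dots,\lambda^{w_N}x_N)$; the $\mathbf w$-blowup of $Z\subseteq\mathbb C^N$ at $0\in Z$ is the restriction of $T\to\mathbb C^N$, $[u,x]\mapsto(u^{w_1}x_1,\dots,u^{w_N}x_N)$, to the strict transform of $Z$. A hypersurface germ in $\mathbb C^4$ is a $cA_n$ singularity if it is isomorphic to $x_1^2+x_2^2+g(x_3,x_4)=0$ with $g\in\mathbb C\{x_3,x_4\}$ of multiplicity $n+1$; an isolated $cA_n$ singularity is of type $t$ if $t$ is the largest positive integer such that the germ is isomorphic to $x_1x_2+g(x_3,x_4)=0$ with $g\in\mathbb C\{x_3,x_4\}$ of weight $t(n+1)$ for the weights $(t,1)$ of $(x_3,x_4)$. For $a\mid r_1+r_2$, $a$ coprime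 to $r_1$ and $r_2$, and $(r_1+r_2)/a\ge 3$, an $(r_1,r_2,a,1)$-Kawakita blowup is a weighted blowup that is locally analytically equivalent to (that is, isomorphic, together with its base, over open neighbourhoods of the centres to) the $(r_1,r_2,a,1)$-blowup at $0$ of an isolated singularity $x_1x_2+g(x_3,x_4)=0$, where $g\in\mathbb C\{x_3,x_4\}$ has weight $r_1+r_2$ for the weights $(a,1)$ and contains the monomial $x_3^{(r_1+r_2)/a}$ with non-zero coefficient. **Setting.** Let $n\ge2$, and let $r_1\ge r_2\ge1$ and $a\ge1$ be integers with $r_1+r_2=a(n+1)$ and $a$ coprime to $r_1$ and $r_2$. Let $F\in\mathbb C[x_1,x_2,x_3,x_4]$ have multiplicity at least $3$, and let $f=-x_1^2+x_2^2+F$ be such that the origin is an isolated singular point of $\mathbb V(f)\subseteq\mathbb C^4$ (for instance, $\mathbb V(f)$ has terminal singularities) and is a $cA_n$ singularity of type at least $a$. For a polynomial automorphism $\sigma$ of $\mathbb C^2$ with coordinates $x_3,x_4$ that fixes the origin, let $f^\sigma=-x_1^2+x_2^2+F^\sigma$ be $f$ after the coordinate change $\sigma$ of $x_3,x_4$. A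 *splitting* of $f^\sigma$ is an identity of convergent power series $$f^\sigma=-\bigl((x_1+q)w\bigr)^2+\bigl((x_2+p)v\bigr)^2+h$$ with $q\in\mathbb C\{x_2,x_3,x_4\}$ and $p\in\mathbb C\{x_3,x_4\}$ of multiplicity at least $2$, $w\in\mathbb C\{x_1,x_2,x_3,x_4\}$ and $v\in\mathbb C\{x_2,x_3,x_4\}$ with constant term $1$, and $h\in\mathbb C\{x_3,x_4\}$ of multiplicity at least $3$. **Claim 1.** There is a $\sigma$, equal to the identity if $a=1$, such that $f^\sigma$ has a splitting in which $h$ has weight $r_1+r_2$ for the weights $(a,1)$ of $(x_3,x_4)$. **Claim 2.** Take any $\sigma$ and any splitting of $f^\sigma$ such that, if $a>1$, $h$ has weight $r_1+r_2$ for the weights $(a,1)$ of $(x_3,x_4)$. Put $m=\min(r_2,\operatorname{mult}q)$ and give $(\alpha,\beta,x_1,x_2,x_3,x_4)$ the weights $\mathbf w'=(r_1,r_2,m,\min(r_2,\operatorname{mult}p),a,1)$. For a power series $s$ in $x_1,\dots,x_4$ let $s_{<k}$ be the sum of its terms of $\mathbf w'$-weight less than $k$, except that $v_{<r_1-r_2}$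 means $1$ if $r_1=r_2$ and $w_{<r_1-m}$ means $1$ if $r_1=m$. Let $$I=\bigl(f^\sigma,\ -\alpha+(x_1+q_{<r_1})w_{<r_1-m}+(x_2+p_{<r_1})v_{<r_1-r_2},\ -\beta+x_2+p_{<r_2}\bigr)\subseteq\mathbb C[\alpha,\beta,x_1,x_2,x_3,x_4].$$ Then $\mathbb V(I)\cong\mathbb V(f^\sigma)$, through $x_i\mapsto x_i$ on coordinate rings, and the $\mathbf w'$-blowup of $\mathbb V(I)$ at the origin is an $(r_1,r_2,a,1)$-Kawakita blowup. Moreover, $F^\sigma\in\mathbb C[x_2,x_3,x_4]$ if and only if $q=0$ and $w=1$. In this case let $$J=\bigl(-(\alpha-(x_2+p_{<r_1})v_{<r_1-r_2})^2+x_2^2+F^\sigma,\ -\beta+x_2+p_{<r_2}\bigr)\subseteq\mathbb C[\alpha,\beta,x_2,x_3,x_4].$$ Then $\mathbb V(J)\cong\mathbb V(f^\sigma)$, and the $(r_1,r_2,\min(r_2,\operatorname{mult}p),a,1)$-blowup of $\mathbb V(J)$ at the origin is an $(r_1,r_2,a,1)$-Kawakita blowup. If in addition $r_1=r_2$, then the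 same two statements hold for $J'=(f^\sigma,\ -\beta+x_2+p_{<r_2})\subseteq\mathbb C[x_1,\beta,x_2,x_3,x_4]$ in place of $J$. -/

import Mathlib

open scoped Topology

noncomputable section

namespace Kawakita

/-! ## Power series, weights and truncations -/

/-- `p` is a convergent power series: it converges absolutely on a neighbourhood of the origin. -/
def IsConvergent {N : ℕ} (p : MvPowerSeries (Fin N) ℂ) : Prop :=
  ∀ᶠ x : Fin N → ℂ in 𝓝 0, Summable fun d : Fin N →₀ ℕ => MvPowerSeries.coeff d p * ∏ i, x i ^ d i

/-- The holomorphic function, defined near the origin, given by a convergent power series. -/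
def seriesSum {N : ℕ} (p : MvPowerSeries (Fin N) ℂ) (x : Fin N → ℂ) : ℂ :=
  ∑' d : Fin N →₀ ℕ, MvPowerSeries.coeff d p * ∏ i, x i ^ d i

/-- Only the variables with index in `S` occur in `p`. -/
def InVars {N : ℕ} (S : Finset (Fin N)) (p : MvPowerSeries (Fin N) ℂ) : Prop :=
  ∀ d : Fin N →₀ ℕ, MvPowerSeries.coeff d p ≠ 0 → d.support ⊆ S

/-- For positive weights `w`, the polynomial `p_{<k}`: the sum of all terms of `p` of `w`-weight
less than `k`. (As the weights are positive, every exponent of such a term is less than `k`.) -/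
def truncLT {N : ℕ} (w : Fin N → ℕ) (k : ℕ) (p : MvPowerSeries (Fin N) ℂ) :
    MvPolynomial (Fin N) ℂ :=
  ∑ d ∈ (Finset.Iic (Finsupp.equivFunOnFinite.symm fun _ : Fin N => k)).filter
      (fun d => Finsupp.weight w d < k),
    MvPolynomial.monomial d (MvPowerSeries.coeff d p)

theorem coeff_truncLT {N : ℕ} (w : Fin N → ℕ) (hw : ∀ i, w i ≠ 0) (k : ℕ)
    (p : MvPowerSeries (Fin N) ℂ) (d : Fin N →₀ ℕ) :
    (truncLT w k p).coeff d = if Finsupp.weight w d < k then MvPowerSeries.coeff d p else 0 := by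
  classical
  have key : Finsupp.weight w d < k →
      d ∈ Finset.Iic (Finsupp.equivFunOnFinite.symm fun _ : Fin N => k) := by
    intro h
    rw [Finset.mem_Iic]
    intro i
    exact (Finsupp.le_weight w (hw i) d).trans h.le
  unfold truncLT
  rw [MvPolynomial.coeff_sum]
  simp only [MvPolynomial.coeff_monomial]
  rw [Finset.sum_ite_eq']
  simp only [Finset.mem_filter]
  by_cases h : Finsupp.weight w d < k
  · simp [h, key h]
  · simp [h]

/-- `p_{<k}`, with the convention that it is `1` when `k = 0`; used for power series with constant
term `1`. -/
def truncUnitLT {N : ℕ} (w : Fin N → ℕ) (k : ℕ) (p : MvPowerSeries (Fin N) ℂ) :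
    MvPolynomial (Fin N) ℂ :=
  if k = 0 then 1 else truncLT w k p

/-! ## Hypersurface singularities -/

/-- The germs at the origin of the holomorphic functions `f` and `g` are contact equivalent:
`g = u * (f ∘ φ)` for a unit `u` and a biholomorphic map germ `φ` (with inverse germ `ψ`) fixing the
origin. Equivalently, the complex analytic space germs `(V(f), 0)` and `(V(g), 0)` are isomorphic. -/
def ContactEquivalent {N : ℕ} (f g : (Fin N → ℂ) → ℂ) : Prop :=
  ∃ (φ ψ : (Fin N → ℂ) → (Fin N → ℂ)) (u : (Fin N → ℂ) → ℂ),
    AnalyticAt ℂ φ 0 ∧ AnalyticAt ℂ ψ 0 ∧ φ 0 = 0 ∧ ψ 0 = 0 ∧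
    (∀ᶠ x in 𝓝 0, φ (ψ x) = x) ∧ (∀ᶠ x in 𝓝 0, ψ (φ x) = x) ∧
    AnalyticAt ℂ u 0 ∧ u 0 ≠ 0 ∧ ∀ᶠ x in 𝓝 0, g x = u x * f (φ x)

/-- The analytic hypersurface germ `f = 0` is smooth outside the origin. -/
def IsIsolated {N : ℕ} (f : (Fin N → ℂ) → ℂ) : Prop :=
  ∀ᶠ x in 𝓝[≠] (0 : Fin N → ℂ), f x = 0 → fderiv ℂ f x ≠ 0

/-- The germ at the origin of `f = 0` in `ℂ⁴` is a `cA_n` singularity: it is isomorphic to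
`x₁² + x₂² + g(x₃, x₄) = 0` with `g` convergent of multiplicity `n + 1`. -/
def IsCA (n : ℕ) (f : (Fin 4 → ℂ) → ℂ) : Prop :=
  ∃ g : MvPowerSeries (Fin 2) ℂ, IsConvergent g ∧ g.order = ((n + 1 : ℕ) : ℕ∞) ∧
    ContactEquivalent f (fun x => x 0 ^ 2 + x 1 ^ 2 + seriesSum g ![x 2, x 3])

/-- The germ at the origin of `f = 0` in `ℂ⁴` is isomorphic to `x₁ x₂ + g(x₃, x₄) = 0` with `g`
convergent of weight `b (n + 1)` for the weights `(b, 1)` of `(x₃, x₄)`. -/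
def HasModelOfWeight (n b : ℕ) (f : (Fin 4 → ℂ) → ℂ) : Prop :=
  ∃ g : MvPowerSeries (Fin 2) ℂ, IsConvergent g ∧
    g.weightedOrder ![b, 1] = ((b * (n + 1) : ℕ) : ℕ∞) ∧
    ContactEquivalent f (fun x => x 0 * x 1 + seriesSum g ![x 2, x 3])

/-- The isolated `cA_n` singularity at the origin of `f = 0` is of type `t`. -/
def IsOfType (n t : ℕ) (f : (Fin 4 → ℂ) → ℂ) : Prop :=
  IsGreatest {b : ℕ | 1 ≤ b ∧ HasModelOfWeight n b f} t

/-! ## Spaces with holomorphic functions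

A reduced complex analytic space is described by its topological space together with the predicate
telling which complex valued functions are holomorphic near a given point. -/

/-- The holomorphic functions on a subset `A` of a space, with its reduced structure: those that
locally extend to holomorphic functions on the ambient space. -/
def holOn {X : Type*} [TopologicalSpace X] (H : (X → ℂ) → X → Prop) (A : Set X) :
    (A → ℂ) → A → Prop :=
  fun s a => ∃ S : X → ℂ, H S a ∧ ∀ᶠ b : A in 𝓝 a, s b = S b

/-- A homeomorphism that is holomorphic in both directions: both it and its inverse pull back
functions holomorphic near a point to functions holomorphic near the preimage of that point. -/
def IsBiholomorphic {X Y : Type*} [TopologicalSpace X] [TopologicalSpace Y]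
    (HX : (X → ℂ) → X → Prop) (HY : (Y → ℂ) → Y → Prop) (e : X ≃ₜ Y) : Prop :=
  (∀ (x : X) (s : Y → ℂ), HY s (e x) → HX (s ∘ e) x) ∧
  (∀ (y : Y) (s : X → ℂ), HX s (e.symm y) → HY (s ∘ e.symm) y)

/-! ## Weighted blowups -/

/-- `ℂ^{N+1} ∖ V(x₁, …, x_N)`, with coordinates `(u, x₁, …, x_N)`. -/
abbrev Cone (N : ℕ) : Type := {y : ℂ × (Fin N → ℂ) // y.2 ≠ 0}

/-- The orbits of the action `λ · (u, x) = (λ⁻¹ u, λ^{w₁} x₁, …, λ^{w_N} x_N)` of `ℂˣ`. -/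
def blowupSetoid {N : ℕ} (w : Fin N → ℕ) : Setoid (Cone N) where
  r y z := ∃ c : ℂˣ, z.1.1 = (c : ℂ)⁻¹ * y.1.1 ∧ ∀ i, z.1.2 i = (c : ℂ) ^ w i * y.1.2 i
  iseqv :=
    { refl := fun y => ⟨1, by simp⟩
      symm := by
        rintro y z ⟨c, h0, h1⟩
        refine ⟨c⁻¹, ?_, fun i => ?_⟩
        · simp [h0]
        · simp [h1]
      trans := by
        rintro x y z ⟨c, h0, h1⟩ ⟨d, k0, k1⟩
        refine ⟨d * c, ?_, fun i => ?_⟩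
        · rw [k0, h0, Units.val_mul, mul_inv]
          ring
        · rw [k1, h1, Units.val_mul, mul_pow]
          ring }

/-- The `w`-blowup `T` of `ℂ^N` at the origin. -/
def Blowup {N : ℕ} (w : Fin N → ℕ) : Type := Quotient (blowupSetoid w)

instance {N : ℕ} (w : Fin N → ℕ) : TopologicalSpace (Blowup w) :=
  inferInstanceAs (TopologicalSpace (Quotient (blowupSetoid w)))

/-- The quotient map to the `w`-blowup. -/
def toBlowup {N : ℕ} (w : Fin N → ℕ) (y : Cone N) : Blowup w := Quotient.mk (blowupSetoid w) y

/-- The morphism `T → ℂ^N`, `[u, x] ↦ (u^{w₁} x₁, …, u^{w_N} x_N)`. -/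
def blowdown {N : ℕ} (w : Fin N → ℕ) : Blowup w → (Fin N → ℂ) :=
  Quotient.lift (s := blowupSetoid w) (fun y i => y.1.1 ^ w i * y.1.2 i) (by
    rintro y z ⟨c, h0, h1⟩
    funext i
    rw [h0, h1, mul_pow, inv_pow]
    have hc : (c : ℂ) ^ w i ≠ 0 := pow_ne_zero _ c.ne_zero
    field_simp)

open Classical in
/-- Holomorphic functions on the quotient `T`: those whose pullback to `ℂ^{N+1} ∖ V(x)` (extended
by zero to have a function on `ℂ^{N+1}`) is holomorphic. -/
def holBlowup {N : ℕ} (w : Fin N → ℕ) : (Blowup w → ℂ) → Blowup w → Prop :=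
  fun s t => ∀ y : Cone N, toBlowup w y = t →
    AnalyticAt ℂ (fun z : ℂ × (Fin N → ℂ) => if h : z.2 ≠ 0 then s (toBlowup w ⟨z, h⟩) else 0) y.1

/-- The strict transform of a locally closed `Z ⊆ ℂ^N`: the closure of the preimage of `Z ∖ {0}`
in the preimage of an open set in which `Z` is closed. -/
def strictTransform {N : ℕ} (w : Fin N → ℕ) (Z : Set (Fin N → ℂ)) : Set (Blowup w) :=
  closure (blowdown w ⁻¹' (Z \ {0})) ∩ blowdown w ⁻¹' Z

/-- The `w`-blowup `Z̃ → Z` of `Z` at the origin. -/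
def blowupMap {N : ℕ} (w : Fin N → ℕ) (Z : Set (Fin N → ℂ)) : strictTransform w Z → Z :=
  fun y => ⟨blowdown w y.1, y.2.2⟩

/-- The `w`-blowup of `Z` and the `w'`-blowup of `Z'` at the origins are analytically equivalent,
with centres corresponding to each other. -/
def BlowupsEquivalent {N M : ℕ} (w : Fin N → ℕ) (Z : Set (Fin N → ℂ))
    (w' : Fin M → ℕ) (Z' : Set (Fin M → ℂ)) : Prop :=
  ∃ (e : Z ≃ₜ Z') (E : strictTransform w Z ≃ₜ strictTransform w' Z'),
    IsBiholomorphic (holOn (AnalyticAt ℂ) Z) (holOn (AnalyticAt ℂ) Z') e ∧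
    IsBiholomorphic (holOn (holBlowup w) (strictTransform w Z))
      (holOn (holBlowup w') (strictTransform w' Z')) E ∧
    (∀ y, blowupMap w' Z' (E y) = e (blowupMap w Z y)) ∧
    ∀ z : Z, (z : Fin N → ℂ) = 0 ↔ (e z : Fin M → ℂ) = 0

/-- The two weighted blowups are locally analytically equivalent, that is, analytically equivalent
over open neighbourhoods of the centres. -/
def BlowupsLocallyEquivalent {N M : ℕ} (w : Fin N → ℕ) (Z : Set (Fin N → ℂ))
    (w' : Fin M → ℕ) (Z' : Set (Fin M → ℂ)) : Prop :=
  0 ∈ Z ∧ 0 ∈ Z' ∧ ∃ (U : Set (Fin N → ℂ)) (U' : Set (Fin M → ℂ)),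
    IsOpen U ∧ IsOpen U' ∧ 0 ∈ U ∧ 0 ∈ U' ∧ BlowupsEquivalent w (Z ∩ U) w' (Z' ∩ U')

/-- The `w'`-blowup of `Z` at the origin is an `(r₁, r₂, a, 1)`-Kawakita blowup: it is locally
analytically equivalent to the `(r₁, r₂, a, 1)`-blowup of the isolated singularity
`x₁ x₂ + g(x₃, x₄) = 0`, where `g` is convergent of weight `r₁ + r₂` and contains the monomial
`x₃^((r₁ + r₂) / a)`. The latter is a `cA_n` singularity with `n + 1 = (r₁ + r₂) / a ≥ 3`. -/
def IsKawakitaBlowup {N : ℕ} (r₁ r₂ a : ℕ) (w' : Fin N → ℕ) (Z : Set (Fin N → ℂ)) : Prop :=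
  0 < r₁ ∧ 0 < r₂ ∧ 0 < a ∧ a ∣ r₁ + r₂ ∧ a.Coprime r₁ ∧ a.Coprime r₂ ∧ 3 ≤ (r₁ + r₂) / a ∧
  ∃ g : MvPowerSeries (Fin 2) ℂ, IsConvergent g ∧
    g.weightedOrder ![a, 1] = ((r₁ + r₂ : ℕ) : ℕ∞) ∧
    MvPowerSeries.coeff (Finsupp.single 0 ((r₁ + r₂) / a)) g ≠ 0 ∧
    IsIsolated (fun x : Fin 4 → ℂ => x 0 * x 1 + seriesSum g ![x 2, x 3]) ∧
    BlowupsLocallyEquivalent w' Z ![r₁, r₂, a, 1]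
      {x : Fin 4 → ℂ | x 0 * x 1 + seriesSum g ![x 2, x 3] = 0}

/-! ## Affine hypersurfaces `-x₁² + x₂² + F`

The variables `x₁, x₂, x₃, x₄` have the indices `0, 1, 2, 3`. -/

/-- The polynomial `f = -x₁² + x₂² + F`. -/
def hyp (F : MvPolynomial (Fin 4) ℂ) : MvPolynomial (Fin 4) ℂ :=
  -MvPolynomial.X 0 ^ 2 + MvPolynomial.X 1 ^ 2 + F

/-- The function on affine space given by a polynomial. -/
def polyFun {N : ℕ} (f : MvPolynomial (Fin N) ℂ) (x : Fin N → ℂ) : ℂ := MvPolynomial.eval x f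

/-- `F` after the polynomial coordinate change `σ` of the variables `x₃, x₄`. -/
def changeCoords (σ : MvPolynomial (Fin 2) ℂ ≃ₐ[ℂ] MvPolynomial (Fin 2) ℂ)
    (F : MvPolynomial (Fin 4) ℂ) : MvPolynomial (Fin 4) ℂ :=
  MvPolynomial.aeval ![MvPolynomial.X 0, MvPolynomial.X 1,
    MvPolynomial.rename ![2, 3] (σ (MvPolynomial.X 0)),
    MvPolynomial.rename ![2, 3] (σ (MvPolynomial.X 1))] F

/-- The convergent power series obtained by splitting `f` with respect to `x₁` and then `x₂`:
`f = -((x₁ + q) w)² + ((x₂ + p) v)² + h`. -/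
structure IsSplitting (f : MvPolynomial (Fin 4) ℂ) (q w p v h : MvPowerSeries (Fin 4) ℂ) :
    Prop where
  eq : (f : MvPowerSeries (Fin 4) ℂ) =
    -((MvPowerSeries.X 0 + q) * w) ^ 2 + ((MvPowerSeries.X 1 + p) * v) ^ 2 + h
  conv_q : IsConvergent q
  conv_w : IsConvergent w
  conv_p : IsConvergent p
  conv_v : IsConvergent v
  conv_h : IsConvergent h
  vars_q : InVars {1, 2, 3} q
  vars_p : InVars {2, 3} p
  vars_v : InVars {1, 2, 3} v
  vars_h : InVars {2, 3} h
  order_q : 2 ≤ q.order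
  order_p : 2 ≤ p.order
  order_h : 3 ≤ h.order
  const_w : MvPowerSeries.constantCoeff w = 1
  const_v : MvPowerSeries.constantCoeff v = 1

/-- `min (r, mult p)`. -/
def minMult (r : ℕ) (p : MvPowerSeries (Fin 4) ℂ) : ℕ := (min (r : ℕ∞) p.order).toNat

/-- The weights `(m, min (r₂, mult p), a, 1)` of `x₁, x₂, x₃, x₄`, where `m = min (r₂, mult q)`. -/
def xWeights (r₂ a : ℕ) (q p : MvPowerSeries (Fin 4) ℂ) : Fin 4 → ℕ :=
  ![minMult r₂ q, minMult r₂ p, a, 1]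

/-- The weights `w' = (r₁, r₂, m, min (r₂, mult p), a, 1)` of `α, β, x₁, x₂, x₃, x₄`. -/
def bigWeights (r₁ r₂ a : ℕ) (q p : MvPowerSeries (Fin 4) ℂ) : Fin 6 → ℕ :=
  ![r₁, r₂, minMult r₂ q, minMult r₂ p, a, 1]

/-- The polynomial `(x₁ + q_{<r₁}) w_{<r₁-m}`. -/
def firstPart (r₁ r₂ a : ℕ) (q w p : MvPowerSeries (Fin 4) ℂ) : MvPolynomial (Fin 4) ℂ :=
  (MvPolynomial.X 0 + truncLT (xWeights r₂ a q p) r₁ q) *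
    truncUnitLT (xWeights r₂ a q p) (r₁ - minMult r₂ q) w

/-- The polynomial `(x₂ + p_{<r₁}) v_{<r₁-r₂}`. -/
def secondPart (r₁ r₂ a : ℕ) (q p v : MvPowerSeries (Fin 4) ℂ) : MvPolynomial (Fin 4) ℂ :=
  (MvPolynomial.X 1 + truncLT (xWeights r₂ a q p) r₁ p) *
    truncUnitLT (xWeights r₂ a q p) (r₁ - r₂) v

/-- The polynomial `x₂ + p_{<r₂}`. -/
def betaPart (r₂ a : ℕ) (q p : MvPowerSeries (Fin 4) ℂ) : MvPolynomial (Fin 4) ℂ :=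
  MvPolynomial.X 1 + truncLT (xWeights r₂ a q p) r₂ p

/-- The ideal `I = (f, -α + (x₁ + q_{<r₁}) w_{<r₁-m} + (x₂ + p_{<r₁}) v_{<r₁-r₂},
-β + x₂ + p_{<r₂})` in the variables `α, β, x₁, x₂, x₃, x₄`, with indices `0, …, 5`. -/
def idealI (r₁ r₂ a : ℕ) (F : MvPolynomial (Fin 4) ℂ) (q w p v : MvPowerSeries (Fin 4) ℂ) :
    Ideal (MvPolynomial (Fin 6) ℂ) :=
  Ideal.span {MvPolynomial.rename ![2, 3, 4, 5] (hyp F),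
    -MvPolynomial.X 0 + MvPolynomial.rename ![2, 3, 4, 5]
      (firstPart r₁ r₂ a q w p + secondPart r₁ r₂ a q p v),
    -MvPolynomial.X 1 + MvPolynomial.rename ![2, 3, 4, 5] (betaPart r₂ a q p)}

/-- A polynomial not involving `x₁`, as a polynomial in the five variables `α, β, x₂, x₃, x₄`. -/
def dropX1 : MvPolynomial (Fin 4) ℂ →ₐ[ℂ] MvPolynomial (Fin 5) ℂ :=
  MvPolynomial.aeval ![0, MvPolynomial.X 2, MvPolynomial.X 3, MvPolynomial.X 4]

/-- The ideal `J = (-(α - (x₂ + p_{<r₁}) v_{<r₁-r₂})² + x₂² + F, -β + x₂ + p_{<r₂})` in the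
variables `α, β, x₂, x₃, x₄`, with indices `0, …, 4`, for `F` not involving `x₁`. -/
def idealJ (r₁ r₂ a : ℕ) (F : MvPolynomial (Fin 4) ℂ) (q p v : MvPowerSeries (Fin 4) ℂ) :
    Ideal (MvPolynomial (Fin 5) ℂ) :=
  Ideal.span {-(MvPolynomial.X 0 - dropX1 (secondPart r₁ r₂ a q p v)) ^ 2 +
      MvPolynomial.X 2 ^ 2 + dropX1 F,
    -MvPolynomial.X 1 + dropX1 (betaPart r₂ a q p)}

/-- The ideal `J' = (f, -β + x₂ + p_{<r₂})` in the variables `x₁, β, x₂, x₃, x₄`, with indices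
`0, …, 4`. -/
def idealJ' (r₂ a : ℕ) (F : MvPolynomial (Fin 4) ℂ) (q p : MvPowerSeries (Fin 4) ℂ) :
    Ideal (MvPolynomial (Fin 5) ℂ) :=
  Ideal.span {MvPolynomial.rename ![0, 2, 3, 4] (hyp F),
    -MvPolynomial.X 1 + MvPolynomial.rename ![0, 2, 3, 4] (betaPart r₂ a q p)}

/-- The weights `(r₁, r₂, min (r₂, mult p), a, 1)` for the five variables. -/
def smallWeights (r₁ r₂ a : ℕ) (p : MvPowerSeries (Fin 4) ℂ) : Fin 5 → ℕ :=
  ![r₁, r₂, minMult r₂ p, a, 1]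

/-- The affine schemes `V(f)` and `V(I)` are isomorphic, through an isomorphism of coordinate rings
that sends `xᵢ` to the variable with index `j i`, for all `i` in `S`. -/
def AffineIso {N M : ℕ} (f : MvPolynomial (Fin N) ℂ) (I : Ideal (MvPolynomial (Fin M) ℂ))
    (j : Fin N → Fin M) (S : Set (Fin N)) : Prop :=
  ∃ e : (MvPolynomial (Fin N) ℂ ⧸ Ideal.span {f}) ≃ₐ[ℂ] (MvPolynomial (Fin M) ℂ ⧸ I),
    ∀ i ∈ S, e (Ideal.Quotient.mk _ (MvPolynomial.X i)) =
      Ideal.Quotient.mk _ (MvPolynomial.X (j i))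

end Kawakita

end

noncomputable section
namespace Kawakita

/-! ## Convergent power series and analytic germs -/

/-! Put A = (x₁ + q)w and B = (x₂ + p)v. Since -A² + B² = (A + B)(B - A), a splitting says that in
the analytic coordinates y = (A + B, B - A, x₃, x₄) the hypersurface is y₁y₂ + h(y₃, y₄) = 0, and
the Kawakita blowup is the (r₁, r₂, a, 1)-blowup in these coordinates. They are not polynomial, but
a weighted blowup sees a coordinate only up to terms of at least its own weight. The polynomial α is
A + B up to weight r₁, and β is x₂ + p up to weight r₂, which suffices for the second coordinate B -
A = 2B - (A + B). So the graph of (α, β), with weights r₁ and r₂ on α and β, has the same blowup.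

The comparison rests on `blowupsLocallyEquivalent_of_maps`, which avoids equations of strict
transforms. Two germs between the ambient spaces, whose i-th components have at least the weight of
the i-th target coordinate and which are inverse to each other on Z and Z', lift to the cones over
the weighted blowups. The lifts are inverse to each other off the exceptional divisor, hence by
continuity on the strict transforms. Weights of germs are handled by `WGE`, which is stable under
sums, products, composition and differentiation, and agrees with the weight of the power series when
all weights are positive. The weights of the two maps are computed in
`IsTruncation.wge_liftedCoords` and `IsTruncation.exists_inverse`; `isKawakitaBlowup_of_graph`
combines them.

It remains to control h. By `exists_germIso_of_contactEquivalent`, if x₁x₂ + H and x₁x₂ + g define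
isomorphic germs and g has weight b(n + 1) for the weights (b, 1), then so has H, as a lower bound,
after an analytic change of x₃, x₄: the first two components of the isomorphism are partial
derivatives of the equation, hence of high weight. With b = 1 this gives mult h = n + 1 for every
splitting. For type at least a it gives an analytic coordinate change making the weight of h at
least a(n + 1), and `exists_ptMap_of_germIso` replaces it by a polynomial automorphism, because only
the a-jet of one smooth curve matters. Finally `HasGoodForm` provides the monomial x₃^(n+1): it is
forced if a > 1, and obtained by a generic linear change if a = 1.

If F is free of x₁, comparing the double root x₁ = -q with the roots of x₁² + K, where K is free of
x₁, gives q = 0 and w = 1 (`IsSplitting.inVars_iff`). Then x₁ can be eliminated through α, and for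
r₁ = r₂ it can itself play the role of α. -/

/-- The monomial function `x ↦ x^d`. -/
def mono {N : ℕ} (d : Fin N →₀ ℕ) (x : Fin N → ℂ) : ℂ := ∏ i, x i ^ d i

theorem mono_zero {N : ℕ} (x : Fin N → ℂ) : mono 0 x = 1 := by simp [mono]

theorem mono_add {N : ℕ} (d e : Fin N →₀ ℕ) (x : Fin N → ℂ) :
    mono (d + e) x = mono d x * mono e x := by
  simp [mono, pow_add, Finset.prod_mul_distrib]

theorem mono_single {N : ℕ} (i : Fin N) (k : ℕ) (x : Fin N → ℂ) :
    mono (Finsupp.single i k) x = x i ^ k := by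
  unfold mono
  rw [Finset.prod_eq_single i]
  · simp
  · intro b _ hb
    simp [Finsupp.single_eq_of_ne hb]
  · simp

theorem mono_at_zero {N : ℕ} {d : Fin N →₀ ℕ} (hd : d ≠ 0) : mono d 0 = 0 := by
  obtain ⟨i, hi⟩ := Finsupp.ne_iff.1 hd
  exact Finset.prod_eq_zero (Finset.mem_univ i) (by simpa using hi)

theorem mono_mul_pt {N : ℕ} (d : Fin N →₀ ℕ) (x y : Fin N → ℂ) :
    mono d (fun i => x i * y i) = mono d x * mono d y := by
  simp [mono, mul_pow, Finset.prod_mul_distrib]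

theorem mono_weight_pow {N : ℕ} (w : Fin N → ℕ) (d : Fin N →₀ ℕ) (u : ℂ) :
    mono d (fun i => u ^ w i) = u ^ Finsupp.weight w d := by
  unfold mono
  rw [Finsupp.weight_apply, Finsupp.sum_fintype _ _ (by simp), ← Finset.prod_pow_eq_pow_sum]
  refine Finset.prod_congr rfl fun i _ => ?_
  rw [← pow_mul, smul_eq_mul, mul_comm]

theorem analyticAt_mono {N : ℕ} (d : Fin N →₀ ℕ) (x : Fin N → ℂ) : AnalyticAt ℂ (mono d) x := by
  unfold mono
  exact Finset.analyticAt_fun_prod _ fun i _ =>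
    ((ContinuousLinearMap.proj (R := ℂ) (φ := fun _ : Fin N => ℂ) i).analyticAt x).pow _

theorem norm_mono_le {N : ℕ} (d : Fin N →₀ ℕ) {x : Fin N → ℂ} {r : ℝ} (hx : ‖x‖ ≤ r) :
    ‖mono d x‖ ≤ r ^ d.degree := by
  unfold mono
  rw [norm_prod, Finsupp.degree_eq_sum, ← Finset.prod_pow_eq_pow_sum]
  refine Finset.prod_le_prod (fun _ _ => norm_nonneg _) fun i _ => ?_
  rw [norm_pow]
  exact pow_le_pow_left₀ (norm_nonneg _) ((norm_le_pi_norm x i).trans hx) _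

/-- The power series `p` converges absolutely at `(r, …, r)`. -/
def ConvAt {N : ℕ} (p : MvPowerSeries (Fin N) ℂ) (r : ℝ) : Prop :=
  Summable fun d : Fin N →₀ ℕ => ‖MvPowerSeries.coeff d p‖ * r ^ d.degree

theorem seriesSum_eq {N : ℕ} (p : MvPowerSeries (Fin N) ℂ) (x : Fin N → ℂ) :
    seriesSum p x = ∑' d, MvPowerSeries.coeff d p * mono d x := rfl

theorem ConvAt.summable_norm {N : ℕ} {p : MvPowerSeries (Fin N) ℂ} {r : ℝ} (h : ConvAt p r)
    {x : Fin N → ℂ} (hx : ‖x‖ ≤ r) :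
    Summable fun d => ‖MvPowerSeries.coeff d p * mono d x‖ := by
  refine Summable.of_nonneg_of_le (fun _ => norm_nonneg _) (fun d => ?_) h
  rw [norm_mul]
  exact mul_le_mul_of_nonneg_left (norm_mono_le d hx) (norm_nonneg _)

theorem ConvAt.isConvergent {N : ℕ} {p : MvPowerSeries (Fin N) ℂ} {r : ℝ} (hr : 0 < r)
    (h : ConvAt p r) : IsConvergent p := by
  filter_upwards [Metric.closedBall_mem_nhds (0 : Fin N → ℂ) hr] with x hx
  exact (h.summable_norm (by simpa using hx)).of_norm

/-- At a point whose coordinates all equal a positive real r, the absolute values of the terms are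
exactly those in `ConvAt`, so one such point near the origin suffices. -/
theorem IsConvergent.exists_convAt {N : ℕ} {p : MvPowerSeries (Fin N) ℂ} (h : IsConvergent p) :
    ∃ r : ℝ, 0 < r ∧ ConvAt p r := by
  obtain ⟨ε, hε, hb⟩ := Metric.eventually_nhds_iff.1 h
  refine ⟨ε / 2, by positivity, ?_⟩
  have h1 := (hb (y := fun _ => ((ε / 2 : ℝ) : ℂ)) (by
    rw [dist_zero_right]
    refine lt_of_le_of_lt (pi_norm_const_le _) ?_
    rw [Complex.norm_real, Real.norm_eq_abs, abs_of_pos (by positivity)]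
    linarith)).norm
  refine h1.congr fun d => ?_
  rw [norm_mul, norm_prod, Finsupp.degree_eq_sum, ← Finset.prod_pow_eq_pow_sum]
  congr 1
  refine Finset.prod_congr rfl fun i _ => ?_
  rw [norm_pow, Complex.norm_real, Real.norm_eq_abs, abs_of_pos (by positivity)]

theorem IsConvergent.eventually_summable {N : ℕ} {p : MvPowerSeries (Fin N) ℂ}
    (h : IsConvergent p) :
    ∀ᶠ x in 𝓝 0, Summable fun d => ‖MvPowerSeries.coeff d p * mono d x‖ := by
  obtain ⟨r, hr, h⟩ := h.exists_convAt
  filter_upwards [Metric.closedBall_mem_nhds (0 : Fin N → ℂ) hr] with x hx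
  exact h.summable_norm (by simpa using hx)

theorem IsConvergent.add {N : ℕ} {p q : MvPowerSeries (Fin N) ℂ} (hp : IsConvergent p)
    (hq : IsConvergent q) : IsConvergent (p + q) := by
  filter_upwards [hp, hq] with x h1 h2
  refine (h1.add h2).congr fun d => ?_
  rw [map_add, add_mul]

theorem IsConvergent.neg {N : ℕ} {p : MvPowerSeries (Fin N) ℂ} (hp : IsConvergent p) :
    IsConvergent (-p) := by
  filter_upwards [hp] with x h1
  refine h1.neg.congr fun d => ?_
  rw [map_neg, neg_mul]

theorem IsConvergent.sub {N : ℕ} {p q : MvPowerSeries (Fin N) ℂ} (hp : IsConvergent p)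
    (hq : IsConvergent q) : IsConvergent (p - q) := by
  rw [sub_eq_add_neg]
  exact hp.add hq.neg

theorem seriesSum_add {N : ℕ} {p q : MvPowerSeries (Fin N) ℂ} (hp : IsConvergent p)
    (hq : IsConvergent q) :
    ∀ᶠ x in 𝓝 0, seriesSum (p + q) x = seriesSum p x + seriesSum q x := by
  filter_upwards [hp, hq] with x h1 h2
  rw [seriesSum, seriesSum, seriesSum, ← h1.tsum_add h2]
  exact tsum_congr fun d => by rw [map_add, add_mul]

theorem seriesSum_neg {N : ℕ} (p : MvPowerSeries (Fin N) ℂ) (x : Fin N → ℂ) :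
    seriesSum (-p) x = -seriesSum p x := by
  rw [seriesSum, seriesSum, ← tsum_neg]
  exact tsum_congr fun d => by rw [map_neg, neg_mul]

theorem seriesSum_sub {N : ℕ} {p q : MvPowerSeries (Fin N) ℂ} (hp : IsConvergent p)
    (hq : IsConvergent q) :
    ∀ᶠ x in 𝓝 0, seriesSum (p - q) x = seriesSum p x - seriesSum q x := by
  filter_upwards [seriesSum_add hp hq.neg] with x h
  rw [sub_eq_add_neg, h, seriesSum_neg, sub_eq_add_neg]

theorem IsConvergent.mul {N : ℕ} {p q : MvPowerSeries (Fin N) ℂ} (hp : IsConvergent p)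
    (hq : IsConvergent q) : IsConvergent (p * q) := by
  classical
  filter_upwards [hp.eventually_summable, hq.eventually_summable] with x h1 h2
  refine (summable_sum_mul_antidiagonal_of_summable_mul
    (summable_mul_of_summable_norm h1 h2)).congr fun d => ?_
  rw [MvPowerSeries.coeff_mul, Finset.sum_mul]
  refine Finset.sum_congr rfl fun e he => ?_
  rw [← Finset.HasAntidiagonal.mem_antidiagonal.1 he]
  change _ = _ * mono (e.1 + e.2) x
  rw [mono_add]
  ring

theorem seriesSum_mul {N : ℕ} {p q : MvPowerSeries (Fin N) ℂ} (hp : IsConvergent p)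
    (hq : IsConvergent q) :
    ∀ᶠ x in 𝓝 0, seriesSum (p * q) x = seriesSum p x * seriesSum q x := by
  classical
  filter_upwards [hp.eventually_summable, hq.eventually_summable] with x h1 h2
  have h3 := summable_mul_of_summable_norm h1 h2
  rw [seriesSum_eq, seriesSum_eq, seriesSum_eq,
    h1.of_norm.tsum_mul_tsum_eq_tsum_sum_antidiagonal h2.of_norm h3]
  refine tsum_congr fun d => ?_
  rw [MvPowerSeries.coeff_mul, Finset.sum_mul]
  refine Finset.sum_congr rfl fun e he => ?_
  rw [← Finset.HasAntidiagonal.mem_antidiagonal.1 he, mono_add]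
  ring

theorem hasSum_coe {N : ℕ} (P : MvPolynomial (Fin N) ℂ) (x : Fin N → ℂ) :
    HasSum (fun d => MvPowerSeries.coeff d (P : MvPowerSeries (Fin N) ℂ) * ∏ i, x i ^ d i)
      (MvPolynomial.eval x P) := by
  rw [MvPolynomial.eval_eq']
  simp only [MvPolynomial.coeff_coe]
  refine hasSum_sum_of_ne_finset_zero fun d hd => ?_
  rw [MvPolynomial.notMem_support_iff.1 hd, zero_mul]

theorem isConvergent_coe {N : ℕ} (P : MvPolynomial (Fin N) ℂ) :
    IsConvergent (P : MvPowerSeries (Fin N) ℂ) :=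
  Filter.Eventually.of_forall fun x => (hasSum_coe P x).summable

theorem seriesSum_coe {N : ℕ} (P : MvPolynomial (Fin N) ℂ) (x : Fin N → ℂ) :
    seriesSum (P : MvPowerSeries (Fin N) ℂ) x = MvPolynomial.eval x P :=
  (hasSum_coe P x).tsum_eq

theorem isConvergent_zero {N : ℕ} : IsConvergent (0 : MvPowerSeries (Fin N) ℂ) := by
  simpa using isConvergent_coe (0 : MvPolynomial (Fin N) ℂ)

theorem seriesSum_zero {N : ℕ} (x : Fin N → ℂ) :
    seriesSum (0 : MvPowerSeries (Fin N) ℂ) x = 0 := by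
  simpa using seriesSum_coe (0 : MvPolynomial (Fin N) ℂ) x

theorem seriesSum_at_zero {N : ℕ} (p : MvPowerSeries (Fin N) ℂ) :
    seriesSum p 0 = MvPowerSeries.constantCoeff p := by
  rw [seriesSum_eq, tsum_eq_single 0]
  · rw [mono_zero, mul_one, MvPowerSeries.coeff_zero_eq_constantCoeff_apply]
  · intro d hd
    rw [mono_at_zero hd, mul_zero]

theorem isConvergent_sum {N : ℕ} {ι : Type*} (s : Finset ι) (p : ι → MvPowerSeries (Fin N) ℂ)
    (h : ∀ i ∈ s, IsConvergent (p i)) : IsConvergent (∑ i ∈ s, p i) := by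
  classical
  induction s using Finset.induction_on with
  | empty => simpa using isConvergent_zero
  | insert i s hi ih =>
    rw [Finset.sum_insert hi]
    exact (h i (by simp)).add (ih fun j hj => h j (by simp [hj]))

theorem seriesSum_sum {N : ℕ} {ι : Type*} (s : Finset ι) (p : ι → MvPowerSeries (Fin N) ℂ)
    (h : ∀ i ∈ s, IsConvergent (p i)) :
    ∀ᶠ x in 𝓝 0, seriesSum (∑ i ∈ s, p i) x = ∑ i ∈ s, seriesSum (p i) x := by
  classical
  induction s using Finset.induction_on with
  | empty => simp [seriesSum_zero]
  | insert i s hi ih =>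
    simp only [Finset.sum_insert hi]
    filter_upwards [seriesSum_add (h i (by simp))
      (isConvergent_sum s p fun j hj => h j (by simp [hj])),
      ih fun j hj => h j (by simp [hj])] with x h1 h2
    rw [h1, h2]

/-! ### Homogeneous parts, and the passage between power series and analytic germs -/

/-- The exponents of degree `n`. -/
def degFinset (N n : ℕ) : Finset (Fin N →₀ ℕ) := Finset.finsuppAntidiag Finset.univ n

theorem mem_degFinset {N n : ℕ} {d : Fin N →₀ ℕ} : d ∈ degFinset N n ↔ d.degree = n := by
  rw [degFinset, Finset.mem_finsuppAntidiag, Finsupp.degree_eq_sum]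
  simp

theorem hasSum_degFinset {N : ℕ} {F : (Fin N →₀ ℕ) → ℂ} {a : ℂ} (h : HasSum F a) :
    HasSum (fun n => ∑ d ∈ degFinset N n, F d) a := by
  have h1 := h.tsum_fiberwise (fun d => d.degree)
  have hs : ∀ n, (fun d : Fin N →₀ ℕ => d.degree) ⁻¹' {n} =
      (degFinset N n : Set (Fin N →₀ ℕ)) := by
    intro n
    ext d
    simp [mem_degFinset]
  have h2 : (fun n => ∑ d ∈ degFinset N n, F d) =
      fun n => ∑' b : ((fun d : Fin N →₀ ℕ => d.degree) ⁻¹' {n}), F b := by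
    funext n
    rw [hs]
    exact (Finset.tsum_subtype' (degFinset N n) F).symm
  rw [h2]
  exact h1

theorem summable_of_degFinset {N : ℕ} {F : (Fin N →₀ ℕ) → ℝ} (h0 : ∀ d, 0 ≤ F d)  :
    Summable F ↔ Summable (fun n => ∑ d ∈ degFinset N n, F d) := by
  have hs : ∀ n, (fun d : Fin N →₀ ℕ => d.degree) ⁻¹' {n} = (degFinset N n : Set (Fin N →₀ ℕ)) := by
    intro n
    ext d
    simp [mem_degFinset]
  rw [summable_partition (s := fun n => (degFinset N n : Set (Fin N →₀ ℕ))) h0]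
  · constructor
    · rintro ⟨-, h⟩
      exact h.congr fun n => Finset.tsum_subtype' (degFinset N n) F
    · intro h
      refine ⟨fun n => ?_, h.congr fun n => (Finset.tsum_subtype' (degFinset N n) F).symm⟩
      exact (degFinset N n).summable F
  · intro d
    exact ⟨d.degree, by simp [mem_degFinset], fun n hn => by
      have := mem_degFinset.1 (Finset.mem_coe.1 hn)
      exact this.symm⟩

/-- The exponent of the monomial `∏ k, x (j k)`. -/
def cnt {N n : ℕ} (j : Fin n → Fin N) : Fin N →₀ ℕ := ∑ k, Finsupp.single (j k) 1

theorem mono_cnt {N n : ℕ} (j : Fin n → Fin N) (x : Fin N → ℂ) :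
    mono (cnt j) x = ∏ k, x (j k) := by
  have : ∀ s : Finset (Fin n), mono (∑ k ∈ s, Finsupp.single (j k) 1) x = ∏ k ∈ s, x (j k) := by
    intro s
    induction s using Finset.induction_on with
    | empty => simp [mono_zero]
    | insert i s hi ih => rw [Finset.sum_insert hi, Finset.prod_insert hi, mono_add, ih,
        mono_single, pow_one]
  exact this _

theorem degree_cnt {N n : ℕ} (j : Fin n → Fin N) : (cnt j).degree = n := by
  simp [cnt, map_sum]

theorem exists_cnt {N : ℕ} (d : Fin N →₀ ℕ) : ∀ {n : ℕ}, d.degree = n →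
    ∃ j : Fin n → Fin N, cnt j = d := by
  intro n
  induction n generalizing d with
  | zero =>
    intro h
    refine ⟨Fin.elim0, ?_⟩
    rw [(Finsupp.degree_eq_zero_iff d).1 h]
    simp [cnt]
  | succ n ih =>
    intro h
    have hd : d ≠ 0 := by
      rintro rfl
      simp at h
    obtain ⟨i, hi⟩ := Finsupp.ne_iff.1 hd
    have hle : Finsupp.single i 1 ≤ d := by
      rw [Finsupp.single_le_iff]
      exact Nat.one_le_iff_ne_zero.2 hi
    have hsum : Finsupp.single i 1 + (d - Finsupp.single i 1) = d := add_tsub_cancel_of_le hle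
    obtain ⟨j, hj⟩ := ih (d - Finsupp.single i 1) (by
      have := congrArg Finsupp.degree hsum
      rw [map_add, Finsupp.degree_single, h] at this
      omega)
    refine ⟨Fin.cons i j, ?_⟩
    rw [cnt, Fin.sum_univ_succ]
    simp only [Fin.cons_zero, Fin.cons_succ]
    rw [← hsum, ← hj, cnt]

/-- The multilinear map underlying the monomial `∏ k, x (j k)`. -/
def monoMul {N n : ℕ} (j : Fin n → Fin N) :
    ContinuousMultilinearMap ℂ (fun _ : Fin n => Fin N → ℂ) ℂ :=
  (ContinuousMultilinearMap.mkPiAlgebra ℂ (Fin n) ℂ).compContinuousLinearMap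
    fun k => ContinuousLinearMap.proj (j k)

theorem monoMul_apply {N n : ℕ} (j : Fin n → Fin N) (x : Fin N → ℂ) :
    monoMul j (fun _ => x) = mono (cnt j) x := by
  rw [mono_cnt]
  simp [monoMul]

theorem norm_monoMul_le {N n : ℕ} (j : Fin n → Fin N) : ‖monoMul j‖ ≤ 1 := by
  refine ContinuousMultilinearMap.opNorm_le_bound zero_le_one fun m => ?_
  simp only [monoMul, ContinuousMultilinearMap.compContinuousLinearMap_apply,
    ContinuousMultilinearMap.mkPiAlgebra_apply, norm_prod, one_mul]
  exact Finset.prod_le_prod (fun _ _ => norm_nonneg _) fun k _ => norm_le_pi_norm (m k) (j k)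

open Classical in
/-- The formal multilinear series of a power series. -/
def multilinearSeries {N : ℕ} (p : MvPowerSeries (Fin N) ℂ) :
    FormalMultilinearSeries ℂ (Fin N → ℂ) ℂ := fun n =>
  ∑ d ∈ degFinset N n, MvPowerSeries.coeff d p •
    -- Any word with exponent d will do, since only values on the diagonal matter and symmetry is
    -- not required. The value 0 never occurs for d of degree n.
    if h : ∃ j : Fin n → Fin N, cnt j = d then monoMul h.choose else 0

theorem multilinearSeries_apply {N : ℕ} (p : MvPowerSeries (Fin N) ℂ) (n : ℕ) (x : Fin N → ℂ) :
    multilinearSeries p n (fun _ => x) =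
      ∑ d ∈ degFinset N n, MvPowerSeries.coeff d p * mono d x := by
  rw [multilinearSeries, sum_apply]
  refine Finset.sum_congr rfl fun d hd => ?_
  have h := exists_cnt d (mem_degFinset.1 hd)
  rw [dif_pos h, smul_apply, monoMul_apply, h.choose_spec, smul_eq_mul]

theorem norm_multilinearSeries_le {N : ℕ} (p : MvPowerSeries (Fin N) ℂ) (n : ℕ) :
    ‖multilinearSeries p n‖ ≤ ∑ d ∈ degFinset N n, ‖MvPowerSeries.coeff d p‖ := by
  refine (norm_sum_le _ _).trans (Finset.sum_le_sum fun d hd => ?_)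
  rw [dif_pos (exists_cnt d (mem_degFinset.1 hd)), norm_smul]
  exact mul_le_of_le_one_right (norm_nonneg _) (norm_monoMul_le _)

theorem ConvAt.hasFPowerSeriesOnBall {N : ℕ} {p : MvPowerSeries (Fin N) ℂ} {r : NNReal}
    (hr : 0 < r) (h : ConvAt p r) :
    HasFPowerSeriesOnBall (seriesSum p) (multilinearSeries p) 0 r where
  r_le := by
    refine FormalMultilinearSeries.le_radius_of_summable _ ?_
    refine Summable.of_nonneg_of_le (fun _ => by positivity) (fun n => ?_)
      ((summable_of_degFinset (fun d => by positivity)).1 h)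
    refine (mul_le_mul_of_nonneg_right (norm_multilinearSeries_le p n) (by positivity)).trans ?_
    rw [Finset.sum_mul]
    refine Finset.sum_le_sum fun d hd => ?_
    rw [mem_degFinset.1 hd]
  r_pos := by simpa using hr
  hasSum := by
    intro y hy
    simp only [multilinearSeries_apply, zero_add]
    refine hasSum_degFinset (h.summable_norm ?_).of_norm.hasSum
    rw [Metric.mem_eball, edist_zero_right] at hy
    have : ‖y‖₊ < r := by simpa using hy
    exact_mod_cast this.le

theorem IsConvergent.analyticAt {N : ℕ} {p : MvPowerSeries (Fin N) ℂ} (h : IsConvergent p) :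
    AnalyticAt ℂ (seriesSum p) 0 := by
  obtain ⟨r, hr, h⟩ := h.exists_convAt
  lift r to NNReal using hr.le
  exact (h.hasFPowerSeriesOnBall (by exact_mod_cast hr)).analyticAt

/-- Expanding the n-th multilinear term at x = ∑ xᵢeᵢ gives one summand for each word of length n in
the basis vectors; the coefficient at d collects the words with exponent d. -/
theorem exists_seriesSum_eq {N : ℕ} {f : (Fin N → ℂ) → ℂ} (hf : AnalyticAt ℂ f 0) :
    ∃ p : MvPowerSeries (Fin N) ℂ, IsConvergent p ∧ f =ᶠ[𝓝 0] seriesSum p := by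
  classical
  obtain ⟨q, hq⟩ := hf
  let e : Fin N → (Fin N → ℂ) := fun i => Pi.single i 1
  let p : MvPowerSeries (Fin N) ℂ := fun d =>
    ∑ j : Fin d.degree → Fin N with cnt j = d, q d.degree (fun k => e (j k))
  have hpc : ∀ (n : ℕ) (d : Fin N →₀ ℕ), d ∈ degFinset N n → MvPowerSeries.coeff d p =
      ∑ j : Fin n → Fin N with cnt j = d, q n (fun k => e (j k)) := by
    intro n d hd
    obtain rfl := mem_degFinset.1 hd
    rfl
  have hmaps : ∀ n : ℕ, ∀ j ∈ (Finset.univ : Finset (Fin n → Fin N)), cnt j ∈ degFinset N n :=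
    fun n j _ => mem_degFinset.2 (degree_cnt j)
  have hval : ∀ (n : ℕ) (x : Fin N → ℂ), q n (fun _ => x) =
      ∑ d ∈ degFinset N n, MvPowerSeries.coeff d p * mono d x := by
    intro n x
    have hx : x = ∑ i, x i • e i := by
      conv_lhs => rw [pi_eq_sum_univ' x]
    conv_lhs => rw [hx]
    rw [ContinuousMultilinearMap.map_sum, ← Finset.sum_fiberwise_of_maps_to (hmaps n)]
    refine Finset.sum_congr rfl fun d hd => ?_
    rw [hpc n d hd, Finset.sum_mul]
    refine Finset.sum_congr rfl fun j hj => ?_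
    rw [ContinuousMultilinearMap.map_smul_univ, smul_eq_mul, mul_comm, ← mono_cnt,
      (Finset.mem_filter.1 hj).2]
  have hnorm : ∀ n : ℕ, ∑ d ∈ degFinset N n, ‖MvPowerSeries.coeff d p‖ ≤ ‖q n‖ * N ^ n := by
    intro n
    calc _ ≤ ∑ d ∈ degFinset N n, ∑ j : Fin n → Fin N with cnt j = d, ‖q n‖ := by
          refine Finset.sum_le_sum fun d hd => ?_
          rw [hpc n d hd]
          refine (norm_sum_le _ _).trans (Finset.sum_le_sum fun j _ => ?_)
          refine ((q n).le_opNorm _).trans (mul_le_of_le_one_right (norm_nonneg _) ?_)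
          refine Finset.prod_le_one (fun _ _ => norm_nonneg _) fun k _ => ?_
          exact (Pi.norm_single _).le.trans (by simp)
      _ = ∑ _j : Fin n → Fin N, ‖q n‖ :=
          Finset.sum_fiberwise_of_maps_to (hmaps n) fun _ => ‖q n‖
      _ = ‖q n‖ * N ^ n := by simp [mul_comm]
  obtain ⟨r, hr0, hr⟩ := ENNReal.lt_iff_exists_nnreal_btwn.1 hq.radius_pos
  have hr0' : 0 < r := by simpa using hr0
  -- There are N ^ n words of length n, so the radius shrinks by a factor of about N; the added 1
  -- avoids division by zero when N = 0.
  have hconv : ConvAt p (r / (N + 1)) := by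
    rw [ConvAt, summable_of_degFinset (fun d => by positivity)]
    refine Summable.of_nonneg_of_le (fun n => Finset.sum_nonneg fun d _ => by positivity)
      (fun n => ?_) (q.summable_norm_mul_pow hr)
    calc _ = (∑ d ∈ degFinset N n, ‖MvPowerSeries.coeff d p‖) * ((r : ℝ) / (N + 1)) ^ n := by
          rw [Finset.sum_mul]
          exact Finset.sum_congr rfl fun d hd => by rw [mem_degFinset.1 hd]
      _ ≤ ‖q n‖ * N ^ n * ((r : ℝ) / (N + 1)) ^ n := by gcongr; exact hnorm n
      _ = ‖q n‖ * (N * ((r : ℝ) / (N + 1))) ^ n := by rw [mul_pow, mul_assoc]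
      _ ≤ ‖q n‖ * (r : ℝ) ^ n := by
          gcongr
          rw [mul_div_assoc', div_le_iff₀ (by positivity), mul_comm]
          exact mul_le_mul_of_nonneg_left (by linarith) r.2
  refine ⟨p, hconv.isConvergent (by positivity), ?_⟩
  obtain ⟨ρ, hρ⟩ := hq
  have h1 := Metric.eball_mem_nhds (0 : Fin N → ℂ) hρ.r_pos
  have h2 := Metric.closedBall_mem_nhds (0 : Fin N → ℂ) (ε := r / (N + 1)) (by positivity)
  filter_upwards [h1, h2] with x hx1 hx2
  have h3 := hρ.hasSum hx1
  simp only [hval, zero_add] at h3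
  exact h3.unique (hasSum_degFinset (hconv.summable_norm (by simpa using hx2)).of_norm.hasSum)

end Kawakita
end

noncomputable section
namespace Kawakita

/-! ## Weights of analytic germs -/

/-- The germ of `f` at the origin is analytic of `w`-weight at least `k`: it is a combination of
monomials of weight at least `k` with analytic coefficients. Weights equal to `0` are allowed. -/
def WGE {N : ℕ} (w : Fin N → ℕ) (k : ℕ) (f : (Fin N → ℂ) → ℂ) : Prop :=
  ∃ (S : Finset (Fin N →₀ ℕ)) (c : (Fin N →₀ ℕ) → (Fin N → ℂ) → ℂ),
    (∀ d ∈ S, AnalyticAt ℂ (c d) 0 ∧ k ≤ Finsupp.weight w d) ∧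
    f =ᶠ[𝓝 0] fun x => ∑ d ∈ S, c d x * mono d x

theorem analyticAt_coord {N : ℕ} (i : Fin N) (x : Fin N → ℂ) :
    AnalyticAt ℂ (fun x : Fin N → ℂ => x i) x :=
  (ContinuousLinearMap.proj (R := ℂ) (φ := fun _ : Fin N => ℂ) i).analyticAt x

namespace WGE

variable {N M : ℕ} {w : Fin N → ℕ} {k l : ℕ} {f g : (Fin N → ℂ) → ℂ}

theorem congr (hf : WGE w k f) (h : g =ᶠ[𝓝 0] f) : WGE w k g := by
  obtain ⟨S, c, h1, h2⟩ := hf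
  exact ⟨S, c, h1, h.trans h2⟩

theorem analyticAt (hf : WGE w k f) : AnalyticAt ℂ f 0 := by
  obtain ⟨S, c, h1, h2⟩ := hf
  refine AnalyticAt.congr ?_ h2.symm
  exact Finset.analyticAt_fun_sum _ fun d hd => (h1 d hd).1.fun_mul (analyticAt_mono d 0)

theorem of_weight (hf : WGE w k f) {w' : Fin N → ℕ}
    (h : ∀ d : Fin N →₀ ℕ, k ≤ Finsupp.weight w d → l ≤ Finsupp.weight w' d) : WGE w' l f := by
  obtain ⟨S, c, h1, h2⟩ := hf
  exact ⟨S, c, fun d hd => ⟨(h1 d hd).1, h d (h1 d hd).2⟩, h2⟩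

theorem le (hf : WGE w k f) (h : l ≤ k) : WGE w l f := hf.of_weight fun _ hd => h.trans hd

theorem zero : WGE w k (fun _ => 0) := ⟨∅, fun _ _ => 0, by simp, by simp⟩

theorem term {c : (Fin N → ℂ) → ℂ} (hc : AnalyticAt ℂ c 0) {d : Fin N →₀ ℕ}
    (h : k ≤ Finsupp.weight w d) : WGE w k (fun x => c x * mono d x) :=
  ⟨{d}, fun _ => c, by simpa using ⟨hc, h⟩, by simp⟩

theorem of_analyticAt (hf : AnalyticAt ℂ f 0) : WGE w 0 f :=
  (term (w := w) (k := 0) (d := 0) hf (Nat.zero_le _)).congr (by simp [mono_zero])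

theorem add (hf : WGE w k f) (hg : WGE w k g) : WGE w k (fun x => f x + g x) := by
  classical
  obtain ⟨S, c, h1, h2⟩ := hf
  obtain ⟨T, b, h3, h4⟩ := hg
  refine ⟨S ∪ T, fun d x => (if d ∈ S then c d x else 0) + if d ∈ T then b d x else 0,
    fun d hd => ⟨AnalyticAt.fun_add ?_ ?_, ?_⟩, ?_⟩
  · by_cases h : d ∈ S
    · simpa [h] using (h1 d h).1
    · simpa [h] using analyticAt_const
  · by_cases h : d ∈ T
    · simpa [h] using (h3 d h).1
    · simpa [h] using analyticAt_const
  · rcases Finset.mem_union.1 hd with h | h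
    · exact (h1 d h).2
    · exact (h3 d h).2
  · filter_upwards [h2, h4] with x hx1 hx2
    rw [hx1, hx2]
    simp only [add_mul, Finset.sum_add_distrib, ite_mul, zero_mul]
    congr 1
    · rw [Finset.sum_ite_mem, Finset.inter_eq_right.2 Finset.subset_union_left]
    · rw [Finset.sum_ite_mem, Finset.inter_eq_right.2 Finset.subset_union_right]

theorem sum {ι : Type*} (s : Finset ι) {F : ι → (Fin N → ℂ) → ℂ}
    (h : ∀ i ∈ s, WGE w k (F i)) : WGE w k (fun x => ∑ i ∈ s, F i x) := by
  classical
  induction s using Finset.induction_on with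
  | empty => simpa using zero
  | insert i s hi ih =>
    simp only [Finset.sum_insert hi]
    exact (h i (by simp)).add (ih fun j hj => h j (by simp [hj]))

theorem mul (hf : WGE w k f) (hg : WGE w l g) : WGE w (k + l) (fun x => f x * g x) := by
  obtain ⟨S, c, h1, h2⟩ := hf
  obtain ⟨T, b, h3, h4⟩ := hg
  have : WGE w (k + l) fun x => ∑ d ∈ S, ∑ e ∈ T, (c d x * b e x) * mono (d + e) x :=
    sum _ fun d hd => sum _ fun e he => term ((h1 d hd).1.fun_mul (h3 e he).1) (by
      rw [map_add]
      exact add_le_add (h1 d hd).2 (h3 e he).2)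
  refine this.congr ?_
  filter_upwards [h2, h4] with x hx1 hx2
  rw [hx1, hx2, Finset.sum_mul_sum]
  refine Finset.sum_congr rfl fun d _ => Finset.sum_congr rfl fun e _ => ?_
  rw [mono_add]
  ring

theorem mul_left (hf : WGE w k f) (hg : AnalyticAt ℂ g 0) : WGE w k (fun x => g x * f x) := by
  simpa using (of_analyticAt (w := w) hg).mul hf

theorem mul_right (hf : WGE w k f) (hg : AnalyticAt ℂ g 0) : WGE w k (fun x => f x * g x) := by
  simpa using hf.mul (of_analyticAt (w := w) hg)

theorem const_mul (hf : WGE w k f) (a : ℂ) : WGE w k (fun x => a * f x) :=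
  hf.mul_left analyticAt_const

theorem neg (hf : WGE w k f) : WGE w k (fun x => -f x) := by simpa using hf.const_mul (-1)

theorem sub (hf : WGE w k f) (hg : WGE w k g) : WGE w k (fun x => f x - g x) := by
  simpa [sub_eq_add_neg] using hf.add hg.neg

theorem pow (hf : WGE w k f) (n : ℕ) : WGE w (n * k) (fun x => f x ^ n) := by
  induction n with
  | zero => simpa using of_analyticAt (w := w) (f := fun _ => (1 : ℂ)) analyticAt_const
  | succ n ih => simpa only [pow_succ, Nat.succ_mul] using ih.mul hf

theorem prod {ι : Type*} (s : Finset ι) {F : ι → (Fin N → ℂ) → ℂ} {m : ι → ℕ}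
    (h : ∀ i ∈ s, WGE w (m i) (F i)) : WGE w (∑ i ∈ s, m i) (fun x => ∏ i ∈ s, F i x) := by
  classical
  induction s using Finset.induction_on with
  | empty => simpa using of_analyticAt (w := w) (f := fun _ => (1 : ℂ)) analyticAt_const
  | insert i s hi ih =>
    simp only [Finset.sum_insert hi, Finset.prod_insert hi]
    exact (h i (by simp)).mul (ih fun j hj => h j (by simp [hj]))

theorem mono_self (d : Fin N →₀ ℕ) : WGE w (Finsupp.weight w d) (mono d) := by
  simpa using term (w := w) (c := fun _ => (1 : ℂ)) analyticAt_const (le_refl (Finsupp.weight w d))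

theorem coord (i : Fin N) : WGE w (w i) (fun x => x i) := by
  have := mono_self (w := w) (Finsupp.single i 1)
  simpa [mono_single, Finsupp.weight_single, funext_iff, Function.comp_def] using
    this.congr (g := fun x => x i) (by simp [Filter.EventuallyEq, mono_single])

/-- A monomial ∏ xᵢ^dᵢ pulls back to ∏ φᵢ^dᵢ, of weight at least ∑ dᵢw'ᵢ. Since weights may be 0,
the weight conditions do not imply φ 0 = 0, which is needed to compose the coefficients. -/
theorem comp {w' : Fin M → ℕ} {F : (Fin M → ℂ) → ℂ} {φ : (Fin N → ℂ) → Fin M → ℂ}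
    (hF : WGE w' k F) (h0 : φ 0 = 0) (hφ : ∀ i, WGE w (w' i) (fun x => φ x i)) :
    WGE w k (fun x => F (φ x)) := by
  obtain ⟨S, c, h1, h2⟩ := hF
  have hφa : AnalyticAt ℂ φ 0 := analyticAt_pi_iff.2 fun i => (hφ i).analyticAt
  have ht : Filter.Tendsto φ (𝓝 0) (𝓝 0) := by simpa [h0] using hφa.continuousAt.tendsto
  have : WGE w k fun x => ∑ d ∈ S, c d (φ x) * ∏ i, φ x i ^ d i := by
    refine sum _ fun d hd => ?_
    refine mul_left (le (prod _ fun i _ => (hφ i).pow (d i)) ?_) ?_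
    · refine (h1 d hd).2.trans (le_of_eq ?_)
      rw [Finsupp.weight_apply, Finsupp.sum_fintype _ _ (by simp)]
      rfl
    · exact AnalyticAt.fun_comp (by rw [h0]; exact (h1 d hd).1) hφa
  exact this.congr (ht.eventually h2)

theorem at_zero (hf : WGE w k f) (hk : 1 ≤ k) : f 0 = 0 := by
  obtain ⟨S, c, h1, h2⟩ := hf
  rw [h2.self_of_nhds]
  refine Finset.sum_eq_zero fun d hd => ?_
  rw [mono_at_zero, mul_zero]
  rintro rfl
  have := (h1 0 hd).2
  simp at this
  omega

/-- Along the weighted curve through x a monomial of weight e becomes a multiple of t^e. Positivity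
of the weights makes the curve tend to the origin. This is the test by which weighted homogeneous
parts are detected below. -/
theorem exists_curve (hw : ∀ i, w i ≠ 0) (hf : WGE w k f) (x : Fin N → ℂ) :
    ∃ G : ℂ → ℂ, ContinuousAt G 0 ∧ ∀ᶠ t in 𝓝 0, f (fun i => t ^ w i * x i) = t ^ k * G t := by
  obtain ⟨S, c, h1, h2⟩ := hf
  have hφ : ContinuousAt (fun (t : ℂ) (i : Fin N) => t ^ w i * x i) 0 := by fun_prop
  have h0 : (fun i : Fin N => (0 : ℂ) ^ w i * x i) = 0 := by
    funext i
    simp [hw i]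
  have ht : Filter.Tendsto (fun (t : ℂ) (i : Fin N) => t ^ w i * x i) (𝓝 0) (𝓝 0) := by
    have := hφ.tendsto
    rwa [h0] at this
  refine ⟨fun t => ∑ d ∈ S, c d (fun i => t ^ w i * x i) *
    (t ^ (Finsupp.weight w d - k) * mono d x), ?_, ?_⟩
  · refine tendsto_finsetSum _ fun d hd => ?_
    refine ContinuousAt.mul ?_ (by fun_prop)
    refine ContinuousAt.comp' (f := fun (t : ℂ) (i : Fin N) => t ^ w i * x i) ?_ hφ
    rw [h0]
    exact (h1 d hd).1.continuousAt
  · filter_upwards [ht.eventually h2] with t ht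
    rw [ht, Finset.mul_sum]
    refine Finset.sum_congr rfl fun d hd => ?_
    rw [mono_mul_pt, mono_weight_pow]
    nth_rewrite 1 [← Nat.add_sub_cancel' (h1 d hd).2]
    rw [pow_add]
    ring

end WGE

/-! ### Comparison of `WGE` with the weight of a power series -/

/-- A single exponent above k at a variable of nonzero weight contributes at least k even after
capping, and exponents at variables of weight 0 contribute nothing. Hence finitely many capped
monomials generate all monomials of weight at least k. -/
theorem weight_inf_const {N : ℕ} (w : Fin N → ℕ) (k : ℕ) {d : Fin N →₀ ℕ}
    (h : k ≤ Finsupp.weight w d) :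
    k ≤ Finsupp.weight w (d ⊓ Finsupp.equivFunOnFinite.symm fun _ => k) := by
  have hs : ∀ e : Fin N →₀ ℕ, Finsupp.weight w e = ∑ i, e i * w i := fun e => by
    rw [Finsupp.weight_apply, Finsupp.sum_fintype _ _ (by simp)]
    rfl
  simp only [hs, Finsupp.inf_apply, Finsupp.equivFunOnFinite_symm_apply_apply] at h ⊢
  by_cases hd : ∃ i, k < d i ∧ w i ≠ 0
  · obtain ⟨i, hi, hwi⟩ := hd
    refine le_trans ?_ (Finset.single_le_sum (fun _ _ => Nat.zero_le _) (Finset.mem_univ i))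
    rw [min_eq_right hi.le]
    exact Nat.le_mul_of_pos_right _ (Nat.pos_of_ne_zero hwi)
  · push Not at hd
    refine h.trans (Finset.sum_le_sum fun i _ => ?_)
    by_cases hi : k < d i
    · simp [hd i hi]
    · rw [min_eq_left (not_lt.1 hi)]

/-- The terms x^d are grouped by the capped exponent e = d ⊓ K. Each of the finitely many groups is
x^e times a convergent series, and only groups with e of weight at least k occur. -/
theorem IsConvergent.wge {N : ℕ} {w : Fin N → ℕ} {k : ℕ} {p : MvPowerSeries (Fin N) ℂ}
    (hp : IsConvergent p) (hk : (k : ℕ∞) ≤ p.weightedOrder w) : WGE w k (seriesSum p) := by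
  classical
  set K : Fin N →₀ ℕ := Finsupp.equivFunOnFinite.symm fun _ => k with hK
  let S : Finset (Fin N →₀ ℕ) := (Finset.Iic K).filter fun d => k ≤ Finsupp.weight w d
  let P : (Fin N →₀ ℕ) → MvPowerSeries (Fin N) ℂ := fun e f =>
    if (f + e) ⊓ K = e then MvPowerSeries.coeff (f + e) p else 0
  have hPc : ∀ e f, MvPowerSeries.coeff f (P e) =
      if (f + e) ⊓ K = e then MvPowerSeries.coeff (f + e) p else 0 := fun e f => rfl
  have hconv : ∀ e, IsConvergent (P e) := by
    intro e
    obtain ⟨r, hr, h⟩ := hp.exists_convAt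
    refine ConvAt.isConvergent hr ?_
    have h1 := (h.comp_injective (add_left_injective e)).mul_left (r ^ e.degree)⁻¹
    refine Summable.of_nonneg_of_le (fun _ => by positivity) (fun f => ?_) h1
    rw [hPc]
    simp only [Function.comp_apply, map_add, pow_add]
    rw [show (r ^ e.degree)⁻¹ * (‖MvPowerSeries.coeff (f + e) p‖ * (r ^ f.degree * r ^ e.degree)) =
      ‖MvPowerSeries.coeff (f + e) p‖ * r ^ f.degree by field_simp]
    gcongr
    split_ifs <;> simp
  have hsum : p = ∑ e ∈ S, ((MvPolynomial.monomial e (1 : ℂ) : MvPolynomial (Fin N) ℂ) :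
      MvPowerSeries (Fin N) ℂ) * P e := by
    ext d
    rw [map_sum]
    simp only [MvPolynomial.coe_monomial, MvPowerSeries.coeff_monomial_mul, one_mul, hPc]
    have h1 : ∀ e ∈ S, (if e ≤ d then if (d - e + e) ⊓ K = e then
        MvPowerSeries.coeff (d - e + e) p else 0 else 0) =
        if e = d ⊓ K then MvPowerSeries.coeff d p else 0 := by
      intro e _
      by_cases he : e ≤ d
      · rw [if_pos he, tsub_add_cancel_of_le he]
        simp only [eq_comm]
      · rw [if_neg he, if_neg]
        rintro rfl
        exact he inf_le_left
    rw [Finset.sum_congr rfl h1, Finset.sum_ite_eq']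
    split_ifs with h2
    · rfl
    · refine MvPowerSeries.coeff_eq_zero_of_lt_weightedOrder w (lt_of_lt_of_le ?_ hk)
      by_contra h3
      refine h2 (Finset.mem_filter.2 ⟨Finset.mem_Iic.2 inf_le_right, ?_⟩)
      exact weight_inf_const w k (by simpa using h3)
  have h1 : WGE w k fun x => ∑ e ∈ S, seriesSum (P e) x * mono e x :=
    WGE.sum _ fun e he => WGE.term (hconv e).analyticAt (Finset.mem_filter.1 he).2
  refine h1.congr ?_
  have h2 : ∀ e ∈ S, ∀ᶠ x in 𝓝 0, seriesSum (((MvPolynomial.monomial e (1 : ℂ) :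
      MvPolynomial (Fin N) ℂ) : MvPowerSeries (Fin N) ℂ) * P e) x =
      seriesSum (P e) x * mono e x := by
    intro e _
    filter_upwards [seriesSum_mul (isConvergent_coe (MvPolynomial.monomial e (1 : ℂ)))
      (hconv e)] with x hx
    rw [hx, seriesSum_coe, MvPolynomial.eval_monomial, one_mul, mul_comm, mono,
      Finsupp.prod_fintype _ _ (by simp)]
  have h3 := seriesSum_sum S (fun e => ((MvPolynomial.monomial e (1 : ℂ) :
      MvPolynomial (Fin N) ℂ) : MvPowerSeries (Fin N) ℂ) * P e)
    fun e _ => (isConvergent_coe _).mul (hconv e)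
  rw [← hsum] at h3
  filter_upwards [h3, (Filter.eventually_all_finset S).2 h2] with x hx1 hx2
  rw [hx1]
  exact Finset.sum_congr rfl hx2

/-- Induction on the weight: once the series has weight at least j, its part P of weight j satisfies
t^j P(x) = t^(j+1) G(t) along every weighted curve, so P vanishes at every x. -/
theorem WGE.le_weightedOrder {N : ℕ} {w : Fin N → ℕ} (hw : ∀ i, w i ≠ 0) {k : ℕ}
    {p : MvPowerSeries (Fin N) ℂ} (hp : IsConvergent p) (h : WGE w k (seriesSum p)) :
    (k : ℕ∞) ≤ p.weightedOrder w := by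
  have key : ∀ j ≤ k, (j : ℕ∞) ≤ p.weightedOrder w := by
    intro j
    induction j with
    | zero => simp
    | succ j ih =>
      intro hj
      have hj' := ih (by omega)
      set P := truncLT w (j + 1) p with hP
      have hPc := coeff_truncLT w hw (j + 1) p
      have h1 : ((j + 1 : ℕ) : ℕ∞) ≤ (p - (P : MvPowerSeries (Fin N) ℂ)).weightedOrder w := by
        refine MvPowerSeries.nat_le_weightedOrder w fun d hd => ?_
        rw [map_sub, MvPolynomial.coeff_coe, hPc, if_pos hd, sub_self]
      have h2 : WGE w (j + 1) (fun x => MvPolynomial.eval x P) := by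
        refine ((h.le hj).sub ((hp.sub (isConvergent_coe P)).wge h1)).congr ?_
        filter_upwards [seriesSum_sub hp (isConvergent_coe P)] with x hx
        rw [hx, seriesSum_coe]
        ring
      have h3 : ∀ x : Fin N → ℂ, MvPolynomial.eval x P = 0 := by
        intro x
        obtain ⟨G, hG, hev⟩ := h2.exists_curve hw x
        have hhom : ∀ t : ℂ, MvPolynomial.eval (fun i => t ^ w i * x i) P =
            t ^ j * MvPolynomial.eval x P := by
          intro t
          rw [MvPolynomial.eval_eq', MvPolynomial.eval_eq', Finset.mul_sum]
          refine Finset.sum_congr rfl fun d hd => ?_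
          have hd' := MvPolynomial.mem_support_iff.1 hd
          have hwd : Finsupp.weight w d = j := by
            rw [hPc] at hd'
            have h4 : Finsupp.weight w d < j + 1 := by
              by_contra h5
              exact hd' (if_neg h5)
            rw [if_pos h4] at hd'
            have h5 : ¬ Finsupp.weight w d < j := fun h6 => hd'
              (MvPowerSeries.coeff_eq_zero_of_lt_weightedOrder w
                (lt_of_lt_of_le (by exact_mod_cast h6) hj'))
            omega
          change _ * mono d _ = _ * (_ * mono d x)
          rw [mono_mul_pt, mono_weight_pow, hwd]
          ring
        have h4 : ∀ᶠ t in 𝓝[≠] (0 : ℂ), MvPolynomial.eval x P = t * G t := by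
          filter_upwards [hev.filter_mono nhdsWithin_le_nhds, self_mem_nhdsWithin] with t ht ht0
          rw [hhom, pow_succ, mul_assoc] at ht
          exact mul_left_cancel₀ (pow_ne_zero j ht0) ht
        have h5 : Filter.Tendsto (fun t => t * G t) (𝓝[≠] (0 : ℂ)) (𝓝 0) := by
          have : ContinuousAt (fun t => t * G t) 0 := continuousAt_id.mul hG
          simpa using this.tendsto.mono_left nhdsWithin_le_nhds
        exact tendsto_nhds_unique
          (tendsto_const_nhds.congr' (h4.mono fun t ht => ht)) h5
      have h4 : P = 0 := MvPolynomial.funext fun x => by simpa using h3 x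
      refine MvPowerSeries.nat_le_weightedOrder w fun d hd => ?_
      have := hPc d
      rw [← hP, h4, if_pos hd] at this
      simpa using this.symm
  exact key k le_rfl

/-- The zero germ has weight at least k for every k, so the difference of the two series has
infinite order. -/
theorem seriesSum_injective {N : ℕ} {p q : MvPowerSeries (Fin N) ℂ} (hp : IsConvergent p)
    (hq : IsConvergent q) (h : seriesSum p =ᶠ[𝓝 0] seriesSum q) : p = q := by
  have h1 : seriesSum (p - q) =ᶠ[𝓝 0] fun _ => 0 := by
    filter_upwards [h, seriesSum_sub hp hq] with x h1 h2
    rw [h2, h1, sub_self]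
  have h2 : ∀ k : ℕ, (k : ℕ∞) ≤ (p - q).weightedOrder fun _ => 1 := fun k =>
    (WGE.zero.congr h1).le_weightedOrder (fun _ => one_ne_zero) (hp.sub hq)
  have h3 : p - q = 0 := by
    refine (MvPowerSeries.weightedOrder_eq_top_iff fun _ => 1).1 ?_
    exact ENat.eq_top_iff_forall_ge.2 h2
  exact sub_eq_zero.1 h3

/-! ### Restriction to some of the variables -/

open Classical in
/-- The point with the coordinates outside `S` replaced by `0`. -/
def restrictPt {N : ℕ} (S : Finset (Fin N)) (x : Fin N → ℂ) : Fin N → ℂ :=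
  fun i => if i ∈ S then x i else 0

open Classical in
/-- The sum of the terms of `p` involving only the variables in `S`. -/
def restrictVars {N : ℕ} (S : Finset (Fin N)) (p : MvPowerSeries (Fin N) ℂ) :
    MvPowerSeries (Fin N) ℂ :=
  fun d => if d.support ⊆ S then MvPowerSeries.coeff d p else 0

theorem coeff_restrictVars {N : ℕ} (S : Finset (Fin N)) (p : MvPowerSeries (Fin N) ℂ)
    (d : Fin N →₀ ℕ) [Decidable (d.support ⊆ S)] :
    MvPowerSeries.coeff d (restrictVars S p) =
      if d.support ⊆ S then MvPowerSeries.coeff d p else 0 := by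
  change restrictVars S p d = _
  rw [restrictVars]
  congr

theorem inVars_restrictVars {N : ℕ} (S : Finset (Fin N)) (p : MvPowerSeries (Fin N) ℂ) :
    InVars S (restrictVars S p) := by
  classical
  intro d hd
  rw [coeff_restrictVars] at hd
  by_contra h
  exact hd (if_neg h)

theorem mono_restrictPt {N : ℕ} (S : Finset (Fin N)) (d : Fin N →₀ ℕ) (x : Fin N → ℂ)
    [Decidable (d.support ⊆ S)] :
    mono d (restrictPt S x) = if d.support ⊆ S then mono d x else 0 := by
  split_ifs with h
  · refine Finset.prod_congr rfl fun i _ => ?_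
    by_cases hi : i ∈ S
    · simp [restrictPt, hi]
    · have : d i = 0 := by
        by_contra h0
        exact hi (h (Finsupp.mem_support_iff.2 h0))
      simp [this]
  · obtain ⟨i, hi, hiS⟩ := Finset.not_subset.1 h
    refine Finset.prod_eq_zero (Finset.mem_univ i) ?_
    simp [restrictPt, hiS, Finsupp.mem_support_iff.1 hi]

theorem seriesSum_restrictVars {N : ℕ} (S : Finset (Fin N)) (p : MvPowerSeries (Fin N) ℂ)
    (x : Fin N → ℂ) : seriesSum (restrictVars S p) x = seriesSum p (restrictPt S x) := by
  classical
  rw [seriesSum_eq, seriesSum_eq]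
  refine tsum_congr fun d => ?_
  rw [coeff_restrictVars, mono_restrictPt]
  split_ifs <;> simp

theorem IsConvergent.restrictVars {N : ℕ} {p : MvPowerSeries (Fin N) ℂ} (hp : IsConvergent p)
    (S : Finset (Fin N)) : IsConvergent (restrictVars S p) := by
  classical
  obtain ⟨r, hr, h⟩ := hp.exists_convAt
  refine ConvAt.isConvergent hr ?_
  refine Summable.of_nonneg_of_le (fun _ => by positivity) (fun d => ?_) h
  rw [coeff_restrictVars]
  gcongr
  split_ifs <;> simp

theorem InVars.restrictVars_eq {N : ℕ} {S : Finset (Fin N)} {p : MvPowerSeries (Fin N) ℂ}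
    (h : InVars S p) : restrictVars S p = p := by
  classical
  ext d
  rw [coeff_restrictVars]
  split_ifs with hd
  · rfl
  · by_contra h0
    exact hd (h d (Ne.symm h0))

theorem InVars.seriesSum_restrictPt {N : ℕ} {S : Finset (Fin N)} {p : MvPowerSeries (Fin N) ℂ}
    (h : InVars S p) (x : Fin N → ℂ) : seriesSum p (restrictPt S x) = seriesSum p x := by
  rw [← seriesSum_restrictVars, h.restrictVars_eq]

theorem InVars.seriesSum_congr {N : ℕ} {S : Finset (Fin N)} {p : MvPowerSeries (Fin N) ℂ}
    (h : InVars S p) {x y : Fin N → ℂ} (hxy : ∀ i ∈ S, x i = y i) :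
    seriesSum p x = seriesSum p y := by
  rw [← h.seriesSum_restrictPt x, ← h.seriesSum_restrictPt y]
  congr 1
  funext i
  simp only [restrictPt]
  split_ifs with hi
  · exact hxy i hi
  · rfl

theorem InVars.le_weightedOrder {N : ℕ} {S : Finset (Fin N)} {p : MvPowerSeries (Fin N) ℂ}
    (h : InVars S p) {w w' : Fin N → ℕ} (hw : ∀ i ∈ S, w i ≤ w' i) {k : ℕ∞}
    (hk : k ≤ p.weightedOrder w) : k ≤ p.weightedOrder w' := by
  refine MvPowerSeries.le_weightedOrder w' fun d hd => ?_
  by_contra h0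
  have h1 := hk.trans (MvPowerSeries.weightedOrder_le w h0)
  have h2 : Finsupp.weight w d ≤ Finsupp.weight w' d := by
    simp only [Finsupp.weight_apply, Finsupp.sum]
    exact Finset.sum_le_sum fun i hi => Nat.mul_le_mul_left _ (hw i (h d h0 hi))
  exact absurd (h1.trans (by exact_mod_cast h2)) (not_le.2 hd)

/-! ### Division by variables -/

theorem mono_sub_single {N : ℕ} {d : Fin N →₀ ℕ} {i : Fin N} {k : ℕ} (h : k ≤ d i)
    (x : Fin N → ℂ) : mono d x = x i ^ k * mono (d - Finsupp.single i k) x := by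
  have : Finsupp.single i k + (d - Finsupp.single i k) = d :=
    add_tsub_cancel_of_le (Finsupp.single_le_iff.2 h)
  nth_rewrite 1 [← this]
  rw [mono_add, mono_single]

/-- With weight 1 on xᵢ and 0 on all other variables, the weight measures divisibility by xᵢ. -/
theorem WGE.exists_eq_pow_mul {N : ℕ} {i : Fin N} {k : ℕ} {f : (Fin N → ℂ) → ℂ}
    (h : WGE (Pi.single i 1) k f) :
    ∃ c : (Fin N → ℂ) → ℂ, AnalyticAt ℂ c 0 ∧ ∀ᶠ x in 𝓝 0, f x = x i ^ k * c x := by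
  obtain ⟨S, c, h1, h2⟩ := h
  have hd : ∀ d ∈ S, k ≤ d i := by
    intro d hd
    refine (h1 d hd).2.trans (le_of_eq ?_)
    rw [Finsupp.weight_apply, Finsupp.sum_fintype _ _ (by simp), Finset.sum_eq_single i]
    · simp
    · intro j _ hj
      simp [Pi.single_eq_of_ne hj]
    · simp
  refine ⟨fun x => ∑ d ∈ S, c d x * mono (d - Finsupp.single i k) x,
    Finset.analyticAt_fun_sum _ fun d hd => (h1 d hd).1.fun_mul (analyticAt_mono _ 0), ?_⟩
  filter_upwards [h2] with x hx
  rw [hx, Finset.mul_sum]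
  refine Finset.sum_congr rfl fun d hdS => ?_
  rw [mono_sub_single (hd d hdS)]
  ring

/-- Hadamard's lemma: the terms free of xᵢ form the restriction to xᵢ = 0, so they all vanish and
every remaining term is divisible by xᵢ. -/
theorem exists_eq_mul_of_restrictPt {N : ℕ} {i : Fin N} {f : (Fin N → ℂ) → ℂ}
    (hf : AnalyticAt ℂ f 0) (h : ∀ᶠ x in 𝓝 0, f (restrictPt (Finset.univ.erase i) x) = 0) :
    ∃ c : (Fin N → ℂ) → ℂ, AnalyticAt ℂ c 0 ∧ ∀ᶠ x in 𝓝 0, f x = x i * c x := by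
  classical
  obtain ⟨p, hp, hfp⟩ := exists_seriesSum_eq hf
  have hcont : Filter.Tendsto (restrictPt (Finset.univ.erase i)) (𝓝 (0 : Fin N → ℂ)) (𝓝 0) := by
    refine tendsto_pi_nhds.2 fun j => ?_
    by_cases hj : j = i
    · simp [restrictPt, hj]
    · simpa [restrictPt, hj] using (continuous_apply j).tendsto (0 : Fin N → ℂ)
  have h1 : restrictVars (Finset.univ.erase i) p = 0 := by
    refine seriesSum_injective (hp.restrictVars _) isConvergent_zero ?_
    filter_upwards [h, hcont.eventually hfp] with x hx1 hx2
    rw [seriesSum_restrictVars, ← hx2, hx1, seriesSum_zero]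
  have h2 : ((1 : ℕ) : ℕ∞) ≤ p.weightedOrder (Pi.single i 1) := by
    refine MvPowerSeries.nat_le_weightedOrder _ fun d hd => ?_
    have h3 : d i = 0 := by
      have := Finsupp.le_weight (Pi.single i 1 : Fin N → ℕ) (s := i) (by simp) d
      omega
    have h4 := congrArg (MvPowerSeries.coeff d) h1
    rw [coeff_restrictVars, if_pos, map_zero] at h4
    · exact h4
    · intro j hj
      refine Finset.mem_erase.2 ⟨?_, Finset.mem_univ _⟩
      rintro rfl
      exact Finsupp.mem_support_iff.1 hj h3
  simpa using ((hp.wge h2).congr hfp).exists_eq_pow_mul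

/-! ### Derivatives -/

/-- The partial derivative with respect to the `i`th coordinate. -/
def pd {N : ℕ} (i : Fin N) (f : (Fin N → ℂ) → ℂ) (x : Fin N → ℂ) : ℂ :=
  fderiv ℂ f x (Pi.single i 1)

theorem AnalyticAt.pd {N : ℕ} {i : Fin N} {f : (Fin N → ℂ) → ℂ} {x : Fin N → ℂ}
    (hf : AnalyticAt ℂ f x) : AnalyticAt ℂ (pd i f) x :=
  ((ContinuousLinearMap.apply ℂ ℂ (Pi.single i (1 : ℂ) : Fin N → ℂ)).analyticAt _).comp hf.fderiv

theorem fderiv_eq_sum_pd {N : ℕ} (f : (Fin N → ℂ) → ℂ) (x v : Fin N → ℂ) :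
    fderiv ℂ f x v = ∑ i, v i * pd i f x := by
  conv_lhs => rw [pi_eq_sum_univ' v, map_sum]
  refine Finset.sum_congr rfl fun i _ => ?_
  rw [map_smul, smul_eq_mul, pd]

theorem eventually_pd_congr {N : ℕ} {i : Fin N} {f g : (Fin N → ℂ) → ℂ} {x : Fin N → ℂ}
    (h : f =ᶠ[𝓝 x] g) : pd i f =ᶠ[𝓝 x] pd i g := by
  filter_upwards [h.eventuallyEq_nhds] with y hy
  rw [pd, pd, hy.fderiv_eq]

theorem pd_mul {N : ℕ} {i : Fin N} {f g : (Fin N → ℂ) → ℂ} {x : Fin N → ℂ}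
    (hf : AnalyticAt ℂ f x) (hg : AnalyticAt ℂ g x) :
    pd i (fun x => f x * g x) x = pd i f x * g x + f x * pd i g x := by
  rw [pd, fderiv_fun_mul hf.differentiableAt hg.differentiableAt]
  simp [pd]
  ring

theorem pd_coord {N : ℕ} (i j : Fin N) (x : Fin N → ℂ) :
    pd i (fun x => x j) x = if i = j then 1 else 0 := by
  have : HasFDerivAt (fun x : Fin N → ℂ => x j)
      (ContinuousLinearMap.proj (R := ℂ) (φ := fun _ : Fin N => ℂ) j) x :=
    (ContinuousLinearMap.proj (R := ℂ) (φ := fun _ : Fin N => ℂ) j).hasFDerivAt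
  rw [pd, this.fderiv]
  simp [Pi.single_apply, eq_comm]

theorem wge_pd_mono {N : ℕ} (w : Fin N → ℕ) (i : Fin N) (d : Fin N →₀ ℕ) :
    WGE w (Finsupp.weight w d - w i) (pd i (mono d)) := by
  have mul : ∀ d e : Fin N →₀ ℕ, WGE w (Finsupp.weight w d - w i) (pd i (mono d)) →
      WGE w (Finsupp.weight w e - w i) (pd i (mono e)) →
      WGE w (Finsupp.weight w (d + e) - w i) (pd i (mono (d + e))) := by
    intro d e hd he
    have h1 := ((hd.mul (WGE.mono_self (w := w) e)).le
      (l := Finsupp.weight w (d + e) - w i) (by rw [map_add]; omega)).add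
      (((WGE.mono_self (w := w) d).mul he).le (by rw [map_add]; omega))
    refine h1.congr (Filter.Eventually.of_forall fun x => ?_)
    rw [show mono (d + e) = fun x => mono d x * mono e x from funext (mono_add d e)]
    exact pd_mul (analyticAt_mono d x) (analyticAt_mono e x)
  have zero : WGE w (Finsupp.weight w (0 : Fin N →₀ ℕ) - w i) (pd i (mono 0)) := by
    refine WGE.zero.congr (Filter.Eventually.of_forall fun x => ?_)
    rw [show mono (0 : Fin N →₀ ℕ) = fun _ => (1 : ℂ) from funext mono_zero]
    simp [pd]
  induction d using Finsupp.induction_linear with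
  | zero => exact zero
  | add d e hd he => exact mul d e hd he
  | single j n =>
    induction n with
    | zero => simpa using zero
    | succ n ih =>
      rw [Finsupp.single_add]
      refine mul _ _ ih ?_
      have h1 : pd i (mono (Finsupp.single j 1)) = fun _ => if i = j then (1 : ℂ) else 0 := by
        funext x
        rw [← pd_coord i j x]
        congr 1
        funext y
        rw [mono_single, pow_one]
      rw [h1]
      by_cases hij : i = j
      · subst hij
        simpa [Finsupp.weight_single] using
          WGE.of_analyticAt (w := w) (f := fun _ => (1 : ℂ)) analyticAt_const
      · simpa [hij] using WGE.zero

theorem WGE.pd {N : ℕ} {w : Fin N → ℕ} {k : ℕ} {f : (Fin N → ℂ) → ℂ} (h : WGE w k f)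
    (i : Fin N) : WGE w (k - w i) (pd i f) := by
  obtain ⟨S, c, h1, h2⟩ := h
  have h3 : WGE w (k - w i) fun x => ∑ d ∈ S,
      (Kawakita.pd i (c d) x * mono d x + c d x * Kawakita.pd i (mono d) x) := by
    refine WGE.sum _ fun d hd => WGE.add ?_ ?_
    · exact WGE.term (AnalyticAt.pd (h1 d hd).1) ((Nat.sub_le _ _).trans (h1 d hd).2)
    · exact ((wge_pd_mono w i d).le (Nat.sub_le_sub_right (h1 d hd).2 _)).mul_left (h1 d hd).1
  refine h3.congr ?_
  filter_upwards [eventually_pd_congr (i := i) h2,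
    (Filter.eventually_all_finset S).2 fun d hd => (h1 d hd).1.eventually_analyticAt] with x hx1 hx2
  rw [hx1, Kawakita.pd, fderiv_fun_sum fun d hd =>
    ((hx2 d hd).fun_mul (analyticAt_mono d x)).differentiableAt]
  rw [sum_apply]
  exact Finset.sum_congr rfl fun d hd => pd_mul (hx2 d hd) (analyticAt_mono d x)

theorem exists_order_le {N : ℕ} {f : (Fin N → ℂ) → ℂ} (hf : AnalyticAt ℂ f 0) (h0 : f 0 = 0) :
    WGE (fun _ => 1) 1 f := by
  obtain ⟨p, hp, hfp⟩ := exists_seriesSum_eq hf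
  refine (hp.wge ?_).congr hfp
  have h1 : MvPowerSeries.constantCoeff p = 0 := by
    rw [← seriesSum_at_zero, ← hfp.self_of_nhds, h0]
  exact_mod_cast (MvPowerSeries.one_le_order_iff_constCoeff_eq_zero).2 h1

theorem WGE.fderiv_eq_zero {N : ℕ} {f : (Fin N → ℂ) → ℂ} (hf : WGE (fun _ => 1) 2 f) :
    fderiv ℂ f 0 = 0 := by
  ext v
  rw [fderiv_eq_sum_pd]
  refine Finset.sum_eq_zero fun i _ => ?_
  rw [(hf.pd i).at_zero (by simp), mul_zero]

end Kawakita
end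

noncomputable section
namespace Kawakita

/-! ## Maps between weighted blowups -/

/-- The map `(u, x) ↦ (u^{w₁} x₁, …, u^{w_N} x_N)`. -/
def bd {N : ℕ} (w : Fin N → ℕ) (z : ℂ × (Fin N → ℂ)) : Fin N → ℂ := fun i => z.1 ^ w i * z.2 i

theorem blowdown_toBlowup {N : ℕ} (w : Fin N → ℕ) (y : Cone N) :
    blowdown w (toBlowup w y) = bd w y.1 := rfl

theorem analyticAt_bd {N : ℕ} (w : Fin N → ℕ) (z : ℂ × (Fin N → ℂ)) : AnalyticAt ℂ (bd w) z := by
  refine analyticAt_pi_iff.2 fun i => ?_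
  exact (analyticAt_fst.pow _).mul ((analyticAt_coord i _).comp analyticAt_snd)

theorem continuous_toBlowup {N : ℕ} (w : Fin N → ℕ) : Continuous (toBlowup w) :=
  continuous_quotient_mk'

theorem toBlowup_surjective {N : ℕ} (w : Fin N → ℕ) : Function.Surjective (toBlowup w) :=
  Quotient.mk_surjective

theorem toBlowup_eq_iff {N : ℕ} {w : Fin N → ℕ} {y z : Cone N} :
    toBlowup w y = toBlowup w z ↔
      ∃ c : ℂˣ, z.1.1 = (c : ℂ)⁻¹ * y.1.1 ∧ ∀ i, z.1.2 i = (c : ℂ) ^ w i * y.1.2 i :=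
  Quotient.eq (r := blowupSetoid w)

/-- The action of `ℂˣ` on `ℂ^{N+1} ∖ V(x₁, …, x_N)`. -/
def coneAct {N : ℕ} (w : Fin N → ℕ) (c : ℂˣ) (y : Cone N) : Cone N :=
  ⟨((c : ℂ)⁻¹ * y.1.1, fun i => (c : ℂ) ^ w i * y.1.2 i), fun h => y.2 (by
    funext i
    have := congrFun h i
    simpa using this)⟩

theorem continuous_coneAct {N : ℕ} (w : Fin N → ℕ) (c : ℂˣ) : Continuous (coneAct w c) := by
  unfold coneAct
  fun_prop

theorem isOpenMap_toBlowup {N : ℕ} (w : Fin N → ℕ) : IsOpenMap (toBlowup w) := by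
  intro O hO
  have h : toBlowup w ⁻¹' (toBlowup w '' O) = ⋃ c : ℂˣ, coneAct w c ⁻¹' O := by
    ext y
    simp only [Set.mem_preimage, Set.mem_image, Set.mem_iUnion]
    constructor
    · rintro ⟨z, hz, hzy⟩
      obtain ⟨c, h0, h1⟩ := toBlowup_eq_iff.1 hzy.symm
      refine ⟨c, ?_⟩
      have : coneAct w c y = z := Subtype.ext (Prod.ext h0.symm (funext fun i => (h1 i).symm))
      rwa [this]
    · rintro ⟨c, hc⟩
      exact ⟨_, hc, (toBlowup_eq_iff.2 ⟨c, rfl, fun i => rfl⟩).symm⟩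
  have h1 : IsOpen (toBlowup w ⁻¹' (toBlowup w '' O)) := by
    rw [h]
    exact isOpen_iUnion fun c => hO.preimage (continuous_coneAct w c)
  exact h1

/-! ### Lifts of germs to the cones -/

/-- `L` is a lift of the germ `Θ : (ℂ^N, 0) → (ℂ^M, 0)`, defined on `V`, to the weighted blowups. -/
structure IsLift {N M : ℕ} (w : Fin N → ℕ) (w' : Fin M → ℕ) (V : Set (Fin N → ℂ))
    (Θ : (Fin N → ℂ) → Fin M → ℂ) (L : ℂ × (Fin N → ℂ) → Fin M → ℂ) : Prop where
  isOpen : IsOpen V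
  analytic : ∀ x ∈ V, AnalyticAt ℂ Θ x
  analytic_lift : ∀ z, bd w z ∈ V → AnalyticAt ℂ L z
  comm : ∀ z, bd w z ∈ V → Θ (bd w z) = bd w' (z.1, L z)
  equivariant : ∀ (c : ℂˣ) (u : ℂ) (x : Fin N → ℂ) (i : Fin M),
    L ((c : ℂ)⁻¹ * u, fun i => (c : ℂ) ^ w i * x i) i = (c : ℂ) ^ w' i * L (u, x) i
  map_zero : ∀ u, L (u, 0) = 0

theorem IsLift.subset {N M : ℕ} {w : Fin N → ℕ} {w' : Fin M → ℕ} {V V₁ : Set (Fin N → ℂ)}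
    {Θ : (Fin N → ℂ) → Fin M → ℂ} {L : ℂ × (Fin N → ℂ) → Fin M → ℂ} (h : IsLift w w' V Θ L)
    (hV : IsOpen V₁) (hs : V₁ ⊆ V) : IsLift w w' V₁ Θ L where
  isOpen := hV
  analytic x hx := h.analytic x (hs hx)
  analytic_lift z hz := h.analytic_lift z (hs hz)
  comm z hz := h.comm z (hs hz)
  equivariant := h.equivariant
  map_zero := h.map_zero

/-- After substituting u^(wⱼ)xⱼ for xⱼ, a monomial of weight e ≥ w'ᵢ acquires the factor u^e.
Removing u^(w'ᵢ) leaves the exponent e - w'ᵢ, and this quotient is the i-th component of the lift.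
As w'ᵢ is positive, no constant monomial occurs, so the lift vanishes at x = 0. -/
theorem exists_isLift {N M : ℕ} {w : Fin N → ℕ} {w' : Fin M → ℕ}
    (hw' : ∀ i, w' i ≠ 0) {Θ : (Fin N → ℂ) → Fin M → ℂ}
    (hΘ : ∀ i, WGE w (w' i) fun x => Θ x i) :
    ∃ V L, (0 : Fin N → ℂ) ∈ V ∧ IsLift w w' V Θ L := by
  have hΘa : AnalyticAt ℂ Θ 0 := analyticAt_pi_iff.2 fun i => (hΘ i).analyticAt
  choose S c h1 h2 using hΘ
  have hev : ∀ᶠ x in 𝓝 (0 : Fin N → ℂ), AnalyticAt ℂ Θ x ∧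
      (∀ i, ∀ d ∈ S i, AnalyticAt ℂ (c i d) x) ∧
      ∀ i, Θ x i = ∑ d ∈ S i, c i d x * mono d x := by
    refine hΘa.eventually_analyticAt.and (Filter.Eventually.and ?_ ?_)
    · exact Filter.eventually_all.2 fun i => (Filter.eventually_all_finset _).2 fun d hd =>
        (h1 i d hd).1.eventually_analyticAt
    · exact Filter.eventually_all.2 fun i => h2 i
  obtain ⟨V, hV, hVo, h0⟩ := eventually_nhds_iff.1 hev
  have hbd : ∀ (a : ℂˣ) (u : ℂ) (x : Fin N → ℂ),
      bd w ((a : ℂ)⁻¹ * u, fun i => (a : ℂ) ^ w i * x i) = bd w (u, x) := by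
    intro a u x
    funext i
    have : (a : ℂ) ^ w i ≠ 0 := pow_ne_zero _ a.ne_zero
    simp only [bd, mul_pow, inv_pow]
    field_simp
  refine ⟨V, fun z i => ∑ d ∈ S i, c i d (bd w z) *
    (z.1 ^ (Finsupp.weight w d - w' i) * mono d z.2), h0, hVo, fun x hx => (hV x hx).1, ?_, ?_, ?_,
    ?_⟩
  · intro z hz
    refine analyticAt_pi_iff.2 fun i => Finset.analyticAt_fun_sum _ fun d hd => ?_
    refine AnalyticAt.fun_mul ?_ (AnalyticAt.fun_mul (analyticAt_fst.pow _) ?_)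
    · exact ((hV _ hz).2.1 i d hd).fun_comp (analyticAt_bd w z)
    · exact (analyticAt_mono d _).fun_comp analyticAt_snd
  · intro z hz
    funext i
    rw [(hV _ hz).2.2 i]
    simp only [bd, Finset.mul_sum]
    refine Finset.sum_congr rfl fun d hd => ?_
    rw [show mono d (bd w z) = _ from mono_mul_pt d _ _, mono_weight_pow]
    nth_rewrite 1 [← Nat.add_sub_cancel' (h1 i d hd).2]
    rw [pow_add]
    ring
  · intro a u x i
    simp only [hbd, Finset.mul_sum]
    refine Finset.sum_congr rfl fun d hd => ?_
    rw [mono_mul_pt, mono_weight_pow, mul_pow, inv_pow]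
    have h3 : (a : ℂ) ^ Finsupp.weight w d =
        (a : ℂ) ^ w' i * (a : ℂ) ^ (Finsupp.weight w d - w' i) := by
      rw [← pow_add, Nat.add_sub_cancel' (h1 i d hd).2]
    rw [h3]
    have : (a : ℂ) ^ (Finsupp.weight w d - w' i) ≠ 0 := pow_ne_zero _ a.ne_zero
    field_simp
  · intro u
    funext i
    refine Finset.sum_eq_zero fun d hd => ?_
    rw [mono_at_zero, mul_zero, mul_zero]
    rintro rfl
    have := (h1 i 0 hd).2
    simp [hw' i] at this

open Classical in
/-- The map of cones induced by a lift; it is meaningful where `L` does not vanish. -/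
def coneMap {N M : ℕ} [Nonempty (Cone M)] (L : ℂ × (Fin N → ℂ) → Fin M → ℂ) (y : Cone N) :
    Cone M :=
  if h : L y.1 ≠ 0 then ⟨(y.1.1, L y.1), h⟩ else Classical.arbitrary _

theorem coneMap_of_ne {N M : ℕ} [Nonempty (Cone M)] {L : ℂ × (Fin N → ℂ) → Fin M → ℂ}
    {y : Cone N} (h : L y.1 ≠ 0) : coneMap L y = ⟨(y.1.1, L y.1), h⟩ := dif_pos h

/-- The map of weighted blowups induced by a lift. -/
def blowMap {N M : ℕ} [Nonempty (Cone M)] (w : Fin N → ℕ) (w' : Fin M → ℕ)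
    (L : ℂ × (Fin N → ℂ) → Fin M → ℂ) (t : Blowup w) : Blowup w' :=
  toBlowup w' (coneMap L (Quotient.out (s := blowupSetoid w) t))

section

variable {N M : ℕ} {w : Fin N → ℕ} {w' : Fin M → ℕ}
  {V : Set (Fin N → ℂ)} {V' : Set (Fin M → ℂ)} {Z : Set (Fin N → ℂ)} {Z' : Set (Fin M → ℂ)}
  {Θ : (Fin N → ℂ) → Fin M → ℂ} {Ψ : (Fin M → ℂ) → Fin N → ℂ}
  {L : ℂ × (Fin N → ℂ) → Fin M → ℂ} {K : ℂ × (Fin M → ℂ) → Fin N → ℂ}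

/-- Independence of the representative is equivariance of L. It extends to points where L vanishes,
since L then vanishes on the whole orbit and the same default point is used. -/
theorem IsLift.blowMap_toBlowup [Nonempty (Cone M)] (h : IsLift w w' V Θ L) (y : Cone N) :
    blowMap w w' L (toBlowup w y) = toBlowup w' (coneMap L y) := by
  set z : Cone N := Quotient.out (s := blowupSetoid w) (toBlowup w y) with hz
  have h1 : toBlowup w z = toBlowup w y := Quotient.out_eq (s := blowupSetoid w) _
  obtain ⟨c, h2, h3⟩ := toBlowup_eq_iff.1 h1
  have h4 : ∀ i, L y.1 i = (c : ℂ) ^ w' i * L z.1 i := by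
    intro i
    have : y.1 = ((c : ℂ)⁻¹ * z.1.1, fun i => (c : ℂ) ^ w i * z.1.2 i) :=
      Prod.ext h2 (funext h3)
    rw [this, h.equivariant]
  change toBlowup w' (coneMap L z) = _
  by_cases h5 : L z.1 = 0
  · have h6 : L y.1 = 0 := by
      funext i
      rw [h4, h5]
      simp
    rw [coneMap, coneMap, dif_neg (not_not.2 h5), dif_neg (not_not.2 h6)]
  · have h6 : L y.1 ≠ 0 := by
      intro h7
      refine h5 (funext fun i => ?_)
      have := h4 i
      rw [h7] at this
      simpa using this.symm
    rw [coneMap_of_ne h5, coneMap_of_ne h6]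
    exact toBlowup_eq_iff.2 ⟨c, h2, h4⟩

theorem IsLift.eventually_coneMap [Nonempty (Cone M)] (h : IsLift w w' V Θ L) {y : Cone N}
    (hy : bd w y.1 ∈ V) (hL : L y.1 ≠ 0) :
    ∀ᶠ z : ℂ × (Fin N → ℂ) in 𝓝 y.1, ∃ (h₁ : z.2 ≠ 0) (h₂ : L z ≠ 0),
      coneMap L ⟨z, h₁⟩ = ⟨(z.1, L z), h₂⟩ := by
  filter_upwards [(h.analytic_lift _ hy).continuousAt.eventually_ne hL,
    continuous_snd.continuousAt.eventually_ne y.2] with z h₁ h₂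
  exact ⟨h₂, h₁, coneMap_of_ne (y := ⟨z, h₂⟩) h₁⟩

theorem IsLift.continuousAt_coneMap [Nonempty (Cone M)] (h : IsLift w w' V Θ L) {y : Cone N}
    (hy : bd w y.1 ∈ V) (hL : L y.1 ≠ 0) : ContinuousAt (coneMap (M := M) L) y := by
  refine Topology.IsInducing.subtypeVal.continuousAt_iff.2 ?_
  have hc : ContinuousAt (fun y : Cone N => (y.1.1, L y.1)) y :=
    (continuous_fst.comp continuous_subtype_val).continuousAt.prodMk
      ((h.analytic_lift _ hy).continuousAt.comp' continuous_subtype_val.continuousAt)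
  refine hc.congr ?_
  filter_upwards [continuous_subtype_val.continuousAt.eventually (h.eventually_coneMap hy hL)]
    with z hz
  obtain ⟨h₁, h₂, h₃⟩ := hz
  change _ = (coneMap L z).1
  rw [coneMap_of_ne h₂]

theorem IsLift.continuousAt_blowMap [Nonempty (Cone M)] (h : IsLift w w' V Θ L) {y : Cone N}
    (hy : bd w y.1 ∈ V) (hL : L y.1 ≠ 0) : ContinuousAt (blowMap w w' L) (toBlowup w y) := by
  rw [ContinuousAt, ← (isOpenMap_toBlowup w).map_nhds_eq (continuous_toBlowup w).continuousAt,
    Filter.tendsto_map'_iff]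
  have h1 : blowMap w w' L ∘ toBlowup w = toBlowup w' ∘ coneMap L :=
    funext fun y => h.blowMap_toBlowup y
  rw [h1, h.blowMap_toBlowup]
  exact (continuous_toBlowup w').continuousAt.comp (h.continuousAt_coneMap hy hL)

theorem IsLift.holBlowup_comp [Nonempty (Cone M)] (h : IsLift w w' V Θ L) {t : Blowup w}
    (ht : ∀ y, toBlowup w y = t → bd w y.1 ∈ V ∧ L y.1 ≠ 0) {S : Blowup w' → ℂ}
    (hS : holBlowup w' S (blowMap w w' L t)) : holBlowup w (S ∘ blowMap w w' L) t := by
  intro y hy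
  obtain ⟨hyV, hL⟩ := ht y hy
  have h1 := hS (coneMap L y) (by rw [← hy, h.blowMap_toBlowup])
  rw [coneMap_of_ne hL] at h1
  have h2 : AnalyticAt ℂ (fun z => (z.1, L z)) y.1 :=
    analyticAt_fst.prod (h.analytic_lift _ hyV)
  have h3 := AnalyticAt.fun_comp (f := fun z => (z.1, L z)) h1 h2
  refine h3.congr ?_
  filter_upwards [h.eventually_coneMap hyV hL] with z hz
  obtain ⟨h₁, h₂, h₃⟩ := hz
  rw [dif_pos h₁, dif_pos h₂, Function.comp_apply, h.blowMap_toBlowup, h₃]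

/-- `Θ` maps `Z ∩ V` to `Z' ∩ V'` with left inverse `Ψ`. -/
def MapsInvOn (V : Set (Fin N → ℂ)) (V' : Set (Fin M → ℂ)) (Z : Set (Fin N → ℂ))
    (Z' : Set (Fin M → ℂ)) (Θ : (Fin N → ℂ) → Fin M → ℂ) (Ψ : (Fin M → ℂ) → Fin N → ℂ) : Prop :=
  ∀ z ∈ Z ∩ V, Θ z ∈ Z' ∩ V' ∧ Ψ (Θ z) = z

/-- Where u ≠ 0, the identity Ψ ∘ Θ = id on Z reads u^(wᵢ)Kᵢ = u^(wᵢ)xᵢ, and the power of u cancels.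
Points of the strict transform are limits of such points, because the quotient map is open and
closures can be computed on the cone. -/
theorem lift_lift (hw : ∀ i, w i ≠ 0) (hL : IsLift w w' V Θ L) (hK : IsLift w' w V' Ψ K)
    (hm : MapsInvOn V V' Z Z' Θ Ψ) {y : Cone N}
    (hy : toBlowup w y ∈ strictTransform w (Z ∩ V)) : K (y.1.1, L y.1) = y.1.2 := by
  have hyV : bd w y.1 ∈ Z ∩ V := hy.2
  have h1 : y ∈ closure (toBlowup w ⁻¹' (blowdown w ⁻¹' ((Z ∩ V) \ {0}))) := by
    rw [← (isOpenMap_toBlowup w).preimage_closure_eq_closure_preimage (continuous_toBlowup w)]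
    exact hy.1
  rw [mem_closure_iff_frequently] at h1
  have h2 : ∃ᶠ z : Cone N in 𝓝 y, K (z.1.1, L z.1) = z.1.2 := by
    refine h1.mono fun z hz => ?_
    obtain ⟨hzV, hz0⟩ : bd w z.1 ∈ Z ∩ V ∧ bd w z.1 ≠ 0 := hz
    have hu : z.1.1 ≠ 0 := by
      intro hu
      refine hz0 (funext fun i => ?_)
      simp [bd, hu, hw i]
    obtain ⟨h3, h4⟩ := hm _ hzV
    rw [hL.comm _ hzV.2] at h3 h4
    rw [hK.comm _ h3.2] at h4
    funext i
    exact mul_left_cancel₀ (pow_ne_zero (w i) hu) (congrFun h4 i)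
  have h3 : ContinuousAt (fun z : Cone N => (z.1.1, L z.1)) y :=
    (continuous_fst.comp continuous_subtype_val).continuousAt.prodMk
      ((hL.analytic_lift _ hyV.2).continuousAt.comp' continuous_subtype_val.continuousAt)
  have h4 : bd w' (y.1.1, L y.1) ∈ V' := by
    rw [← hL.comm _ hyV.2]
    exact (hm _ hyV).1.2
  have h5 : ContinuousAt (fun z : Cone N => K (z.1.1, L z.1)) y :=
    ContinuousAt.comp' (f := fun z : Cone N => (z.1.1, L z.1))
      (hK.analytic_lift _ h4).continuousAt h3
  exact tendsto_nhds_unique_of_frequently_eq h5.tendsto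
    (continuous_snd.comp continuous_subtype_val).continuousAt.tendsto h2

/-- If L vanished at (u, x), then x = K(u, 0) = 0, which is excluded in the cone. Thus the induced
map is defined on the whole strict transform, although it need not be on the ambient blowup. -/
theorem lift_ne_zero (hw : ∀ i, w i ≠ 0) (hL : IsLift w w' V Θ L) (hK : IsLift w' w V' Ψ K)
    (hm : MapsInvOn V V' Z Z' Θ Ψ) {y : Cone N}
    (hy : toBlowup w y ∈ strictTransform w (Z ∩ V)) : L y.1 ≠ 0 := by
  intro h
  have h1 := lift_lift hw hL hK hm hy
  rw [h, hK.map_zero] at h1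
  exact y.2 h1.symm

theorem blowMap_mem [Nonempty (Cone M)] (hw : ∀ i, w i ≠ 0) (hL : IsLift w w' V Θ L)
    (hK : IsLift w' w V' Ψ K) (hm : MapsInvOn V V' Z Z' Θ Ψ) (hΨ : Ψ 0 = 0) {t : Blowup w}
    (ht : t ∈ strictTransform w (Z ∩ V)) :
    blowMap w w' L t ∈ strictTransform w' (Z' ∩ V') ∧
      blowdown w' (blowMap w w' L t) = Θ (blowdown w t) := by
  have key : ∀ y : Cone N, bd w y.1 ∈ V → L y.1 ≠ 0 →
      blowdown w' (blowMap w w' L (toBlowup w y)) = Θ (bd w y.1) := by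
    intro y hy hLy
    rw [hL.blowMap_toBlowup, blowdown_toBlowup, coneMap_of_ne hLy, hL.comm _ hy]
  obtain ⟨y, rfl⟩ := toBlowup_surjective w t
  have hyV : bd w y.1 ∈ Z ∩ V := ht.2
  have hLy := lift_ne_zero hw hL hK hm ht
  have h1 := key y hyV.2 hLy
  refine ⟨⟨?_, ?_⟩, h1⟩
  · refine (hL.continuousAt_blowMap hyV.2 hLy).continuousWithinAt.mem_closure ht.1 ?_
    intro s hs
    obtain ⟨z, rfl⟩ := toBlowup_surjective w s
    have hs' : bd w z.1 ∈ Z ∩ V ∧ bd w z.1 ≠ 0 := hs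
    obtain ⟨hzV, hz0⟩ := hs'
    have hzs : toBlowup w z ∈ strictTransform w (Z ∩ V) := ⟨subset_closure hs, hzV⟩
    rw [Set.mem_preimage, key z hzV.2 (lift_ne_zero hw hL hK hm hzs)]
    obtain ⟨h2, h3⟩ := hm _ hzV
    refine ⟨h2, fun h4 => hz0 ?_⟩
    rw [Set.mem_singleton_iff.1 h4, hΨ] at h3
    exact h3.symm
  · rw [Set.mem_preimage, h1]
    exact (hm _ hyV).1

theorem blowMap_blowMap [Nonempty (Cone M)] [Nonempty (Cone N)] (hw : ∀ i, w i ≠ 0)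
    (hL : IsLift w w' V Θ L) (hK : IsLift w' w V' Ψ K) (hm : MapsInvOn V V' Z Z' Θ Ψ)
    {t : Blowup w} (ht : t ∈ strictTransform w (Z ∩ V)) :
    blowMap w' w K (blowMap w w' L t) = t := by
  obtain ⟨y, rfl⟩ := toBlowup_surjective w t
  have h1 := lift_lift hw hL hK hm ht
  have hLy := lift_ne_zero hw hL hK hm ht
  rw [hL.blowMap_toBlowup, hK.blowMap_toBlowup, coneMap_of_ne hLy]
  have h2 : K ((⟨(y.1.1, L y.1), hLy⟩ : Cone M)).1 ≠ 0 := by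
    rw [h1]
    exact y.2
  rw [coneMap_of_ne h2]
  congr 1
  exact Subtype.ext (Prod.ext rfl h1)

theorem holOn_blowMap [Nonempty (Cone M)] (hw : ∀ i, w i ≠ 0) (hL : IsLift w w' V Θ L)
    (hK : IsLift w' w V' Ψ K) (hm : MapsInvOn V V' Z Z' Θ Ψ)
    (E : strictTransform w (Z ∩ V) ≃ₜ strictTransform w' (Z' ∩ V'))
    (hE : ∀ t, (E t : Blowup w') = blowMap w w' L t) (t : strictTransform w (Z ∩ V))
    (s : strictTransform w' (Z' ∩ V') → ℂ)
    (hs : holOn (holBlowup w') (strictTransform w' (Z' ∩ V')) s (E t)) :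
    holOn (holBlowup w) (strictTransform w (Z ∩ V)) (s ∘ E) t := by
  obtain ⟨S, hS, hev⟩ := hs
  refine ⟨S ∘ blowMap w w' L, hL.holBlowup_comp ?_ (by rwa [← hE]), ?_⟩
  · intro y hy
    have ht : toBlowup w y ∈ strictTransform w (Z ∩ V) := by
      rw [hy]
      exact t.2
    exact ⟨ht.2.2, lift_ne_zero hw hL hK hm ht⟩
  · filter_upwards [E.continuous.continuousAt.eventually hev] with b hb
    rw [Function.comp_apply, hb, hE, Function.comp_apply]

theorem holOn_comp (hL : IsLift w w' V Θ L) (e : (Z ∩ V : Set _) ≃ₜ (Z' ∩ V' : Set _))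
    (he : ∀ z, (e z : Fin M → ℂ) = Θ z) (z : (Z ∩ V : Set _)) (s : (Z' ∩ V' : Set _) → ℂ)
    (hs : holOn (AnalyticAt ℂ) (Z' ∩ V') s (e z)) : holOn (AnalyticAt ℂ) (Z ∩ V) (s ∘ e) z := by
  obtain ⟨S, hS, hev⟩ := hs
  rw [he] at hS
  refine ⟨S ∘ Θ, hS.comp (hL.analytic _ z.2.2), ?_⟩
  filter_upwards [e.continuous.continuousAt.eventually hev] with b hb
  rw [Function.comp_apply, hb, he, Function.comp_apply]

/-- Germs of maps respecting the weights, whose restrictions to `Z` and `Z'` are inverse to each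
other, identify the weighted blowups of `Z` and `Z'` near the centres. -/
theorem blowupsLocallyEquivalent_of_maps [Nonempty (Cone M)] [Nonempty (Cone N)]
    (hw : ∀ i, w i ≠ 0) (hw' : ∀ i, w' i ≠ 0) (hZ : 0 ∈ Z) (hZ' : 0 ∈ Z')
    (hΘ : ∀ i, WGE w (w' i) fun x => Θ x i) (hΨ : ∀ i, WGE w' (w i) fun x => Ψ x i)
    (hm : ∀ᶠ z in 𝓝 0, z ∈ Z → Θ z ∈ Z' ∧ Ψ (Θ z) = z)
    (hm' : ∀ᶠ z in 𝓝 0, z ∈ Z' → Ψ z ∈ Z ∧ Θ (Ψ z) = z) :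
    BlowupsLocallyEquivalent w Z w' Z' := by
  have hΘ0 : Θ 0 = 0 := funext fun i => (hΘ i).at_zero (Nat.one_le_iff_ne_zero.2 (hw' i))
  have hΨ0 : Ψ 0 = 0 := funext fun i => (hΨ i).at_zero (Nat.one_le_iff_ne_zero.2 (hw i))
  obtain ⟨V₀, L, h0V₀, hL₀⟩ := exists_isLift hw' hΘ
  obtain ⟨V₀', K, h0V₀', hK₀⟩ := exists_isLift hw hΨ
  obtain ⟨V₁, hV₁, hV₁o, h0V₁⟩ := eventually_nhds_iff.1 hm
  obtain ⟨V₁', hV₁', hV₁o', h0V₁'⟩ := eventually_nhds_iff.1 hm'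
  have hL₁ := hL₀.subset (hL₀.isOpen.inter hV₁o) Set.inter_subset_left
  have hK₁ := hK₀.subset (hK₀.isOpen.inter hV₁o') Set.inter_subset_left
  -- The domains are shrunk so that Θ and Ψ map Z ∩ V and Z' ∩ V' into each other; the second factor
  -- of each intersection is preserved because the maps are inverse on Z and Z'.
  set V : Set (Fin N → ℂ) := (V₀ ∩ V₁) ∩ Θ ⁻¹' (V₀' ∩ V₁') with hV
  set V' : Set (Fin M → ℂ) := (V₀' ∩ V₁') ∩ Ψ ⁻¹' (V₀ ∩ V₁) with hV'
  have hVo : IsOpen V := ContinuousOn.isOpen_inter_preimage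
    (fun x hx => (hL₁.analytic x hx).continuousAt.continuousWithinAt) hL₁.isOpen hK₁.isOpen
  have hVo' : IsOpen V' := ContinuousOn.isOpen_inter_preimage
    (fun x hx => (hK₁.analytic x hx).continuousAt.continuousWithinAt) hK₁.isOpen hL₁.isOpen
  have hL := hL₁.subset hVo Set.inter_subset_left
  have hK := hK₁.subset hVo' Set.inter_subset_left
  have hmap : MapsInvOn V V' Z Z' Θ Ψ := by
    rintro z ⟨hz, hzV⟩
    obtain ⟨h1, h2⟩ := hV₁ z hzV.1.2 hz
    refine ⟨⟨h1, hzV.2, ?_⟩, h2⟩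
    rw [Set.mem_preimage, h2]
    exact hzV.1
  have hmap' : MapsInvOn V' V Z' Z Ψ Θ := by
    rintro z ⟨hz, hzV⟩
    obtain ⟨h1, h2⟩ := hV₁' z hzV.1.2 hz
    refine ⟨⟨h1, hzV.2, ?_⟩, h2⟩
    rw [Set.mem_preimage, h2]
    exact hzV.1
  let e : (Z ∩ V : Set _) ≃ₜ (Z' ∩ V' : Set _) :=
    { toFun := fun z => ⟨Θ z, (hmap z z.2).1⟩
      invFun := fun z => ⟨Ψ z, (hmap' z z.2).1⟩
      left_inv := fun z => Subtype.ext (hmap z z.2).2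
      right_inv := fun z => Subtype.ext (hmap' z z.2).2
      continuous_toFun := by
        refine Continuous.subtype_mk (continuous_iff_continuousAt.2 fun z => ?_) _
        exact (hL.analytic _ z.2.2).continuousAt.comp' continuous_subtype_val.continuousAt
      continuous_invFun := by
        refine Continuous.subtype_mk (continuous_iff_continuousAt.2 fun z => ?_) _
        exact (hK.analytic _ z.2.2).continuousAt.comp' continuous_subtype_val.continuousAt }
  let E : strictTransform w (Z ∩ V) ≃ₜ strictTransform w' (Z' ∩ V') :=
    { toFun := fun t => ⟨blowMap w w' L t, (blowMap_mem hw hL hK hmap hΨ0 t.2).1⟩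
      invFun := fun t => ⟨blowMap w' w K t, (blowMap_mem hw' hK hL hmap' hΘ0 t.2).1⟩
      left_inv := fun t => Subtype.ext (blowMap_blowMap hw hL hK hmap t.2)
      right_inv := fun t => Subtype.ext (blowMap_blowMap hw' hK hL hmap' t.2)
      continuous_toFun := by
        refine Continuous.subtype_mk (continuous_iff_continuousAt.2 fun t => ?_) _
        obtain ⟨t, ht⟩ := t
        obtain ⟨y, rfl⟩ := toBlowup_surjective w t
        exact ContinuousAt.comp' (f := Subtype.val)
          (hL.continuousAt_blowMap ht.2.2 (lift_ne_zero hw hL hK hmap ht))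
          continuous_subtype_val.continuousAt
      continuous_invFun := by
        refine Continuous.subtype_mk (continuous_iff_continuousAt.2 fun t => ?_) _
        obtain ⟨t, ht⟩ := t
        obtain ⟨y, rfl⟩ := toBlowup_surjective w' t
        exact ContinuousAt.comp' (f := Subtype.val)
          (hK.continuousAt_blowMap ht.2.2 (lift_ne_zero hw' hK hL hmap' ht))
          continuous_subtype_val.continuousAt }
  refine ⟨hZ, hZ', V, V', hVo, hVo', ⟨⟨h0V₀, h0V₁⟩, ?_⟩, ⟨⟨h0V₀', h0V₁'⟩, ?_⟩, e, E, ⟨?_, ?_⟩,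
    ⟨?_, ?_⟩, ?_, ?_⟩
  · rw [Set.mem_preimage, hΘ0]
    exact ⟨h0V₀', h0V₁'⟩
  · rw [Set.mem_preimage, hΨ0]
    exact ⟨h0V₀, h0V₁⟩
  · exact holOn_comp hL e fun _ => rfl
  · exact holOn_comp hK e.symm fun _ => rfl
  · exact holOn_blowMap hw hL hK hmap E fun _ => rfl
  · exact holOn_blowMap hw' hK hL hmap' E.symm fun _ => rfl
  · exact fun t => Subtype.ext (blowMap_mem hw hL hK hmap hΨ0 t.2).2
  · intro z
    constructor
    · intro h
      change Θ z = 0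
      rw [h, hΘ0]
    · intro h
      have h1 : Θ z = 0 := h
      rw [← (hmap z z.2).2, h1, hΨ0]

end

end Kawakita
end

noncomputable section
namespace Kawakita

/-! ## Biholomorphic germs and contact equivalence -/

/-- `φ` is the germ of a biholomorphic map fixing the origin, with inverse germ `ψ`. -/
structure IsGermIso {N : ℕ} (φ ψ : (Fin N → ℂ) → Fin N → ℂ) : Prop where
  analytic : AnalyticAt ℂ φ 0
  analytic_inv : AnalyticAt ℂ ψ 0
  map_zero : φ 0 = 0
  inv_zero : ψ 0 = 0
  right_inv : ∀ᶠ x in 𝓝 0, φ (ψ x) = x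
  left_inv : ∀ᶠ x in 𝓝 0, ψ (φ x) = x

theorem tendsto_of_analyticAt {N M : ℕ} {φ : (Fin N → ℂ) → Fin M → ℂ} (h : AnalyticAt ℂ φ 0)
    (h0 : φ 0 = 0) : Filter.Tendsto φ (𝓝 0) (𝓝 0) := by
  simpa [h0] using h.continuousAt.tendsto

namespace IsGermIso

variable {N : ℕ} {φ ψ φ' ψ' : (Fin N → ℂ) → Fin N → ℂ}

theorem symm (h : IsGermIso φ ψ) : IsGermIso ψ φ :=
  ⟨h.analytic_inv, h.analytic, h.inv_zero, h.map_zero, h.left_inv, h.right_inv⟩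

theorem refl : IsGermIso (fun x : Fin N → ℂ => x) fun x => x :=
  ⟨analyticAt_id, analyticAt_id, rfl, rfl, by simp, by simp⟩

theorem tendsto (h : IsGermIso φ ψ) : Filter.Tendsto φ (𝓝 0) (𝓝 0) :=
  tendsto_of_analyticAt h.analytic h.map_zero

theorem comp (h : IsGermIso φ ψ) (h' : IsGermIso φ' ψ') :
    IsGermIso (fun x => φ (φ' x)) fun x => ψ' (ψ x) where
  analytic := AnalyticAt.fun_comp (by rw [h'.map_zero]; exact h.analytic) h'.analytic
  analytic_inv := AnalyticAt.fun_comp (by rw [h.inv_zero]; exact h'.analytic_inv) h.analytic_inv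
  map_zero := by rw [h'.map_zero, h.map_zero]
  inv_zero := by rw [h.inv_zero, h'.inv_zero]
  right_inv := by
    filter_upwards [h.right_inv, h.symm.tendsto.eventually h'.right_inv] with x h1 h2
    rw [h2, h1]
  left_inv := by
    filter_upwards [h'.left_inv, h'.tendsto.eventually h.left_inv] with x h1 h2
    rw [h2, h1]

theorem eventually_ne_zero (h : IsGermIso φ ψ) : ∀ᶠ x in 𝓝 0, φ x = 0 → x = 0 := by
  filter_upwards [h.left_inv] with x hx h0
  rw [← hx, h0, h.inv_zero]

theorem fderiv_comp_fderiv (h : IsGermIso φ ψ) :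
    ∀ᶠ x in 𝓝 0, ∀ v, fderiv ℂ φ x (fderiv ℂ ψ (φ x) v) = v := by
  filter_upwards [h.left_inv, h.tendsto.eventually h.right_inv.eventually_nhds,
    h.analytic.eventually_analyticAt,
    h.tendsto.eventually h.analytic_inv.eventually_analyticAt] with x h1 h2 h3 h4 v
  have h5 : HasFDerivAt (fun y => φ (ψ y)) ((fderiv ℂ φ x).comp (fderiv ℂ ψ (φ x))) (φ x) := by
    refine HasFDerivAt.comp (φ x) (g := φ) ?_ h4.differentiableAt.hasFDerivAt
    rw [h1]
    exact h3.differentiableAt.hasFDerivAt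
  have h6 : HasFDerivAt (fun y => φ (ψ y)) (ContinuousLinearMap.id ℂ _) (φ x) :=
    (hasFDerivAt_id _).congr_of_eventuallyEq h2
  exact congrArg (fun A => A v) (h5.unique h6)

end IsGermIso

theorem exists_isGermIso {N : ℕ} {φ : (Fin N → ℂ) → Fin N → ℂ} (hφ : AnalyticAt ℂ φ 0)
    (h0 : φ 0 = 0) (hinj : ∀ v, fderiv ℂ φ 0 v = 0 → v = 0) : ∃ ψ, IsGermIso φ ψ := by
  have hi : Function.Injective (fderiv ℂ φ 0 : (Fin N → ℂ) →ₗ[ℂ] Fin N → ℂ) :=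
    (injective_iff_map_eq_zero _).2 hinj
  let e : (Fin N → ℂ) ≃L[ℂ] (Fin N → ℂ) :=
    (LinearEquiv.ofInjectiveEndo _ hi).toContinuousLinearEquiv
  have he : fderiv ℂ φ 0 = e := by
    ext v
    rfl
  have hs : HasStrictFDerivAt φ (e : (Fin N → ℂ) →L[ℂ] Fin N → ℂ) 0 := by
    rw [← he]
    exact hφ.hasStrictFDerivAt
  set R := hs.toOpenPartialHomeomorph φ with hR
  have hsrc : (0 : Fin N → ℂ) ∈ R.source := hs.mem_toOpenPartialHomeomorph_source
  have hcoe : ∀ x, R x = φ x := fun x => rfl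
  have hR0 : R 0 = 0 := by rw [hcoe, h0]
  have htgt : (0 : Fin N → ℂ) ∈ R.target := by
    rw [← hR0]
    exact R.map_source hsrc
  have hinv0 : R.symm 0 = 0 := by
    nth_rewrite 1 [← hR0]
    exact R.left_inv hsrc
  refine ⟨R.symm, hφ, ?_, h0, hinv0, ?_, ?_⟩
  · have := R.analyticAt_symm' (i := e) hsrc hφ he
    rwa [hR0] at this
  · filter_upwards [R.open_target.mem_nhds htgt] with x hx
    exact R.right_inv hx
  · filter_upwards [R.open_source.mem_nhds hsrc] with x hx
    exact R.left_inv hx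

theorem contactEquivalent_iff {N : ℕ} {f g : (Fin N → ℂ) → ℂ} : ContactEquivalent f g ↔
    ∃ φ ψ u, IsGermIso φ ψ ∧ AnalyticAt ℂ u 0 ∧ u 0 ≠ 0 ∧ ∀ᶠ x in 𝓝 0, g x = u x * f (φ x) := by
  constructor
  · rintro ⟨φ, ψ, u, h1, h2, h3, h4, h5, h6, h7⟩
    exact ⟨φ, ψ, u, ⟨h1, h2, h3, h4, h5, h6⟩, h7⟩
  · rintro ⟨φ, ψ, u, ⟨h1, h2, h3, h4, h5, h6⟩, h7⟩
    exact ⟨φ, ψ, u, h1, h2, h3, h4, h5, h6, h7⟩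

theorem IsGermIso.contactEquivalent {N : ℕ} {φ ψ : (Fin N → ℂ) → Fin N → ℂ} (h : IsGermIso φ ψ)
    {f g : (Fin N → ℂ) → ℂ} (hg : ∀ᶠ x in 𝓝 0, g x = f (φ x)) : ContactEquivalent f g :=
  contactEquivalent_iff.2 ⟨φ, ψ, fun _ => 1, h, analyticAt_const, one_ne_zero, by simpa using hg⟩

namespace ContactEquivalent

variable {N : ℕ} {f g h : (Fin N → ℂ) → ℂ}

theorem symm (hfg : ContactEquivalent f g) : ContactEquivalent g f := by
  obtain ⟨φ, ψ, u, h1, h2, h3, h4⟩ := contactEquivalent_iff.1 hfg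
  have hu : AnalyticAt ℂ (fun x => u (ψ x)) 0 :=
    AnalyticAt.fun_comp (by rw [h1.inv_zero]; exact h2) h1.analytic_inv
  have hu0 : u (ψ 0) ≠ 0 := by rwa [h1.inv_zero]
  refine contactEquivalent_iff.2 ⟨ψ, φ, fun x => (u (ψ x))⁻¹, h1.symm, hu.fun_inv hu0,
    inv_ne_zero hu0, ?_⟩
  filter_upwards [h1.symm.tendsto.eventually h4, h1.right_inv,
    hu.continuousAt.eventually_ne hu0] with x h5 h6 h7
  rw [h5, h6]
  field_simp

theorem trans (hfg : ContactEquivalent f g) (hgh : ContactEquivalent g h) :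
    ContactEquivalent f h := by
  obtain ⟨φ, ψ, u, h1, h2, h3, h4⟩ := contactEquivalent_iff.1 hfg
  obtain ⟨φ', ψ', u', h1', h2', h3', h4'⟩ := contactEquivalent_iff.1 hgh
  refine contactEquivalent_iff.2 ⟨_, _, fun x => u' x * u (φ' x), h1.comp h1', ?_, ?_, ?_⟩
  · exact h2'.fun_mul (AnalyticAt.fun_comp (by rw [h1'.map_zero]; exact h2) h1'.analytic)
  · change u' 0 * u (φ' 0) ≠ 0
    rw [h1'.map_zero]
    exact mul_ne_zero h3' h3
  · filter_upwards [h4', h1'.tendsto.eventually h4] with x h5 h6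
    rw [h5, h6]
    ring

/-- At a zero of g the term with du drops out, so dg = u · df ∘ dφ. As dφ is surjective and u is
nonzero, dg = 0 would force df = 0. -/
theorem isIsolated (hfg : ContactEquivalent f g) (hf : AnalyticAt ℂ f 0) (hi : IsIsolated f) :
    IsIsolated g := by
  obtain ⟨φ, ψ, u, h1, h2, h3, h4⟩ := contactEquivalent_iff.1 hfg
  have hi' := eventually_nhdsWithin_iff.1 hi
  refine eventually_nhdsWithin_iff.2 ?_
  filter_upwards [h1.tendsto.eventually hi', h1.eventually_ne_zero, h4.eventually_nhds,
    h1.fderiv_comp_fderiv, h2.continuousAt.eventually_ne h3, h2.eventually_analyticAt,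
    h1.analytic.eventually_analyticAt,
    h1.tendsto.eventually hf.eventually_analyticAt] with x k1 k2 k3 k4 k5 k6 k7 k8 hx hgx hd
  have hfx : f (φ x) = 0 := by
    have := k3.self_of_nhds
    rw [hgx] at this
    simpa [k5] using this.symm
  refine k1 (fun h => hx (k2 h)) hfx ?_
  have hd1 : HasFDerivAt (fun x => u x * f (φ x))
      (u x • ((fderiv ℂ f (φ x)).comp (fderiv ℂ φ x)) + f (φ x) • fderiv ℂ u x) x :=
    k6.differentiableAt.hasFDerivAt.mul
      (HasFDerivAt.comp x k8.differentiableAt.hasFDerivAt k7.differentiableAt.hasFDerivAt)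
  have hd2 := (hd1.congr_of_eventuallyEq k3).fderiv
  rw [hd, hfx] at hd2
  ext v
  have h5 := congrArg (fun A => A (fderiv ℂ ψ (φ x) v)) hd2
  simpa [k4, k5] using h5.symm

end ContactEquivalent

end Kawakita
end

noncomputable section
namespace Kawakita

/-! ## Invariance of weights under contact equivalence -/

/-- The function `x₁ x₂ + H(x₃, x₄)`. -/
def model (H : (Fin 2 → ℂ) → ℂ) (x : Fin 4 → ℂ) : ℂ := x 0 * x 1 + H ![x 2, x 3]

/-- The inclusion of the coordinate plane `x₁ = x₂ = 0`. -/
def slice : (Fin 2 → ℂ) →L[ℂ] Fin 4 → ℂ :=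
  ContinuousLinearMap.pi ![0, 0, ContinuousLinearMap.proj 0, ContinuousLinearMap.proj 1]

theorem slice_apply (s : Fin 2 → ℂ) : slice s = ![0, 0, s 0, s 1] := by
  ext i
  fin_cases i <;> rfl

theorem vec_pair_zero : (![0, 0] : Fin 2 → ℂ) = 0 := by
  ext i
  fin_cases i <;> rfl

theorem vec_pair_eta (s : Fin 2 → ℂ) : ![s 0, s 1] = s := by
  ext i
  fin_cases i <;> rfl

theorem fderiv_pi_apply {N M : ℕ} {φ : (Fin N → ℂ) → Fin M → ℂ} {x : Fin N → ℂ}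
    (h : AnalyticAt ℂ φ x) (v : Fin N → ℂ) (i : Fin M) :
    fderiv ℂ φ x v i = fderiv ℂ (fun y => φ y i) x v := by
  have h1 : HasFDerivAt (fun y => φ y i)
      ((ContinuousLinearMap.proj (R := ℂ) (φ := fun _ : Fin M => ℂ) i).comp (fderiv ℂ φ x)) x :=
    (ContinuousLinearMap.proj (R := ℂ) (φ := fun _ : Fin M => ℂ) i).hasFDerivAt.comp x
      h.differentiableAt.hasFDerivAt
  rw [h1.fderiv]
  rfl

theorem wge_pair {N : ℕ} {w : Fin N → ℕ} {b c k : ℕ} {g : (Fin 2 → ℂ) → ℂ}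
    (hg : WGE ![b, c] k g) {F G : (Fin N → ℂ) → ℂ} (hF : WGE w b F) (hG : WGE w c G)
    (hF0 : F 0 = 0) (hG0 : G 0 = 0) : WGE w k fun x => g ![F x, G x] := by
  refine hg.comp (φ := fun x => ![F x, G x]) ?_ ?_
  · simp only [hF0, hG0, vec_pair_zero]
  · intro i
    fin_cases i
    · exact hF
    · exact hG

theorem analyticAt_pair {N : ℕ} {g : (Fin 2 → ℂ) → ℂ} (hg : AnalyticAt ℂ g 0)
    {F G : (Fin N → ℂ) → ℂ} (hF : AnalyticAt ℂ F 0) (hG : AnalyticAt ℂ G 0)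
    (hF0 : F 0 = 0) (hG0 : G 0 = 0) : AnalyticAt ℂ (fun x => g ![F x, G x]) 0 :=
  (wge_pair (w := fun _ => 0) (b := 0) (c := 0) (WGE.of_analyticAt hg) (WGE.of_analyticAt hF)
    (WGE.of_analyticAt hG) hF0 hG0).analyticAt

/-- The first two coordinates are themselves partial derivatives of the model, so the chain rule
controls the corresponding components of any isomorphism between models. -/
theorem pd_model {H : (Fin 2 → ℂ) → ℂ} {x : Fin 4 → ℂ}
    (h : AnalyticAt ℂ (fun x : Fin 4 → ℂ => H ![x 2, x 3]) x) :
    pd 0 (model H) x = x 1 ∧ pd 1 (model H) x = x 0 := by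
  have h0 : AnalyticAt ℂ (fun x : Fin 4 → ℂ => x 0 * x 1) x :=
    (analyticAt_coord 0 x).fun_mul (analyticAt_coord 1 x)
  have key : ∀ i : Fin 4, i = 0 ∨ i = 1 → pd i (fun x : Fin 4 → ℂ => H ![x 2, x 3]) x = 0 := by
    intro i hi
    have h1 : (fun t : ℂ => H ![(x + t • (Pi.single i 1 : Fin 4 → ℂ)) 2,
        (x + t • (Pi.single i 1 : Fin 4 → ℂ)) 3]) = fun _ => H ![x 2, x 3] := by
      funext t
      rcases hi with rfl | rfl <;> simp
    have h2 := h.differentiableAt.hasFDerivAt.hasLineDerivAt (Pi.single i 1)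
    have h3 : HasDerivAt (fun t : ℂ => H ![(x + t • (Pi.single i 1 : Fin 4 → ℂ)) 2,
        (x + t • (Pi.single i 1 : Fin 4 → ℂ)) 3])
        (pd i (fun x : Fin 4 → ℂ => H ![x 2, x 3]) x) 0 := h2
    rw [h1] at h3
    exact h3.unique (hasDerivAt_const _ _)
  have h4 : ∀ i : Fin 4, pd i (model H) x = pd i (fun x : Fin 4 → ℂ => x 0 * x 1) x +
      pd i (fun x : Fin 4 → ℂ => H ![x 2, x 3]) x := by
    intro i
    unfold model
    rw [pd, fderiv_fun_add h0.differentiableAt h.differentiableAt]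
    rfl
  constructor
  · rw [h4, key 0 (Or.inl rfl), pd_mul (analyticAt_coord 0 x) (analyticAt_coord 1 x), pd_coord,
      pd_coord]
    simp
  · rw [h4, key 1 (Or.inr rfl), pd_mul (analyticAt_coord 0 x) (analyticAt_coord 1 x), pd_coord,
      pd_coord]
    simp

/-- Write G = u⁻¹(x₁x₂ + g), which is the model of H composed with φ. By the chain rule φ₁ and φ₂
are combinations of the partial derivatives of G, all of weight at least bn for the weights (bn, bn,
b, 1). Restricting to x₁ = x₂ = 0 gives H(ξ) = u⁻¹g - φ₁φ₂, with ξ formed by the last two components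
of φ. The right-hand side has weight at least b(n + 1), because 2bn ≥ b(n + 1). -/
theorem exists_germIso_of_contactEquivalent {H g : (Fin 2 → ℂ) → ℂ} (hH : AnalyticAt ℂ H 0)
    {b n : ℕ} (hb : 1 ≤ b) (hn : 2 ≤ n) (hg : WGE ![b, 1] (b * (n + 1)) g)
    (h : ContactEquivalent (model H) (model g)) :
    ∃ ξ η : (Fin 2 → ℂ) → Fin 2 → ℂ, IsGermIso ξ η ∧
      WGE ![b, 1] (b * (n + 1)) fun s => H (ξ s) := by
  obtain ⟨φ, ψ, u, hφ, hu, hu0, heq⟩ := contactEquivalent_iff.1 h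
  have hui : AnalyticAt ℂ (fun x => (u x)⁻¹) 0 := hu.fun_inv hu0
  have hga := hg.analyticAt
  have hbn : b * (n + 1) = b * n + b := by ring
  have hbn' : b ≤ b * n := Nat.le_mul_of_pos_right b (by omega)
  set w : Fin 4 → ℕ := ![b * n, b * n, b, 1] with hw
  -- The term u⁻¹g is differentiated with weight 0 on x₁ and x₂, so that no derivative loses more
  -- than b; with the weights w, differentiating in x₁ or x₂ would lose bn.
  set w' : Fin 4 → ℕ := ![0, 0, b, 1] with hw'
  have hg' : WGE w' (b * (n + 1)) fun x : Fin 4 → ℂ => (u x)⁻¹ * g ![x 2, x 3] :=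
    (wge_pair hg (WGE.coord (w := w') 2) (WGE.coord (w := w') 3) rfl rfl).mul_left hui
  have hx' : WGE w (b * n + b * n) fun x : Fin 4 → ℂ => (u x)⁻¹ * (x 0 * x 1) :=
    ((WGE.coord (w := w) 0).mul (WGE.coord (w := w) 1)).mul_left hui
  set G : (Fin 4 → ℂ) → ℂ := fun x => (u x)⁻¹ * (x 0 * x 1) + (u x)⁻¹ * g ![x 2, x 3] with hG
  have hGa : AnalyticAt ℂ G 0 := hx'.analyticAt.fun_add hg'.analyticAt
  have hpd : ∀ j, WGE w (b * n) (pd j G) := by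
    intro j
    have h1 : WGE w (b * n) (pd j fun x : Fin 4 → ℂ => (u x)⁻¹ * (x 0 * x 1)) := by
      refine (hx'.pd j).le ?_
      have : w j ≤ b * n := by fin_cases j <;> simp [hw] <;> omega
      omega
    have h2 : WGE w (b * n) (pd j fun x : Fin 4 → ℂ => (u x)⁻¹ * g ![x 2, x 3]) := by
      have h3 : b * n ≤ b * (n + 1) - w' j := by
        have : w' j ≤ b := by fin_cases j <;> simp [hw'] <;> omega
        omega
      refine ((hg'.pd j).le h3).of_weight fun d hd => hd.trans ?_
      simp only [Finsupp.weight_apply, Finsupp.sum]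
      refine Finset.sum_le_sum fun i _ => Nat.mul_le_mul_left _ ?_
      fin_cases i <;> simp [hw, hw']
    refine (h1.add h2).congr ?_
    filter_upwards [hx'.analyticAt.eventually_analyticAt,
      hg'.analyticAt.eventually_analyticAt] with x k1 k2
    rw [hG, pd, fderiv_fun_add k1.differentiableAt k2.differentiableAt]
    rfl
  have hGφ : ∀ᶠ x in 𝓝 0, G x = model H (φ x) := by
    filter_upwards [heq, hu.continuousAt.eventually_ne hu0] with x k1 k2
    rw [model] at k1
    simp only [hG]
    rw [← mul_add, k1]
    field_simp
  have hGψ : ∀ᶠ y in 𝓝 0, model H y = G (ψ y) := by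
    filter_upwards [hφ.symm.tendsto.eventually hGφ, hφ.right_inv] with y k1 k2
    rw [k1, k2]
  have hHa : AnalyticAt ℂ (fun x : Fin 4 → ℂ => H ![x 2, x 3]) 0 :=
    analyticAt_pair hH (analyticAt_coord 2 0) (analyticAt_coord 3 0) rfl rfl
  have hder : ∀ i : Fin 4, ∀ᶠ x in 𝓝 0, pd i (model H) (φ x) =
      ∑ j, fderiv ℂ ψ (φ x) (Pi.single i 1) j * pd j G x := by
    intro i
    filter_upwards [hφ.tendsto.eventually hGψ.eventually_nhds, hφ.left_inv,
      hφ.tendsto.eventually hφ.analytic_inv.eventually_analyticAt,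
      hGa.eventually_analyticAt] with x k1 k2 k3 k4
    have k5 : HasFDerivAt (fun y => G (ψ y)) ((fderiv ℂ G x).comp (fderiv ℂ ψ (φ x))) (φ x) := by
      refine HasFDerivAt.comp (φ x) (g := G) ?_ k3.differentiableAt.hasFDerivAt
      rw [k2]
      exact k4.differentiableAt.hasFDerivAt
    rw [pd, (k5.congr_of_eventuallyEq k1).fderiv, ContinuousLinearMap.comp_apply,
      fderiv_eq_sum_pd]
  have hv : ∀ i j : Fin 4, AnalyticAt ℂ (fun x => fderiv ℂ ψ (φ x) (Pi.single i 1) j) 0 := by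
    intro i j
    have k1 : AnalyticAt ℂ (fun x => fderiv ℂ ψ (φ x)) 0 :=
      AnalyticAt.fun_comp (by rw [hφ.map_zero]; exact hφ.analytic_inv.fderiv) hφ.analytic
    have k2 : AnalyticAt ℂ (fun x => fderiv ℂ ψ (φ x) (Pi.single i 1)) 0 :=
      ((ContinuousLinearMap.apply ℂ (Fin 4 → ℂ)
        (Pi.single i (1 : ℂ) : Fin 4 → ℂ)).analyticAt _).comp k1
    exact (analyticAt_pi_iff.1 k2) j
  have hsum : ∀ i : Fin 4, WGE w (b * n) fun x => pd i (model H) (φ x) := by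
    intro i
    exact (WGE.sum _ fun j _ => (hpd j).mul_left (hv i j)).congr (hder i)
  have hφ0 : WGE w (b * n) fun x => φ x 0 := by
    refine (hsum 1).congr ?_
    filter_upwards [hφ.tendsto.eventually hHa.eventually_analyticAt] with x k
    exact (pd_model k).2.symm
  have hφ1 : WGE w (b * n) fun x => φ x 1 := by
    refine (hsum 0).congr ?_
    filter_upwards [hφ.tendsto.eventually hHa.eventually_analyticAt] with x k
    exact (pd_model k).1.symm
  have hslice0 : slice 0 = 0 := _root_.map_zero slice
  have hslice : ∀ i, WGE ![b, 1] (w i) fun s => slice s i := by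
    intro i
    simp only [slice_apply]
    fin_cases i
    · exact WGE.zero
    · exact WGE.zero
    · exact WGE.coord (w := ![b, 1]) 0
    · exact WGE.coord (w := ![b, 1]) 1
  have hsl : Filter.Tendsto slice (𝓝 0) (𝓝 0) := tendsto_of_analyticAt (slice.analyticAt 0) hslice0
  have hs0 : WGE ![b, 1] (b * n) fun s => φ (slice s) 0 := hφ0.comp hslice0 hslice
  have hs1 : WGE ![b, 1] (b * n) fun s => φ (slice s) 1 := hφ1.comp hslice0 hslice
  -- A monomial of degree at most 1 has weight at most b, which is less than bn as n ≥ 2.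
  have hord : ∀ f, WGE ![b, 1] (b * n) f → fderiv ℂ f (0 : Fin 2 → ℂ) = 0 := by
    intro f hf
    refine (hf.of_weight (w' := fun _ => 1) (l := 2) fun d hd => ?_).fderiv_eq_zero
    rw [Finsupp.weight_apply, Finsupp.sum_fintype _ _ (by simp), Fin.sum_univ_two] at hd ⊢
    simp only [smul_eq_mul, Matrix.cons_val_zero, Matrix.cons_val_one, mul_one] at hd ⊢
    nlinarith
  have hΦ : AnalyticAt ℂ (fun s => φ (slice s)) 0 :=
    AnalyticAt.fun_comp (by rw [hslice0]; exact hφ.analytic) (slice.analyticAt 0)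
  have hΦi : ∀ i, AnalyticAt ℂ (fun s => φ (slice s) i) 0 := analyticAt_pi_iff.1 hΦ
  set ξ : (Fin 2 → ℂ) → Fin 2 → ℂ := fun s => ![φ (slice s) 2, φ (slice s) 3] with hξ
  have hξa : AnalyticAt ℂ ξ 0 := by
    refine analyticAt_pi_iff.2 fun i => ?_
    fin_cases i
    · exact hΦi 2
    · exact hΦi 3
  have hξ0 : ξ 0 = 0 := by
    simp only [hξ, hslice0, hφ.map_zero]
    exact vec_pair_zero
  -- On the slice the first two components of φ have no linear part, so a vector killed by dξ is
  -- killed by dφ.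
  have hinj : ∀ v, fderiv ℂ ξ 0 v = 0 → v = 0 := by
    intro v hv
    have k1 : fderiv ℂ (fun s => φ (slice s)) 0 v = 0 := by
      funext i
      rw [fderiv_pi_apply hΦ]
      have k2 := fderiv_pi_apply hξa v
      fin_cases i
      · change fderiv ℂ (fun s => φ (slice s) 0) 0 v = 0
        rw [hord _ hs0]
        rfl
      · change fderiv ℂ (fun s => φ (slice s) 1) 0 v = 0
        rw [hord _ hs1]
        rfl
      · exact (k2 0).symm.trans (congrFun hv 0)
      · exact (k2 1).symm.trans (congrFun hv 1)
    have k2 : HasFDerivAt (fun s => φ (slice s)) ((fderiv ℂ φ 0).comp slice) 0 := by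
      refine HasFDerivAt.comp (0 : Fin 2 → ℂ) (g := φ) ?_ slice.hasFDerivAt
      rw [hslice0]
      exact hφ.analytic.differentiableAt.hasFDerivAt
    rw [k2.fderiv, ContinuousLinearMap.comp_apply] at k1
    have k3 := hφ.symm.fderiv_comp_fderiv.self_of_nhds (slice v)
    rw [hφ.inv_zero, k1, _root_.map_zero, slice_apply] at k3
    rw [← vec_pair_eta v, ← vec_pair_zero]
    exact congrArg₂ (fun x y => ![x, y]) (congrFun k3 2).symm (congrFun k3 3).symm
  obtain ⟨η, hη⟩ := exists_isGermIso hξa hξ0 hinj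
  refine ⟨ξ, η, hη, ?_⟩
  have huis : AnalyticAt ℂ (fun s => (u (slice s))⁻¹) 0 :=
    AnalyticAt.fun_comp (f := slice) (by rw [hslice0]; exact hui) (slice.analyticAt 0)
  have h1 := (hg.mul_left huis).sub
    ((hs0.mul hs1).le (l := b * (n + 1)) (by omega))
  refine h1.congr ?_
  filter_upwards [hsl.eventually hGφ] with s k1
  have j0 : slice s 0 = 0 := by rw [slice_apply]; rfl
  have j1 : slice s 1 = 0 := by rw [slice_apply]; rfl
  have j2 : slice s 2 = s 0 := by rw [slice_apply]; rfl
  have j3 : slice s 3 = s 1 := by rw [slice_apply]; rfl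
  simp only [hG, j0, j1, j2, j3, vec_pair_eta, model, mul_zero, zero_add] at k1
  simp only [hξ]
  rw [k1]
  ring

theorem wge_ones_iff {k : ℕ} {f : (Fin 2 → ℂ) → ℂ} : WGE ![1, 1] k f ↔ WGE (fun _ => 1) k f := by
  have : (![1, 1] : Fin 2 → ℕ) = fun _ => 1 := by
    ext i
    fin_cases i <;> rfl
  rw [this]

/-- For equal weights every germ fixing the origin preserves weight bounds, so the coordinate change
ξ can be undone. -/
theorem wge_of_contactEquivalent {H g : (Fin 2 → ℂ) → ℂ} (hH : AnalyticAt ℂ H 0) {n : ℕ}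
    (hn : 2 ≤ n) (hg : WGE (fun _ => 1) (n + 1) g) (h : ContactEquivalent (model H) (model g)) :
    WGE (fun _ => 1) (n + 1) H := by
  obtain ⟨ξ, η, hξ, h1⟩ := exists_germIso_of_contactEquivalent hH le_rfl hn
    (by simpa using wge_ones_iff.2 hg) h
  rw [one_mul, wge_ones_iff] at h1
  have h2 : WGE (fun _ => 1) (n + 1) fun s => H (ξ (η s)) := by
    refine h1.comp (φ := η) hξ.inv_zero fun i => ?_
    exact exists_order_le (analyticAt_pi_iff.1 hξ.analytic_inv i) (congrFun hξ.inv_zero i)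
  refine h2.congr ?_
  filter_upwards [hξ.right_inv] with s hs
  rw [hs]

theorem order_eq_of_contactEquivalent {p q : MvPowerSeries (Fin 2) ℂ} (hp : IsConvergent p)
    (hq : IsConvergent q) {n : ℕ} (hn : 2 ≤ n)
    (hqo : q.order = ((n + 1 : ℕ) : ℕ∞))
    (h : ContactEquivalent (model (seriesSum p)) (model (seriesSum q))) :
    p.order = ((n + 1 : ℕ) : ℕ∞) := by
  have key : ∀ {p q : MvPowerSeries (Fin 2) ℂ}, IsConvergent p → IsConvergent q →
      ContactEquivalent (model (seriesSum p)) (model (seriesSum q)) → ∀ m : ℕ, 2 ≤ m →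
      ((m + 1 : ℕ) : ℕ∞) ≤ q.order → ((m + 1 : ℕ) : ℕ∞) ≤ p.order := by
    intro p q hp hq h m hm hqm
    exact (wge_of_contactEquivalent hp.analyticAt hm (hq.wge hqm) h).le_weightedOrder
      (fun _ => one_ne_zero) hp
  refine le_antisymm ?_ (key hp hq h n hn hqo.ge)
  by_contra hlt
  rw [not_le] at hlt
  have h1 : ((n + 1 + 1 : ℕ) : ℕ∞) ≤ p.order := by
    have := Order.add_one_le_of_lt hlt
    exact_mod_cast this
  have h2 := key hq hp h.symm (n + 1) (by omega) h1
  rw [hqo] at h2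
  have : n + 1 + 1 ≤ n + 1 := by exact_mod_cast h2
  omega

end Kawakita
end

noncomputable section
namespace Kawakita

/-! ## The splitting lemma -/

theorem exists_sqrt {N : ℕ} {V : (Fin N → ℂ) → ℂ} (hV : AnalyticAt ℂ V 0) (h1 : V 0 = 1) :
    ∃ W : (Fin N → ℂ) → ℂ, AnalyticAt ℂ W 0 ∧ W 0 = 1 ∧ ∀ᶠ x in 𝓝 0, W x ^ 2 = V x := by
  refine ⟨fun x => Complex.exp (Complex.log (V x) / 2), ?_, by simp [h1], ?_⟩
  · refine AnalyticAt.cexp ((hV.clog ?_).fun_div analyticAt_const two_ne_zero)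
    rw [h1]
    exact Complex.one_mem_slitPlane
  · filter_upwards [hV.continuousAt.eventually_ne (h1.trans_ne one_ne_zero)]
      with x hx
    rw [← Complex.exp_nat_mul]
    push_cast
    rw [mul_div_cancel₀ _ two_ne_zero, Complex.exp_log hx]

theorem restrictPt_erase {N : ℕ} (i : Fin N) (x : Fin N → ℂ) :
    restrictPt (Finset.univ.erase i) x = Function.update x i 0 := by
  funext j
  by_cases hj : j = i
  · subst hj
    simp [restrictPt]
  · simp [restrictPt, hj]

theorem analyticAt_update {N : ℕ} {φ : (Fin N → ℂ) → Fin N → ℂ} {s : (Fin N → ℂ) → ℂ}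
    {x : Fin N → ℂ} (hφ : AnalyticAt ℂ φ x) (hs : AnalyticAt ℂ s x) (i : Fin N) :
    AnalyticAt ℂ (fun x => Function.update (φ x) i (s x)) x := by
  refine analyticAt_pi_iff.2 fun j => ?_
  by_cases hj : j = i
  · subst hj
    simpa using hs
  · simpa [hj] using (analyticAt_pi_iff.1 hφ) j

/-- Splitting off one variable: `f = c ((x_i - s) W)² + f|_{x_i = s}`. -/
theorem exists_split_var {N : ℕ} (i : Fin N) {c : ℂ} (hc : c ≠ 0) {f A F : (Fin N → ℂ) → ℂ}
    (hf : ∀ x, f x = c * x i ^ 2 + A x + F x) (hA : AnalyticAt ℂ A 0)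
    (hAi : ∀ x t, A (Function.update x i t) = A x) (hA0 : A 0 = 0) (hF : WGE (fun _ => 1) 3 F) :
    ∃ s W : (Fin N → ℂ) → ℂ, WGE (fun _ => 1) 2 s ∧ (∀ x t, s (Function.update x i t) = s x) ∧
      AnalyticAt ℂ W 0 ∧ W 0 = 1 ∧
      ∀ᶠ x in 𝓝 0, f x = c * ((x i - s x) * W x) ^ 2 + f (Function.update x i (s x)) := by
  classical
  have hfa : AnalyticAt ℂ f 0 := by
    rw [funext hf]
    exact ((analyticAt_const.fun_mul ((analyticAt_coord i 0).fun_pow 2)).fun_add hA).fun_add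
      hF.analyticAt
  have hpdA : ∀ x, AnalyticAt ℂ A x → pd i A x = 0 := by
    intro x hx
    have h1 : HasDerivAt (fun t : ℂ => A (x + t • (Pi.single i 1 : Fin N → ℂ))) (pd i A x) 0 :=
      hx.differentiableAt.hasFDerivAt.hasLineDerivAt (Pi.single i 1)
    have h2 : (fun t : ℂ => A (x + t • (Pi.single i 1 : Fin N → ℂ))) = fun _ => A x := by
      funext t
      rw [← hAi x (x i + t)]
      congr 1
      funext j
      by_cases hj : j = i
      · subst hj
        simp
      · simp [hj]
    rw [h2] at h1
    exact h1.unique (hasDerivAt_const _ _)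
  set δ : (Fin N → ℂ) → ℂ := fun x => (2 * c)⁻¹ * pd i F x with hδ
  have hδw : WGE (fun _ => 1) 2 δ := (hF.pd i).const_mul _
  have hpdf : ∀ᶠ x in 𝓝 0, pd i f x = 2 * c * (x i + δ x) := by
    filter_upwards [hA.eventually_analyticAt, hF.analyticAt.eventually_analyticAt] with x h1 h2
    have h3 : AnalyticAt ℂ (fun x : Fin N → ℂ => c * x i ^ 2) x :=
      analyticAt_const.fun_mul ((analyticAt_coord i x).fun_pow 2)
    have h4 : pd i f x = pd i (fun x : Fin N → ℂ => c * x i ^ 2) x + pd i A x + pd i F x := by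
      rw [funext hf, pd, fderiv_fun_add (h3.fun_add h1).differentiableAt h2.differentiableAt,
        fderiv_fun_add h3.differentiableAt h1.differentiableAt]
      rfl
    have h5 : pd i (fun x : Fin N → ℂ => c * x i ^ 2) x = 2 * c * x i := by
      have : (fun x : Fin N → ℂ => c * x i ^ 2) = fun x => (c * x i) * x i := by
        funext x
        ring
      rw [this, pd_mul (analyticAt_const.fun_mul (analyticAt_coord i x)) (analyticAt_coord i x),
        pd_mul analyticAt_const (analyticAt_coord i x), pd_coord]
      simp [pd]
      ring
    rw [h4, h5, hpdA x h1, hδ]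
    field_simp
    ring
  -- The normalised derivative ∂ᵢf / 2c becomes the i-th coordinate. As δ has multiplicity at least
  -- 2, the linear part of Φ is the identity.
  set Φ : (Fin N → ℂ) → Fin N → ℂ := fun x => Function.update x i (x i + δ x) with hΦ
  have hΦa : AnalyticAt ℂ Φ 0 :=
    analyticAt_update analyticAt_id ((analyticAt_coord i 0).fun_add hδw.analyticAt) i
  have hΦ0 : Φ 0 = 0 := by
    simp [hΦ, hδw.at_zero one_le_two]
  have hcoord : ∀ j, fderiv ℂ (fun x : Fin N → ℂ => x j) 0 =
      ContinuousLinearMap.proj (R := ℂ) (φ := fun _ : Fin N => ℂ) j := fun j =>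
    (ContinuousLinearMap.proj (R := ℂ) (φ := fun _ : Fin N => ℂ) j).hasFDerivAt.fderiv
  have hinj : ∀ v, fderiv ℂ Φ 0 v = 0 → v = 0 := by
    intro v hv
    funext j
    have h1 := congrFun hv j
    rw [fderiv_pi_apply hΦa] at h1
    by_cases hj : j = i
    · subst hj
      simp only [hΦ, Function.update_self] at h1
      rw [fderiv_fun_add (analyticAt_coord j 0).differentiableAt hδw.analyticAt.differentiableAt,
        hδw.fderiv_eq_zero, hcoord] at h1
      simpa using h1
    · simp only [hΦ, Function.update_of_ne hj] at h1
      rw [hcoord] at h1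
      simpa using h1
  obtain ⟨Ψ, hΨ⟩ := exists_isGermIso hΦa hΦ0 hinj
  -- The critical point of f in the direction xᵢ, read off from the inverse of Φ where the new
  -- coordinate is 0.
  set s : (Fin N → ℂ) → ℂ := fun x => Ψ (Function.update x i 0) i with hs
  have hρ : AnalyticAt ℂ (fun x : Fin N → ℂ => Function.update x i (0 : ℂ)) 0 :=
    analyticAt_update analyticAt_id analyticAt_const i
  have hρ0 : Function.update (0 : Fin N → ℂ) i 0 = 0 := by simp
  have hρt := tendsto_of_analyticAt hρ hρ0
  have hsi : ∀ x t, s (Function.update x i t) = s x := by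
    intro x t
    simp [hs]
  have hsa : AnalyticAt ℂ s 0 := by
    refine AnalyticAt.fun_comp (f := fun x : Fin N → ℂ => Function.update x i (0 : ℂ))
      (g := fun y => Ψ y i) ?_ hρ
    rw [hρ0]
    exact analyticAt_pi_iff.1 hΨ.analytic_inv i
  have hs0 : s 0 = 0 := by
    simp only [hs, hρ0, hΨ.inv_zero]
    rfl
  have hkey : ∀ᶠ x in 𝓝 0, s x + δ (Function.update x i (s x)) = 0 := by
    filter_upwards [hρt.eventually hΨ.right_inv] with x hx
    have h1 : Ψ (Function.update x i 0) = Function.update x i (s x) := by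
      funext j
      by_cases hj : j = i
      · subst hj
        simp [hs]
      · have := congrFun hx j
        simp only [hΦ, Function.update_of_ne hj] at this
        simp [hj, this]
    have h2 := congrFun hx i
    simp only [hΦ, Function.update_self] at h2
    rw [h1, Function.update_self] at h2
    exact h2
  have hsupd : AnalyticAt ℂ (fun x => Function.update x i (s x)) 0 :=
    analyticAt_update analyticAt_id hsa i
  have hsupd0 : Function.update (0 : Fin N → ℂ) i (s 0) = 0 := by simp [hs0]
  have hsw : WGE (fun _ => 1) 2 s := by
    refine (hδw.comp (φ := fun x => Function.update x i (s x)) (w := fun _ => 1) hsupd0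
      fun j => ?_).neg.congr ?_
    · exact exists_order_le (analyticAt_pi_iff.1 hsupd j) (congrFun hsupd0 j)
    · filter_upwards [hkey] with x hx
      exact eq_neg_of_add_eq_zero_left hx
  set S : (Fin N → ℂ) → Fin N → ℂ := fun x => Function.update x i (x i + s x) with hS
  have hSa : AnalyticAt ℂ S 0 :=
    analyticAt_update analyticAt_id ((analyticAt_coord i 0).fun_add hsa) i
  have hS0 : S 0 = 0 := by simp [hS, hs0]
  -- This is f minus its critical value, translated so that the critical point lies at xᵢ = 0.
  set k : (Fin N → ℂ) → ℂ := fun x => f (S x) - f (Function.update x i (s x)) with hk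
  have hfS : AnalyticAt ℂ (fun x => f (S x)) 0 := AnalyticAt.fun_comp (by rwa [hS0]) hSa
  have hf2 : AnalyticAt ℂ (fun x => f (Function.update x i (s x))) 0 :=
    AnalyticAt.fun_comp (by rwa [hsupd0]) hsupd
  have hka : AnalyticAt ℂ k 0 := hfS.fun_sub hf2
  obtain ⟨k₁, hk₁, hkk₁⟩ := exists_eq_mul_of_restrictPt (i := i) hka (by
    refine Filter.Eventually.of_forall fun x => ?_
    rw [restrictPt_erase]
    simp [hk, hS, hsi])
  -- The value of k₁ at xᵢ = 0 is the derivative of f at the critical point, so a second factor xᵢ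
  -- splits off.
  obtain ⟨k₂, hk₂, hkk₂⟩ := exists_eq_mul_of_restrictPt (i := i) hk₁ (by
    simp only [restrictPt_erase]
    filter_upwards [hρt.eventually hkk₁.eventually_nhds, hρt.eventually hk₁.eventually_analyticAt,
      (tendsto_of_analyticAt hsupd hsupd0).eventually hpdf, hkey,
      (tendsto_of_analyticAt hsupd hsupd0).eventually hfa.eventually_analyticAt,
      hρt.eventually hka.eventually_analyticAt]
      with x h1 h2 h3 h4 h5 h6
    have h7 : pd i k (Function.update x i 0) = k₁ (Function.update x i 0) := by
      rw [(eventually_pd_congr h1).self_of_nhds, pd_mul (analyticAt_coord i _) h2, pd_coord]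
      simp
    have h8 : HasDerivAt (fun t : ℂ => k (Function.update x i 0 + t • (Pi.single i 1 : Fin N → ℂ)))
        (pd i k (Function.update x i 0)) 0 :=
      h6.differentiableAt.hasFDerivAt.hasLineDerivAt (Pi.single i 1)
    have h9 : HasDerivAt (fun t : ℂ => f (Function.update x i (s x) +
        t • (Pi.single i 1 : Fin N → ℂ))) (pd i f (Function.update x i (s x))) 0 :=
      h5.differentiableAt.hasFDerivAt.hasLineDerivAt (Pi.single i 1)
    have h10 : (fun t : ℂ => k (Function.update x i 0 + t • (Pi.single i 1 : Fin N → ℂ))) =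
        fun t => f (Function.update x i (s x) + t • (Pi.single i 1 : Fin N → ℂ)) -
          f (Function.update x i (s x)) := by
      funext t
      have e1 : Function.update x i 0 + t • (Pi.single i 1 : Fin N → ℂ) =
          Function.update x i t := by
        funext j
        by_cases hj : j = i
        · subst hj
          simp
        · simp [hj]
      have e2 : Function.update x i (s x) + t • (Pi.single i 1 : Fin N → ℂ) =
          Function.update x i (t + s x) := by
        funext j
        by_cases hj : j = i
        · subst hj
          simp [add_comm]
        · simp [hj]
      rw [e1, e2]
      simp [hk, hS, hsi]
    rw [h10] at h8
    rw [← h7, h8.unique (h9.sub_const _), h3]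
    simp [h4])
  have hk2 : ∀ᶠ x in 𝓝 0, k x = x i ^ 2 * k₂ x := by
    filter_upwards [hkk₁, hkk₂] with x h1 h2
    rw [h1, h2]
    ring
  have hline : ContinuousAt (fun t : ℂ => (Pi.single i t : Fin N → ℂ)) 0 :=
    (continuous_single i).continuousAt
  have hline0 : Filter.Tendsto (fun t : ℂ => (Pi.single i t : Fin N → ℂ)) (𝓝 0) (𝓝 0) := by
    simpa using hline.tendsto
  -- On the xᵢ-axis s and A vanish, and f is c t² plus terms of order at least 3.
  have hk20 : k₂ 0 = c := by
    obtain ⟨G, hG, hFG⟩ := hF.exists_curve (fun _ => one_ne_zero) (Pi.single i 1)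
    have h1 : ∀ᶠ t in 𝓝[≠] (0 : ℂ), k₂ (Pi.single i t) = c + t * G t := by
      filter_upwards [(hline0.eventually hk2).filter_mono nhdsWithin_le_nhds,
        hFG.filter_mono nhdsWithin_le_nhds, self_mem_nhdsWithin] with t h1 h2 h3
      have e1 : (fun j => t ^ 1 * (Pi.single i 1 : Fin N → ℂ) j) = Pi.single i t := by
        funext j
        by_cases hj : j = i
        · subst hj
          simp
        · simp [hj]
      rw [e1] at h2
      have e2 : s (Pi.single i t) = 0 := by
        rw [← hs0, ← hsi 0 t]
        rfl
      have e3 : A (Pi.single i t) = 0 := by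
        rw [← hA0, ← hAi 0 t]
        rfl
      have e4 : S (Pi.single i t) = Pi.single i t := by
        simp only [hS, e2, add_zero]
        exact Function.update_eq_self _ _
      have e5 : Function.update (Pi.single i t : Fin N → ℂ) i 0 = 0 := by
        funext j
        by_cases hj : j = i
        · subst hj
          simp
        · simp [hj]
      simp only [hk, e4, e2, e5] at h1
      rw [hf, hf, e3, h2, hA0, hF.at_zero (by norm_num)] at h1
      have h3' : t ≠ 0 := h3
      have h4 : t ^ 2 * (k₂ (Pi.single i t)) = t ^ 2 * (c + t * G t) := by
        simp at h1
        linear_combination -h1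
      exact mul_left_cancel₀ (pow_ne_zero 2 h3') h4
    have h2 : Filter.Tendsto (fun t => k₂ (Pi.single i t)) (𝓝[≠] (0 : ℂ)) (𝓝 (k₂ 0)) :=
      (hk₂.continuousAt.tendsto.comp hline0).mono_left nhdsWithin_le_nhds
    have h3 : Filter.Tendsto (fun t => c + t * G t) (𝓝[≠] (0 : ℂ)) (𝓝 c) := by
      have : ContinuousAt (fun t => c + t * G t) 0 :=
        continuousAt_const.add (continuousAt_id.mul hG)
      simpa using this.tendsto.mono_left nhdsWithin_le_nhds
    exact tendsto_nhds_unique (h2.congr' h1) h3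
  set T : (Fin N → ℂ) → Fin N → ℂ := fun x => Function.update x i (x i - s x) with hT
  have hTa : AnalyticAt ℂ T 0 :=
    analyticAt_update analyticAt_id ((analyticAt_coord i 0).fun_sub hsa) i
  have hT0 : T 0 = 0 := by simp [hT, hs0]
  have hV : AnalyticAt ℂ (fun x => c⁻¹ * k₂ (T x)) 0 :=
    analyticAt_const.fun_mul (AnalyticAt.fun_comp (by rwa [hT0]) hTa)
  obtain ⟨W, hW, hW0, hWV⟩ := exists_sqrt hV (by rw [hT0, hk20]; field_simp)
  refine ⟨s, W, hsw, hsi, hW, hW0, ?_⟩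
  filter_upwards [hWV, (tendsto_of_analyticAt hTa hT0).eventually hk2] with x h1 h2
  have e1 : S (T x) = x := by
    simp [hS, hT, hsi]
  have e2 : Function.update (T x) i (s (T x)) = Function.update x i (s x) := by
    simp [hT, hsi]
  have e3 : T x i = x i - s x := by simp [hT]
  simp only [hk, e1, e2, e3] at h2
  rw [mul_pow, h1]
  rw [sub_eq_iff_eq_add.1 h2]
  field_simp

/-! ### Splittings of functions and of power series -/

theorem exists_inVars_series {N : ℕ} (S : Finset (Fin N)) {f : (Fin N → ℂ) → ℂ}
    (hf : AnalyticAt ℂ f 0) (hS : ∀ᶠ x in 𝓝 0, f (restrictPt S x) = f x) :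
    ∃ p : MvPowerSeries (Fin N) ℂ, IsConvergent p ∧ InVars S p ∧ f =ᶠ[𝓝 0] seriesSum p := by
  obtain ⟨p, hp, hfp⟩ := exists_seriesSum_eq hf
  refine ⟨restrictVars S p, hp.restrictVars S, inVars_restrictVars S p, ?_⟩
  have hcont : Filter.Tendsto (restrictPt S) (𝓝 (0 : Fin N → ℂ)) (𝓝 0) := by
    refine tendsto_pi_nhds.2 fun j => ?_
    by_cases hj : j ∈ S
    · simpa [restrictPt, hj] using (continuous_apply j).tendsto (0 : Fin N → ℂ)
    · simp [restrictPt, hj]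
  filter_upwards [hS, hcont.eventually hfp] with x h1 h2
  rw [seriesSum_restrictVars, ← h2, h1]

theorem seriesSum_pow_two {N : ℕ} {p : MvPowerSeries (Fin N) ℂ} (hp : IsConvergent p) :
    ∀ᶠ x in 𝓝 0, seriesSum (p ^ 2) x = seriesSum p x ^ 2 := by
  rw [pow_two]
  filter_upwards [seriesSum_mul hp hp] with x hx
  rw [hx, pow_two]

theorem IsConvergent.pow_two {N : ℕ} {p : MvPowerSeries (Fin N) ℂ} (hp : IsConvergent p) :
    IsConvergent (p ^ 2) := by
  rw [_root_.pow_two]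
  exact hp.mul hp

theorem isConvergent_X {N : ℕ} (i : Fin N) :
    IsConvergent (MvPowerSeries.X i : MvPowerSeries (Fin N) ℂ) := by
  simpa using isConvergent_coe (MvPolynomial.X i : MvPolynomial (Fin N) ℂ)

theorem seriesSum_X {N : ℕ} (i : Fin N) (x : Fin N → ℂ) :
    seriesSum (MvPowerSeries.X i : MvPowerSeries (Fin N) ℂ) x = x i := by
  simpa using seriesSum_coe (MvPolynomial.X i : MvPolynomial (Fin N) ℂ) x

theorem splitting_isConvergent {q w p v h : MvPowerSeries (Fin 4) ℂ} (hq : IsConvergent q)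
    (hw : IsConvergent w) (hp : IsConvergent p) (hv : IsConvergent v) (hh : IsConvergent h) :
    IsConvergent (-((MvPowerSeries.X 0 + q) * w) ^ 2 + ((MvPowerSeries.X 1 + p) * v) ^ 2 + h) ∧
    ∀ᶠ x in 𝓝 0, seriesSum
      (-((MvPowerSeries.X 0 + q) * w) ^ 2 + ((MvPowerSeries.X 1 + p) * v) ^ 2 + h) x =
      -((x 0 + seriesSum q x) * seriesSum w x) ^ 2 + ((x 1 + seriesSum p x) * seriesSum v x) ^ 2 +
        seriesSum h x := by
  have a1 := (isConvergent_X 0).add hq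
  have a2 := (isConvergent_X 1).add hp
  have b1 := a1.mul hw
  have b2 := a2.mul hv
  have c1 := b1.pow_two.neg.add b2.pow_two
  refine ⟨c1.add hh, ?_⟩
  filter_upwards [seriesSum_add c1 hh, seriesSum_add b1.pow_two.neg b2.pow_two,
    seriesSum_pow_two b1, seriesSum_pow_two b2, seriesSum_mul a1 hw, seriesSum_mul a2 hv,
    seriesSum_add (isConvergent_X 0) hq, seriesSum_add (isConvergent_X 1) hp]
    with x h1 h2 h3 h4 h5 h6 h7 h8
  rw [h1, h2, seriesSum_neg, h3, h4, h5, h6, h7, h8, seriesSum_X, seriesSum_X]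

theorem IsSplitting.eventually_eq {f : MvPolynomial (Fin 4) ℂ} {q w p v h : MvPowerSeries (Fin 4) ℂ}
    (hs : IsSplitting f q w p v h) :
    ∀ᶠ x in 𝓝 0, polyFun f x = -((x 0 + seriesSum q x) * seriesSum w x) ^ 2 +
      ((x 1 + seriesSum p x) * seriesSum v x) ^ 2 + seriesSum h x := by
  filter_upwards [(splitting_isConvergent hs.conv_q hs.conv_w hs.conv_p hs.conv_v hs.conv_h).2]
    with x hx
  rw [← hx, ← hs.eq, seriesSum_coe]
  rfl

/-- The analytic counterpart of `IsSplitting`. -/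
structure FunSplitting (f q w p v h : (Fin 4 → ℂ) → ℂ) : Prop where
  eq : ∀ᶠ x in 𝓝 0, f x = -((x 0 + q x) * w x) ^ 2 + ((x 1 + p x) * v x) ^ 2 + h x
  wge_q : WGE (fun _ => 1) 2 q
  wge_p : WGE (fun _ => 1) 2 p
  wge_h : WGE (fun _ => 1) 3 h
  an_w : AnalyticAt ℂ w 0
  an_v : AnalyticAt ℂ v 0
  w_zero : w 0 = 1
  v_zero : v 0 = 1
  res_q : ∀ᶠ x in 𝓝 0, q (restrictPt {1, 2, 3} x) = q x
  res_v : ∀ᶠ x in 𝓝 0, v (restrictPt {1, 2, 3} x) = v x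
  res_p : ∀ᶠ x in 𝓝 0, p (restrictPt {2, 3} x) = p x
  res_h : ∀ᶠ x in 𝓝 0, h (restrictPt {2, 3} x) = h x

theorem FunSplitting.exists_isSplitting {f : MvPolynomial (Fin 4) ℂ}
    {q w p v h : (Fin 4 → ℂ) → ℂ} (hs : FunSplitting (polyFun f) q w p v h) :
    ∃ q' w' p' v' h' : MvPowerSeries (Fin 4) ℂ, IsSplitting f q' w' p' v' h' ∧
      h =ᶠ[𝓝 0] seriesSum h' := by
  obtain ⟨q', cq, vq, eq⟩ := exists_inVars_series _ hs.wge_q.analyticAt hs.res_q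
  obtain ⟨p', cp, vp, ep⟩ := exists_inVars_series _ hs.wge_p.analyticAt hs.res_p
  obtain ⟨h', ch, vh, eh⟩ := exists_inVars_series _ hs.wge_h.analyticAt hs.res_h
  obtain ⟨v', cv, vv, ev⟩ := exists_inVars_series _ hs.an_v hs.res_v
  obtain ⟨w', cw, ew⟩ := exists_seriesSum_eq hs.an_w
  have hsc := splitting_isConvergent cq cw cp cv ch
  refine ⟨q', w', p', v', h', ⟨?_, cq, cw, cp, cv, ch, vq, vp, vv, vh, ?_, ?_, ?_, ?_, ?_⟩, eh⟩
  · refine seriesSum_injective (isConvergent_coe f) hsc.1 ?_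
    filter_upwards [hs.eq, eq, ep, eh, ev, ew, hsc.2] with x h1 h2 h3 h4 h5 h6 h7
    rw [h7, ← h2, ← h3, ← h4, ← h5, ← h6, ← h1, seriesSum_coe]
    rfl
  · exact (hs.wge_q.congr eq.symm).le_weightedOrder (fun _ => one_ne_zero) cq
  · exact (hs.wge_p.congr ep.symm).le_weightedOrder (fun _ => one_ne_zero) cp
  · exact (hs.wge_h.congr eh.symm).le_weightedOrder (fun _ => one_ne_zero) ch
  · rw [← seriesSum_at_zero, ← ew.self_of_nhds, hs.w_zero]
  · rw [← seriesSum_at_zero, ← ev.self_of_nhds, hs.v_zero]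

theorem IsSplitting.funSplitting {f : MvPolynomial (Fin 4) ℂ} {q w p v h : MvPowerSeries (Fin 4) ℂ}
    (hs : IsSplitting f q w p v h) :
    FunSplitting (polyFun f) (seriesSum q) (seriesSum w) (seriesSum p) (seriesSum v)
      (seriesSum h) where
  eq := hs.eventually_eq
  wge_q := hs.conv_q.wge hs.order_q
  wge_p := hs.conv_p.wge hs.order_p
  wge_h := hs.conv_h.wge hs.order_h
  an_w := hs.conv_w.analyticAt
  an_v := hs.conv_v.analyticAt
  w_zero := by rw [seriesSum_at_zero, hs.const_w]
  v_zero := by rw [seriesSum_at_zero, hs.const_v]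
  res_q := Filter.Eventually.of_forall hs.vars_q.seriesSum_restrictPt
  res_v := Filter.Eventually.of_forall hs.vars_v.seriesSum_restrictPt
  res_p := Filter.Eventually.of_forall hs.vars_p.seriesSum_restrictPt
  res_h := Filter.Eventually.of_forall hs.vars_h.seriesSum_restrictPt

theorem polyFun_hyp (F : MvPolynomial (Fin 4) ℂ) (x : Fin 4 → ℂ) :
    polyFun (hyp F) x = -x 0 ^ 2 + x 1 ^ 2 + polyFun F x := by
  simp [polyFun, hyp]

theorem wge_polyFun {N : ℕ} {w : Fin N → ℕ} {F : MvPolynomial (Fin N) ℂ} {k : ℕ}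
    (hF : (k : ℕ∞) ≤ (F : MvPowerSeries (Fin N) ℂ).weightedOrder w) : WGE w k (polyFun F) :=
  ((isConvergent_coe F).wge hF).congr
    (Filter.Eventually.of_forall fun x => (seriesSum_coe F x).symm)

theorem analyticAt_polyFun {N : ℕ} (F : MvPolynomial (Fin N) ℂ) : AnalyticAt ℂ (polyFun F) 0 :=
  (wge_polyFun (w := fun _ => 1) (k := 0) (by simp)).analyticAt

theorem wge_update {N : ℕ} {k : ℕ} {F s : (Fin N → ℂ) → ℂ} (hF : WGE (fun _ => 1) k F)
    (hs : WGE (fun _ => 1) 2 s) (i : Fin N) :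
    WGE (fun _ => 1) k fun x => F (Function.update x i (s x)) := by
  have h0 : Function.update (0 : Fin N → ℂ) i (s 0) = 0 := by simp [hs.at_zero one_le_two]
  have ha : AnalyticAt ℂ (fun x => Function.update x i (s x)) 0 :=
    analyticAt_update analyticAt_id hs.analyticAt i
  exact hF.comp (φ := fun x => Function.update x i (s x)) (w := fun _ => 1) h0 fun j =>
    exists_order_le (analyticAt_pi_iff.1 ha j) (congrFun h0 j)

/-- The variable x₁ is split off first, then x₂ from the remaining function f₂. The data r and Y of
the second splitting might still depend on x₁, although f₂ does not; replacing them by their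
restrictions to x₁ = 0 keeps the identity. -/
theorem exists_funSplitting {F : MvPolynomial (Fin 4) ℂ}
    (hF : 3 ≤ (F : MvPowerSeries (Fin 4) ℂ).order) :
    ∃ q w p v h, FunSplitting (polyFun (hyp F)) q w p v h := by
  have hFw : WGE (fun _ => 1) 3 (polyFun F) := wge_polyFun hF
  obtain ⟨s, W, hs, hsi, hW, hW0, h1⟩ := exists_split_var (0 : Fin 4) (c := -1) (by norm_num)
    (f := polyFun (hyp F)) (A := fun x => x 1 ^ 2) (F := polyFun F)
    (fun x => by rw [polyFun_hyp]; ring) ((analyticAt_coord 1 0).fun_pow 2)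
    (fun x t => by simp) (by simp) hFw
  set F₂ : (Fin 4 → ℂ) → ℂ := fun x => -s x ^ 2 + polyFun F (Function.update x 0 (s x)) with hF₂
  have hF₂w : WGE (fun _ => 1) 3 F₂ :=
    ((hs.pow 2).neg.le (by norm_num)).add (wge_update hFw hs 0)
  set f₂ : (Fin 4 → ℂ) → ℂ := fun x => polyFun (hyp F) (Function.update x 0 (s x)) with hf₂
  have hf₂e : ∀ x, f₂ x = 1 * x 1 ^ 2 + 0 + F₂ x := by
    intro x
    simp only [hf₂, polyFun_hyp, hF₂]
    simp
    ring
  have hf₂i : ∀ x t, f₂ (Function.update x 0 t) = f₂ x := by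
    intro x t
    simp [hf₂, hsi]
  obtain ⟨r, Y, hr, hri, hY, hY0, h2⟩ := exists_split_var (1 : Fin 4) (c := 1) one_ne_zero
    (f := f₂) (A := fun _ => 0) (F := F₂) hf₂e analyticAt_const (fun _ _ => rfl) rfl hF₂w
  have hρ : AnalyticAt ℂ (fun x : Fin 4 → ℂ => Function.update x 0 (0 : ℂ)) 0 :=
    analyticAt_update analyticAt_id analyticAt_const 0
  have hρ0 : Function.update (0 : Fin 4 → ℂ) 0 0 = 0 := by simp
  have hr' : WGE (fun _ => 1) 2 fun x => r (Function.update x 0 0) := wge_update hr WGE.zero 0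
  have hrest : ∀ x : Fin 4 → ℂ, restrictPt {1, 2, 3} x = Function.update x 0 0 := by
    intro x
    rw [← restrictPt_erase]
    rfl
  have hrest2 : ∀ x : Fin 4 → ℂ, restrictPt {2, 3} x =
      Function.update (Function.update x 0 0) 1 0 := by
    intro x
    funext j
    fin_cases j <;> simp [restrictPt]
  have hcomm : ∀ (x : Fin 4 → ℂ) (a b : ℂ), Function.update (Function.update x 1 a) 0 b =
      Function.update (Function.update x 0 b) 1 a := fun x a b =>
    Function.update_comm (by decide) _ _ _
  have hridem : ∀ x : Fin 4 → ℂ, r (Function.update (Function.update (Function.update x 0 0) 1 0)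
      0 0) = r (Function.update x 0 0) := by
    intro x
    rw [hcomm, Function.update_idem, hri]
  refine ⟨fun x => -s x, W, fun x => -r (Function.update x 0 0), fun x => Y (Function.update x 0 0),
    fun x => f₂ (Function.update x 1 (r (Function.update x 0 0))), ?_, hs.neg, hr'.neg, ?_, hW,
    AnalyticAt.fun_comp (by rwa [hρ0]) hρ, hW0, ?_, ?_, ?_, ?_, ?_⟩
  · filter_upwards [h1, (tendsto_of_analyticAt hρ hρ0).eventually h2] with x k1 k2
    rw [hf₂i, ← hcomm, hf₂i] at k2
    rw [k1]
    change _ + f₂ x = _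
    rw [k2]
    simp
    ring
  · have k2 : WGE (fun _ => 1) 4 fun x => r (Function.update x 0 0) ^ 2 := hr'.pow 2
    refine ((k2.le (l := 3) (by norm_num)).add (wge_update hF₂w hr' 1)).congr
      (Filter.Eventually.of_forall fun x => ?_)
    simp only [hf₂e]
    simp
  · change Y (Function.update 0 0 0) = 1
    rw [hρ0, hY0]
  · refine Filter.Eventually.of_forall fun x => ?_
    simp only [hrest, hsi]
  · refine Filter.Eventually.of_forall fun x => ?_
    simp only [hrest, Function.update_idem]
  · refine Filter.Eventually.of_forall fun x => ?_
    simp only [hrest2, hridem]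
  · refine Filter.Eventually.of_forall fun x => ?_
    simp only [hrest2, hridem, Function.update_idem]
    rw [← hcomm, hf₂i]

end Kawakita
end

noncomputable section
namespace Kawakita

/-! ## Coordinate changes of the last two variables -/

/-- The polynomial map given by an automorphism of the polynomial ring. -/
def ptMap (σ : MvPolynomial (Fin 2) ℂ ≃ₐ[ℂ] MvPolynomial (Fin 2) ℂ) (y : Fin 2 → ℂ) : Fin 2 → ℂ :=
  fun i => MvPolynomial.eval y (σ (MvPolynomial.X i))

theorem eval_ptMap (σ : MvPolynomial (Fin 2) ℂ ≃ₐ[ℂ] MvPolynomial (Fin 2) ℂ) (y : Fin 2 → ℂ)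
    (P : MvPolynomial (Fin 2) ℂ) :
    MvPolynomial.eval y (σ P) = MvPolynomial.eval (ptMap σ y) P := by
  have : (MvPolynomial.aeval y).comp (σ : MvPolynomial (Fin 2) ℂ →ₐ[ℂ] MvPolynomial (Fin 2) ℂ) =
      MvPolynomial.aeval (ptMap σ y) := by
    refine MvPolynomial.algHom_ext fun i => ?_
    simp [ptMap, MvPolynomial.aeval_eq_eval]
  simpa [MvPolynomial.aeval_eq_eval] using congrArg (fun φ => φ P) this

theorem ptMap_trans (σ τ : MvPolynomial (Fin 2) ℂ ≃ₐ[ℂ] MvPolynomial (Fin 2) ℂ)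
    (y : Fin 2 → ℂ) : ptMap (σ.trans τ) y = ptMap σ (ptMap τ y) := by
  funext i
  change MvPolynomial.eval y (τ (σ (MvPolynomial.X i))) = _
  rw [eval_ptMap]
  rfl

theorem ptMap_refl (y : Fin 2 → ℂ) : ptMap AlgEquiv.refl y = y := by
  funext i
  simp [ptMap]

theorem ptMap_symm_ptMap (σ : MvPolynomial (Fin 2) ℂ ≃ₐ[ℂ] MvPolynomial (Fin 2) ℂ)
    (y : Fin 2 → ℂ) : ptMap σ.symm (ptMap σ y) = y := by
  rw [← ptMap_trans, AlgEquiv.symm_trans_self, ptMap_refl]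

theorem ptMap_ptMap_symm (σ : MvPolynomial (Fin 2) ℂ ≃ₐ[ℂ] MvPolynomial (Fin 2) ℂ)
    (y : Fin 2 → ℂ) : ptMap σ (ptMap σ.symm y) = y := by
  rw [← ptMap_trans, AlgEquiv.self_trans_symm, ptMap_refl]

theorem ptMap_zero_iff {σ : MvPolynomial (Fin 2) ℂ ≃ₐ[ℂ] MvPolynomial (Fin 2) ℂ} :
    ptMap σ 0 = 0 ↔ ∀ i, MvPolynomial.constantCoeff (σ (MvPolynomial.X i)) = 0 := by
  rw [funext_iff]
  simp [ptMap, MvPolynomial.constantCoeff_eq]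

theorem analyticAt_ptMap (σ : MvPolynomial (Fin 2) ℂ ≃ₐ[ℂ] MvPolynomial (Fin 2) ℂ) :
    AnalyticAt ℂ (ptMap σ) 0 :=
  analyticAt_pi_iff.2 fun i => analyticAt_polyFun (σ (MvPolynomial.X i))

theorem isGermIso_ptMap {σ : MvPolynomial (Fin 2) ℂ ≃ₐ[ℂ] MvPolynomial (Fin 2) ℂ}
    (h : ptMap σ 0 = 0) : IsGermIso (ptMap σ) (ptMap σ.symm) where
  analytic := analyticAt_ptMap σ
  analytic_inv := analyticAt_ptMap σ.symm
  map_zero := h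
  inv_zero := by
    nth_rewrite 1 [← h]
    exact ptMap_symm_ptMap σ 0
  right_inv := Filter.Eventually.of_forall (ptMap_ptMap_symm σ)
  left_inv := Filter.Eventually.of_forall (ptMap_symm_ptMap σ)

/-- The map of `ℂ⁴` acting as `φ` on the last two coordinates. -/
def prolong (φ : (Fin 2 → ℂ) → Fin 2 → ℂ) (x : Fin 4 → ℂ) : Fin 4 → ℂ :=
  ![x 0, x 1, φ ![x 2, x 3] 0, φ ![x 2, x 3] 1]

theorem prolong_zero {φ : (Fin 2 → ℂ) → Fin 2 → ℂ} (h : φ 0 = 0) : prolong φ 0 = 0 := by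
  have h0 : (![(0 : Fin 4 → ℂ) 2, (0 : Fin 4 → ℂ) 3] : Fin 2 → ℂ) = 0 := vec_pair_zero
  funext i
  unfold prolong
  rw [h0, h]
  fin_cases i <;> rfl

theorem analyticAt_prolong {φ : (Fin 2 → ℂ) → Fin 2 → ℂ} (h : AnalyticAt ℂ φ 0) :
    AnalyticAt ℂ (prolong φ) 0 := by
  refine analyticAt_pi_iff.2 fun i => ?_
  fin_cases i
  · exact analyticAt_coord 0 0
  · exact analyticAt_coord 1 0
  · exact analyticAt_pair (analyticAt_pi_iff.1 h 0) (analyticAt_coord 2 0) (analyticAt_coord 3 0)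
      rfl rfl
  · exact analyticAt_pair (analyticAt_pi_iff.1 h 1) (analyticAt_coord 2 0) (analyticAt_coord 3 0)
      rfl rfl

theorem prolong_prolong {φ ψ : (Fin 2 → ℂ) → Fin 2 → ℂ} {x : Fin 4 → ℂ}
    (h : φ (ψ ![x 2, x 3]) = ![x 2, x 3]) : prolong φ (prolong ψ x) = x := by
  have h1 : (![prolong ψ x 2, prolong ψ x 3] : Fin 2 → ℂ) = ψ ![x 2, x 3] :=
    vec_pair_eta (ψ ![x 2, x 3])
  funext i
  rw [prolong, h1, h]
  fin_cases i <;> rfl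

theorem tendsto_pair : Filter.Tendsto (fun x : Fin 4 → ℂ => (![x 2, x 3] : Fin 2 → ℂ))
    (𝓝 0) (𝓝 0) := by
  refine tendsto_of_analyticAt (φ := fun x : Fin 4 → ℂ => (![x 2, x 3] : Fin 2 → ℂ)) ?_
    vec_pair_zero
  refine analyticAt_pi_iff.2 fun i => ?_
  fin_cases i
  · exact analyticAt_coord 2 0
  · exact analyticAt_coord 3 0

theorem IsGermIso.prolong {φ ψ : (Fin 2 → ℂ) → Fin 2 → ℂ} (h : IsGermIso φ ψ) :
    IsGermIso (prolong φ) (prolong ψ) where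
  analytic := analyticAt_prolong h.analytic
  analytic_inv := analyticAt_prolong h.analytic_inv
  map_zero := prolong_zero h.map_zero
  inv_zero := prolong_zero h.inv_zero
  right_inv := by
    filter_upwards [tendsto_pair.eventually h.right_inv] with x hx
    exact prolong_prolong hx
  left_inv := by
    filter_upwards [tendsto_pair.eventually h.left_inv] with x hx
    exact prolong_prolong hx

theorem model_prolong (H : (Fin 2 → ℂ) → ℂ) (φ : (Fin 2 → ℂ) → Fin 2 → ℂ) (x : Fin 4 → ℂ) :
    model H (prolong φ x) = model (fun s => H (φ s)) x := by
  have h1 : (![Kawakita.prolong φ x 2, Kawakita.prolong φ x 3] : Fin 2 → ℂ) = φ ![x 2, x 3] :=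
    vec_pair_eta (φ ![x 2, x 3])
  rw [model, model, h1]
  rfl

theorem polyFun_changeCoords (σ : MvPolynomial (Fin 2) ℂ ≃ₐ[ℂ] MvPolynomial (Fin 2) ℂ)
    (F : MvPolynomial (Fin 4) ℂ) (x : Fin 4 → ℂ) :
    polyFun (changeCoords σ F) x = polyFun F (prolong (ptMap σ) x) := by
  have hx : (x ∘ ![2, 3] : Fin 2 → ℂ) = ![x 2, x 3] := by
    funext i
    fin_cases i <;> rfl
  have : (MvPolynomial.aeval x).comp (MvPolynomial.aeval ![MvPolynomial.X 0, MvPolynomial.X 1,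
      MvPolynomial.rename ![2, 3] (σ (MvPolynomial.X 0)),
      MvPolynomial.rename ![2, 3] (σ (MvPolynomial.X 1))]) =
      (MvPolynomial.aeval (prolong (ptMap σ) x) : MvPolynomial (Fin 4) ℂ →ₐ[ℂ] ℂ) := by
    refine MvPolynomial.algHom_ext fun i => ?_
    fin_cases i <;> simp [prolong, ptMap, MvPolynomial.aeval_eq_eval, MvPolynomial.eval_rename, hx]
  have h := congrArg (fun φ => φ F) this
  simp only [AlgHom.comp_apply, MvPolynomial.aeval_eq_eval] at h
  exact h

theorem polyFun_hyp_changeCoords (σ : MvPolynomial (Fin 2) ℂ ≃ₐ[ℂ] MvPolynomial (Fin 2) ℂ)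
    (F : MvPolynomial (Fin 4) ℂ) (x : Fin 4 → ℂ) :
    polyFun (hyp (changeCoords σ F)) x = polyFun (hyp F) (prolong (ptMap σ) x) := by
  rw [polyFun_hyp, polyFun_hyp, polyFun_changeCoords]
  rfl

theorem contactEquivalent_changeCoords
    {σ : MvPolynomial (Fin 2) ℂ ≃ₐ[ℂ] MvPolynomial (Fin 2) ℂ} (hσ : ptMap σ 0 = 0)
    (F : MvPolynomial (Fin 4) ℂ) :
    ContactEquivalent (polyFun (hyp F)) (polyFun (hyp (changeCoords σ F))) :=
  (isGermIso_ptMap hσ).prolong.contactEquivalent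
    (Filter.Eventually.of_forall (polyFun_hyp_changeCoords σ F))

/-- The map σ mixes only x₃ and x₄, and each set of admissible variables in a splitting contains
both, so every condition is preserved. -/
theorem FunSplitting.changeCoords {F : MvPolynomial (Fin 4) ℂ} {q w p v h : (Fin 4 → ℂ) → ℂ}
    (hs : FunSplitting (polyFun (hyp F)) q w p v h)
    {σ : MvPolynomial (Fin 2) ℂ ≃ₐ[ℂ] MvPolynomial (Fin 2) ℂ} (hσ : ptMap σ 0 = 0) :
    FunSplitting (polyFun (hyp (changeCoords σ F))) (fun x => q (prolong (ptMap σ) x))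
      (fun x => w (prolong (ptMap σ) x)) (fun x => p (prolong (ptMap σ) x))
      (fun x => v (prolong (ptMap σ) x)) (fun x => h (prolong (ptMap σ) x)) := by
  have hP := (isGermIso_ptMap hσ).prolong
  have hwge : ∀ {k : ℕ} {f : (Fin 4 → ℂ) → ℂ}, WGE (fun _ => 1) k f →
      WGE (fun _ => 1) k fun x => f (prolong (ptMap σ) x) := fun {k f} hf =>
    hf.comp (w := fun _ => 1) (φ := prolong (ptMap σ)) hP.map_zero fun i =>
      exists_order_le (analyticAt_pi_iff.1 hP.analytic i) (congrFun hP.map_zero i)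
  have han : ∀ {f : (Fin 4 → ℂ) → ℂ}, AnalyticAt ℂ f 0 →
      AnalyticAt ℂ (fun x => f (prolong (ptMap σ) x)) 0 := fun {f} hf =>
    AnalyticAt.fun_comp (by rwa [hP.map_zero]) hP.analytic
  have hres : ∀ (S : Finset (Fin 4)) (x : Fin 4 → ℂ), 2 ∈ S → 3 ∈ S →
      prolong (ptMap σ) (restrictPt S x) = restrictPt S (prolong (ptMap σ) x) := by
    intro S x h2 h3
    have e : (![restrictPt S x 2, restrictPt S x 3] : Fin 2 → ℂ) = ![x 2, x 3] := by
      simp [restrictPt, h2, h3]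
    funext i
    rw [prolong, e]
    fin_cases i <;> simp [restrictPt, prolong, h2, h3]
  refine ⟨?_, hwge hs.wge_q, hwge hs.wge_p, hwge hs.wge_h, han hs.an_w, han hs.an_v, ?_, ?_,
    ?_, ?_, ?_, ?_⟩
  · filter_upwards [hP.tendsto.eventually hs.eq] with x hx
    rw [polyFun_hyp_changeCoords, hx]
    rfl
  · simp only [hP.map_zero, hs.w_zero]
  · simp only [hP.map_zero, hs.v_zero]
  · filter_upwards [hP.tendsto.eventually hs.res_q] with x hx
    rw [hres _ _ (by decide) (by decide), hx]
  · filter_upwards [hP.tendsto.eventually hs.res_v] with x hx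
    rw [hres _ _ (by decide) (by decide), hx]
  · filter_upwards [hP.tendsto.eventually hs.res_p] with x hx
    rw [hres _ _ (by decide) (by decide), hx]
  · filter_upwards [hP.tendsto.eventually hs.res_h] with x hx
    rw [hres _ _ (by decide) (by decide), hx]

/-! ## The model of a splitting -/

/-- The coordinates `(A + B, B - A, x₃, x₄)` with `A = (x₁ + q) w` and `B = (x₂ + p) v`. -/
def splitCoords (q w p v : (Fin 4 → ℂ) → ℂ) (x : Fin 4 → ℂ) : Fin 4 → ℂ :=
  ![(x 0 + q x) * w x + (x 1 + p x) * v x, (x 1 + p x) * v x - (x 0 + q x) * w x, x 2, x 3]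

theorem wge_two_of_unit {i : Fin 4} {q w : (Fin 4 → ℂ) → ℂ} (hq : WGE (fun _ => 1) 2 q)
    (hw : AnalyticAt ℂ w 0) (hw1 : w 0 = 1) :
    WGE (fun _ => 1) 2 fun x => (x i + q x) * w x - x i := by
  have h1 : WGE (fun _ => 1) 1 fun x => w x - 1 :=
    exists_order_le (hw.fun_sub analyticAt_const) (by rw [hw1, sub_self])
  refine (((WGE.coord (w := fun _ => 1) i).mul h1).add (hq.mul_right hw)).congr
    (Filter.Eventually.of_forall fun x => ?_)
  ring

/-- The linear part is (x₁ + x₂, x₂ - x₁, x₃, x₄), which is invertible; q and p have multiplicity at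
least 2, and w and v take the value 1 at the origin. -/
theorem FunSplitting.exists_isGermIso {f q w p v h : (Fin 4 → ℂ) → ℂ}
    (hs : FunSplitting f q w p v h) : ∃ χ, IsGermIso (splitCoords q w p v) χ := by
  have hA := wge_two_of_unit (i := 0) hs.wge_q hs.an_w hs.w_zero
  have hB := wge_two_of_unit (i := 1) hs.wge_p hs.an_v hs.v_zero
  have hlin : ∀ i : Fin 4, AnalyticAt ℂ (fun x => splitCoords q w p v x i) 0 ∧
      splitCoords q w p v 0 i = 0 ∧ ∀ u, fderiv ℂ (fun x => splitCoords q w p v x i) 0 u =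
        (![u 0 + u 1, u 1 - u 0, u 2, u 3] : Fin 4 → ℂ) i := by
    have key : ∀ (ℓ : (Fin 4 → ℂ) →L[ℂ] ℂ) (g : (Fin 4 → ℂ) → ℂ),
        WGE (fun _ => 1) 2 (fun x => g x - ℓ x) →
        AnalyticAt ℂ g 0 ∧ g 0 = 0 ∧ ∀ u, fderiv ℂ g 0 u = ℓ u := by
      intro ℓ g hg
      have e : g = fun x => (g x - ℓ x) + ℓ x := by
        funext x
        ring
      have h0 := hg.at_zero one_le_two
      simp only [_root_.map_zero, sub_zero] at h0
      refine ⟨?_, h0, fun u => ?_⟩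
      · rw [e]
        exact hg.analyticAt.fun_add (ℓ.analyticAt 0)
      · rw [e, fderiv_fun_add hg.analyticAt.differentiableAt ℓ.differentiableAt,
          hg.fderiv_eq_zero, ℓ.fderiv, zero_add]
    let pr : Fin 4 → (Fin 4 → ℂ) →L[ℂ] ℂ := fun i =>
      ContinuousLinearMap.proj (R := ℂ) (φ := fun _ : Fin 4 => ℂ) i
    intro i
    fin_cases i
    · refine key (pr 0 + pr 1) _ ((hA.add hB).congr (Filter.Eventually.of_forall fun x => ?_))
      simp [splitCoords, pr]
      ring
    · refine key (pr 1 - pr 0) _ ((hB.sub hA).congr (Filter.Eventually.of_forall fun x => ?_))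
      simp [splitCoords, pr]
      ring
    · refine key (pr 2) _ (WGE.zero.congr (Filter.Eventually.of_forall fun x => ?_))
      simp [splitCoords, pr]
    · refine key (pr 3) _ (WGE.zero.congr (Filter.Eventually.of_forall fun x => ?_))
      simp [splitCoords, pr]
  have ha : AnalyticAt ℂ (splitCoords q w p v) 0 := analyticAt_pi_iff.2 fun i => (hlin i).1
  refine Kawakita.exists_isGermIso ha (funext fun i => (hlin i).2.1) fun u hu => ?_
  have h1 : ∀ i, (![u 0 + u 1, u 1 - u 0, u 2, u 3] : Fin 4 → ℂ) i = 0 := fun i => by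
    rw [← (hlin i).2.2, ← fderiv_pi_apply ha, hu]
    rfl
  have e0 : u 0 + u 1 = 0 := h1 0
  have e1 : u 1 - u 0 = 0 := h1 1
  have e2 : u 2 = 0 := h1 2
  have e3 : u 3 = 0 := h1 3
  funext i
  fin_cases i
  · change u 0 = 0
    linear_combination (e0 - e1) / 2
  · change u 1 = 0
    linear_combination (e0 + e1) / 2
  · exact e2
  · exact e3

theorem slice_pair (x : Fin 4 → ℂ) : slice ![x 2, x 3] = restrictPt {2, 3} x := by
  rw [slice_apply]
  funext i
  fin_cases i <;> simp [restrictPt]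

theorem slice_zero : slice 0 = 0 := _root_.map_zero slice

theorem tendsto_slice : Filter.Tendsto slice (𝓝 0) (𝓝 0) :=
  tendsto_of_analyticAt (slice.analyticAt 0) slice_zero

theorem FunSplitting.eventually_model {f q w p v h : (Fin 4 → ℂ) → ℂ}
    (hs : FunSplitting f q w p v h) :
    ∀ᶠ x in 𝓝 0, f x = model (fun s => h (slice s)) (splitCoords q w p v x) := by
  filter_upwards [hs.eq, hs.res_h] with x h1 h2
  rw [h1, model]
  have e : (![splitCoords q w p v x 2, splitCoords q w p v x 3] : Fin 2 → ℂ) = ![x 2, x 3] := rfl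
  rw [e, slice_pair, h2]
  change _ = ((x 0 + q x) * w x + (x 1 + p x) * v x) * ((x 1 + p x) * v x - (x 0 + q x) * w x) + _
  ring

theorem FunSplitting.contactEquivalent {f q w p v h : (Fin 4 → ℂ) → ℂ}
    (hs : FunSplitting f q w p v h) : ContactEquivalent (model fun s => h (slice s)) f := by
  obtain ⟨χ, hχ⟩ := hs.exists_isGermIso
  exact hχ.contactEquivalent hs.eventually_model

theorem contactEquivalent_squares (g : (Fin 2 → ℂ) → ℂ) :
    ContactEquivalent (fun x : Fin 4 → ℂ => x 0 ^ 2 + x 1 ^ 2 + g ![x 2, x 3]) (model g) := by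
  let φ : (Fin 4 → ℂ) → Fin 4 → ℂ := fun x =>
    ![(x 0 + x 1) / 2, (x 0 - x 1) / (2 * Complex.I), x 2, x 3]
  let ψ : (Fin 4 → ℂ) → Fin 4 → ℂ := fun x =>
    ![x 0 + Complex.I * x 1, x 0 - Complex.I * x 1, x 2, x 3]
  have hI : Complex.I ≠ 0 := Complex.I_ne_zero
  have hφ : IsGermIso φ ψ := by
    refine ⟨?_, ?_, ?_, ?_, Filter.Eventually.of_forall fun x => ?_,
      Filter.Eventually.of_forall fun x => ?_⟩
    · refine analyticAt_pi_iff.2 fun i => ?_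
      fin_cases i
      · exact ((analyticAt_coord 0 0).fun_add (analyticAt_coord 1 0)).fun_div analyticAt_const
          two_ne_zero
      · exact ((analyticAt_coord 0 0).fun_sub (analyticAt_coord 1 0)).fun_div analyticAt_const
          (mul_ne_zero two_ne_zero hI)
      · exact analyticAt_coord 2 0
      · exact analyticAt_coord 3 0
    · refine analyticAt_pi_iff.2 fun i => ?_
      fin_cases i
      · exact (analyticAt_coord 0 0).fun_add (analyticAt_const.fun_mul (analyticAt_coord 1 0))
      · exact (analyticAt_coord 0 0).fun_sub (analyticAt_const.fun_mul (analyticAt_coord 1 0))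
      · exact analyticAt_coord 2 0
      · exact analyticAt_coord 3 0
    · funext i
      fin_cases i <;> simp [φ]
    · funext i
      fin_cases i <;> simp [ψ]
    · funext i
      fin_cases i
      · change (x 0 + Complex.I * x 1 + (x 0 - Complex.I * x 1)) / 2 = x 0
        ring
      · change (x 0 + Complex.I * x 1 - (x 0 - Complex.I * x 1)) / (2 * Complex.I) = x 1
        field_simp
        ring
      · rfl
      · rfl
    · funext i
      fin_cases i
      · change (x 0 + x 1) / 2 + Complex.I * ((x 0 - x 1) / (2 * Complex.I)) = x 0
        field_simp
        ring
      · change (x 0 + x 1) / 2 - Complex.I * ((x 0 - x 1) / (2 * Complex.I)) = x 1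
        field_simp
        ring
      · rfl
      · rfl
  refine hφ.contactEquivalent (Filter.Eventually.of_forall fun x => ?_)
  change x 0 * x 1 + g ![x 2, x 3] =
    ((x 0 + x 1) / 2) ^ 2 + ((x 0 - x 1) / (2 * Complex.I)) ^ 2 + g ![x 2, x 3]
  rw [div_pow, div_pow, mul_pow, Complex.I_sq]
  ring

/-- As only x₃ and x₄ occur in h, the weights m₁ and m₂ of the other variables are irrelevant. -/
theorem InVars.wge_slice_iff {h : MvPowerSeries (Fin 4) ℂ} (hv : InVars {2, 3} h) {b k : ℕ}
    {m₁ m₂ : ℕ} :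
    WGE ![b, 1] k (fun s => seriesSum h (slice s)) ↔ WGE ![m₁, m₂, b, 1] k (seriesSum h) := by
  constructor
  · intro h1
    refine (wge_pair h1 (WGE.coord (w := ![m₁, m₂, b, 1]) 2) (WGE.coord (w := ![m₁, m₂, b, 1]) 3)
      rfl rfl).congr (Filter.Eventually.of_forall fun x => ?_)
    change seriesSum h x = seriesSum h (slice ![x 2, x 3])
    rw [slice_pair, hv.seriesSum_restrictPt]
  · intro h1
    refine h1.comp (φ := slice) slice_zero fun i => ?_
    simp only [slice_apply]
    fin_cases i
    · exact WGE.zero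
    · exact WGE.zero
    · exact WGE.coord (w := ![b, 1]) 0
    · exact WGE.coord (w := ![b, 1]) 1

theorem vec_ones : (![1, 1, 1, 1] : Fin 4 → ℕ) = fun _ => 1 := by
  funext i
  fin_cases i <;> rfl

theorem InVars.order_eq_of_slice {h : MvPowerSeries (Fin 4) ℂ} (hv : InVars {2, 3} h)
    (hh : IsConvergent h) {g : MvPowerSeries (Fin 2) ℂ} (hg : IsConvergent g)
    (he : (fun s => seriesSum h (slice s)) =ᶠ[𝓝 0] seriesSum g) : h.order = g.order := by
  refine ENat.eq_of_forall_natCast_le_iff fun k => ?_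
  have e1 : (k : ℕ∞) ≤ h.order ↔ WGE (fun _ => 1) k (seriesSum h) :=
    ⟨fun hk => hh.wge hk, fun hk => hk.le_weightedOrder (fun _ => one_ne_zero) hh⟩
  have e2 : (k : ℕ∞) ≤ g.order ↔ WGE (fun _ => 1) k (seriesSum g) :=
    ⟨fun hk => hg.wge hk, fun hk => hk.le_weightedOrder (fun _ => one_ne_zero) hg⟩
  rw [e1, e2, ← vec_ones, ← hv.wge_slice_iff, wge_ones_iff]
  exact ⟨fun hk => hk.congr he.symm, fun hk => hk.congr he⟩

/-- The multiplicity of the residual term is an invariant of the singularity, so every splitting has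
the same one as the given model. -/
theorem IsSplitting.order_eq {f : MvPolynomial (Fin 4) ℂ} {q w p v h : MvPowerSeries (Fin 4) ℂ}
    (hs : IsSplitting f q w p v h) {n : ℕ} (hn : 2 ≤ n) (hcA : IsCA n (polyFun f)) :
    h.order = ((n + 1 : ℕ) : ℕ∞) := by
  obtain ⟨g, hg, hgo, hfg⟩ := hcA
  have h1 : AnalyticAt ℂ (fun s => seriesSum h (slice s)) 0 :=
    AnalyticAt.fun_comp (f := slice) (by rw [slice_zero]; exact hs.conv_h.analyticAt)
      (slice.analyticAt 0)
  obtain ⟨h2, hh2, he⟩ := exists_seriesSum_eq h1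
  have h3 : ContactEquivalent (model (seriesSum h2)) (model fun s => seriesSum h (slice s)) := by
    refine IsGermIso.refl.contactEquivalent ?_
    filter_upwards [tendsto_pair.eventually he] with x hx
    rw [model, model, ← hx]
  have h4 := order_eq_of_contactEquivalent hh2 hg hn hgo
    ((h3.trans hs.funSplitting.contactEquivalent).trans
      (hfg.trans (contactEquivalent_squares (seriesSum g))))
  rw [← h4]
  exact hs.vars_h.order_eq_of_slice hs.conv_h hh2 he

theorem IsCA.of_contactEquivalent {n : ℕ} {f f' : (Fin 4 → ℂ) → ℂ} (h : IsCA n f)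
    (hf : ContactEquivalent f f') : IsCA n f' := by
  obtain ⟨g, hg, hgo, hfg⟩ := h
  exact ⟨g, hg, hgo, hf.symm.trans hfg⟩

end Kawakita
end

noncomputable section
namespace Kawakita

/-! ## Straightening a curve to high order by a polynomial automorphism -/

theorem exists_pair_decomposition {f : (Fin 2 → ℂ) → ℂ} (hf : AnalyticAt ℂ f 0) (h0 : f 0 = 0) :
    ∃ c₁ c₂ : (Fin 2 → ℂ) → ℂ, AnalyticAt ℂ c₁ 0 ∧ AnalyticAt ℂ c₂ 0 ∧
      ∀ᶠ x in 𝓝 0, f x = x 0 * c₁ x + x 1 * c₂ x := by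
  have hρ : AnalyticAt ℂ (fun x : Fin 2 → ℂ => Function.update x 0 (0 : ℂ)) 0 :=
    analyticAt_update analyticAt_id analyticAt_const 0
  have hρ0 : Function.update (0 : Fin 2 → ℂ) 0 0 = 0 := by simp
  have hfρ : AnalyticAt ℂ (fun x => f (Function.update x 0 0)) 0 :=
    AnalyticAt.fun_comp (by rwa [hρ0]) hρ
  obtain ⟨c₁, hc₁, h1⟩ := exists_eq_mul_of_restrictPt (i := 0) (hf.fun_sub hfρ)
    (Filter.Eventually.of_forall fun x => by
      simp only [restrictPt_erase, Function.update_idem, sub_self])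
  obtain ⟨c₂, hc₂, h2⟩ := exists_eq_mul_of_restrictPt (i := 1) hfρ
    (Filter.Eventually.of_forall fun x => by
      simp only [restrictPt_erase]
      refine Eq.trans (congrArg f ?_) h0
      funext j
      fin_cases j <;> simp)
  refine ⟨c₁, c₂, hc₁, hc₂, ?_⟩
  filter_upwards [h1, h2] with x k1 k2
  rw [← k2, ← k1]
  ring

/-- The automorphism `x₃ ↦ x₃ + P(x₄)`, where `P(x₄)` is any polynomial fixed by it. -/
def shear (P : MvPolynomial (Fin 2) ℂ)
    (hP : ∀ c : ℂ, MvPolynomial.aeval ![MvPolynomial.X 0 + MvPolynomial.C c * P,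
      MvPolynomial.X 1] P = P) : MvPolynomial (Fin 2) ℂ ≃ₐ[ℂ] MvPolynomial (Fin 2) ℂ :=
  AlgEquiv.ofAlgHom
    (MvPolynomial.aeval ![MvPolynomial.X 0 + MvPolynomial.C 1 * P, MvPolynomial.X 1])
    (MvPolynomial.aeval ![MvPolynomial.X 0 + MvPolynomial.C (-1) * P, MvPolynomial.X 1])
    (by
      refine MvPolynomial.algHom_ext fun i => ?_
      have := hP 1
      fin_cases i <;> simp at this ⊢
      simp [this])
    (by
      refine MvPolynomial.algHom_ext fun i => ?_
      have := hP (-1)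
      fin_cases i <;> simp at this ⊢
      simp [this])

theorem ptMap_shear (P : MvPolynomial (Fin 2) ℂ) (hP) (y : Fin 2 → ℂ) :
    ptMap (shear P hP) y = ![y 0 + MvPolynomial.eval y P, y 1] := by
  funext i
  fin_cases i <;> simp [ptMap, shear]

/-- The automorphism exchanging the two variables. -/
def swapVars : MvPolynomial (Fin 2) ℂ ≃ₐ[ℂ] MvPolynomial (Fin 2) ℂ :=
  MvPolynomial.renameEquiv ℂ (Equiv.swap 0 1)

theorem ptMap_swapVars (y : Fin 2 → ℂ) : ptMap swapVars y = ![y 1, y 0] := by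
  funext i
  fin_cases i <;> simp [ptMap, swapVars]

/-- After exchanging the variables if necessary, f = 0 is a smooth curve transverse to the x₃-axis,
that is, a graph over the x₄-axis. Shears x₃ ↦ x₃ + s x₄^k remove its Taylor terms one at a time,
and stopping at order a keeps the coordinate change polynomial. -/
theorem exists_straighten {f : (Fin 2 → ℂ) → ℂ} (hf : AnalyticAt ℂ f 0) (h0 : f 0 = 0)
    (hd : fderiv ℂ f 0 ≠ 0) {a : ℕ} (ha : 1 ≤ a) :
    ∃ σ : MvPolynomial (Fin 2) ℂ ≃ₐ[ℂ] MvPolynomial (Fin 2) ℂ, ptMap σ 0 = 0 ∧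
      WGE ![a, 1] a fun x => f (ptMap σ x) := by
  -- The induction also carries c₁ 0 ≠ 0, which is what makes the next Taylor term removable.
  suffices h : ∃ σ : MvPolynomial (Fin 2) ℂ ≃ₐ[ℂ] MvPolynomial (Fin 2) ℂ, ptMap σ 0 = 0 ∧
      ∃ c₁ c₂ : (Fin 2 → ℂ) → ℂ, AnalyticAt ℂ c₁ 0 ∧ AnalyticAt ℂ c₂ 0 ∧ c₁ 0 ≠ 0 ∧
        ∀ᶠ x in 𝓝 0, f (ptMap σ x) = x 0 * c₁ x + x 1 ^ a * c₂ x by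
    obtain ⟨σ, hσ, c₁, c₂, h1, h2, -, h3⟩ := h
    refine ⟨σ, hσ, ?_⟩
    have k1 : WGE ![a, 1] a fun x : Fin 2 → ℂ => x 0 * c₁ x :=
      (WGE.coord (w := ![a, 1]) 0).mul_right h1
    have k2 : WGE ![a, 1] a fun x : Fin 2 → ℂ => x 1 ^ a * c₂ x :=
      (((WGE.coord (w := ![a, 1]) 1).pow a).le (by simp)).mul_right h2
    exact (k1.add k2).congr h3
  induction a, ha using Nat.le_induction with
  | base =>
    obtain ⟨c₁, c₂, h1, h2, h3⟩ := exists_pair_decomposition hf h0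
    have hc : c₁ 0 ≠ 0 ∨ c₂ 0 ≠ 0 := by
      by_contra hc
      push Not at hc
      refine hd ?_
      have k1 : WGE (fun _ => 1) 2 fun x : Fin 2 → ℂ => x 0 * c₁ x :=
        (WGE.coord (w := fun _ => 1) 0).mul (exists_order_le h1 hc.1)
      have k2 : WGE (fun _ => 1) 2 fun x : Fin 2 → ℂ => x 1 * c₂ x :=
        (WGE.coord (w := fun _ => 1) 1).mul (exists_order_le h2 hc.2)
      exact ((k1.add k2).congr h3).fderiv_eq_zero
    rcases hc with hc | hc
    · refine ⟨AlgEquiv.refl, ptMap_refl 0, c₁, c₂, h1, h2, hc, ?_⟩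
      simpa only [ptMap_refl, pow_one] using h3
    -- Here only the derivative in x₄ is known to be nonzero, so the variables are exchanged.
    · have hs0 : ptMap swapVars 0 = 0 := by
        rw [ptMap_swapVars]
        exact vec_pair_zero
      have ht := (isGermIso_ptMap hs0).tendsto
      have han : ∀ c : (Fin 2 → ℂ) → ℂ, AnalyticAt ℂ c 0 →
          AnalyticAt ℂ (fun x => c (ptMap swapVars x)) 0 := fun c h =>
        AnalyticAt.fun_comp (by rwa [hs0]) (analyticAt_ptMap _)
      refine ⟨swapVars, hs0, fun x => c₂ (ptMap swapVars x), fun x => c₁ (ptMap swapVars x),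
        han _ h2, han _ h1, by simpa only [hs0] using hc, ?_⟩
      filter_upwards [ht.eventually h3] with x hx
      rw [hx]
      have e0 : ptMap swapVars x 0 = x 1 := by rw [ptMap_swapVars]; rfl
      have e1 : ptMap swapVars x 1 = x 0 := by rw [ptMap_swapVars]; rfl
      rw [e0, e1]
      ring
  | succ a ha ih =>
    obtain ⟨σ, hσ, c₁, c₂, h1, h2, hc, h3⟩ := ih
    -- With this s the function s c₁ + c₂ vanishes at the origin, which raises the power of x₄ by
    -- one.
    set s : ℂ := -c₂ 0 / c₁ 0 with hs
    let P : MvPolynomial (Fin 2) ℂ := MvPolynomial.C s * MvPolynomial.X 1 ^ a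
    have hP : ∀ c : ℂ, MvPolynomial.aeval ![MvPolynomial.X 0 + MvPolynomial.C c * P,
      MvPolynomial.X 1] P = P := fun c => by
        simp only [P, map_mul, map_pow, MvPolynomial.aeval_X, MvPolynomial.aeval_C]
        rfl
    set τ := shear P hP with hτ
    have hpt : ∀ x, ptMap τ x = ![x 0 + s * x 1 ^ a, x 1] := fun x => by
      rw [hτ, ptMap_shear]
      simp [P]
    have hτ0 : ptMap τ 0 = 0 := by
      rw [hpt]
      simp [show a ≠ 0 by omega]
    have ht := (isGermIso_ptMap hτ0).tendsto
    have han : ∀ c : (Fin 2 → ℂ) → ℂ, AnalyticAt ℂ c 0 →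
        AnalyticAt ℂ (fun x => c (ptMap τ x)) 0 := fun c h =>
      AnalyticAt.fun_comp (by rwa [hτ0]) (analyticAt_ptMap _)
    have h4 := (analyticAt_const (v := s)).fun_mul (han _ h1) |>.fun_add (han _ h2)
    obtain ⟨d₁, d₂, k1, k2, k3⟩ := exists_pair_decomposition h4 (by
      simp only [hτ0, hs]
      field_simp
      ring)
    refine ⟨σ.trans τ, by rw [ptMap_trans, hτ0, hσ], fun x => c₁ (ptMap τ x) + x 1 ^ a * d₁ x, d₂,
      (han _ h1).fun_add (((analyticAt_coord 1 0).fun_pow a).fun_mul k1), k2, ?_, ?_⟩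
    · simpa [hτ0, show a ≠ 0 by omega] using hc
    · filter_upwards [ht.eventually h3, k3] with x k4 k5
      rw [ptMap_trans, k4]
      have e0 : ptMap τ x 0 = x 0 + s * x 1 ^ a := by rw [hpt]; rfl
      have e1 : ptMap τ x 1 = x 1 := by rw [hpt]; rfl
      rw [e0, e1]
      linear_combination x 1 ^ a * k5

theorem wge_pair_one {a : ℕ} (ha : 1 ≤ a) {f : (Fin 2 → ℂ) → ℂ} (hf : AnalyticAt ℂ f 0)
    (h0 : f 0 = 0) : WGE ![a, 1] 1 f := by
  refine (exists_order_le hf h0).of_weight fun d hd => hd.trans ?_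
  simp only [Finsupp.weight_apply, Finsupp.sum]
  refine Finset.sum_le_sum fun i _ => Nat.mul_le_mul_left _ ?_
  fin_cases i
  · exact ha
  · exact le_refl 1

/-- Write H ∘ σ = (H ∘ ξ) ∘ (η ∘ σ). It suffices that η ∘ σ respects the weights (a, 1). The second
component only needs weight 1, and the first gets weight a by straightening the smooth curve on
which the first component of η vanishes. -/
theorem exists_ptMap_of_germIso {H : (Fin 2 → ℂ) → ℂ} {ξ η : (Fin 2 → ℂ) → Fin 2 → ℂ}
    (hξ : IsGermIso ξ η) {a k : ℕ} (ha : 1 ≤ a) (hH : WGE ![a, 1] k fun s => H (ξ s)) :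
    ∃ σ : MvPolynomial (Fin 2) ℂ ≃ₐ[ℂ] MvPolynomial (Fin 2) ℂ, ptMap σ 0 = 0 ∧
      WGE ![a, 1] k fun s => H (ptMap σ s) := by
  have hη0 : AnalyticAt ℂ (fun x => η x 0) 0 := analyticAt_pi_iff.1 hξ.analytic_inv 0
  have hd : fderiv ℂ (fun x => η x 0) 0 ≠ 0 := by
    intro hd
    have h1 := hξ.symm.fderiv_comp_fderiv.self_of_nhds (Pi.single 0 1)
    have h2 := congrFun h1 0
    rw [fderiv_pi_apply hξ.analytic_inv, hd] at h2
    simp at h2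
  obtain ⟨σ, hσ, h1⟩ := exists_straighten hη0 (congrFun hξ.inv_zero 0) hd ha
  refine ⟨σ, hσ, ?_⟩
  have hc : AnalyticAt ℂ (fun x => η (ptMap σ x)) 0 :=
    AnalyticAt.fun_comp (by rw [hσ]; exact hξ.analytic_inv) (analyticAt_ptMap σ)
  have hc0 : η (ptMap σ 0) = 0 := by rw [hσ, hξ.inv_zero]
  have h2 := hH.comp (φ := fun x => η (ptMap σ x)) (w := ![a, 1]) hc0 (by
    intro i
    fin_cases i
    · exact h1
    · exact wge_pair_one ha (analyticAt_pi_iff.1 hc 1) (congrFun hc0 1))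
  refine h2.congr ?_
  filter_upwards [(isGermIso_ptMap hσ).tendsto.eventually hξ.right_inv] with x hx
  rw [hx]

/-- If d₀ ≤ n + 1, the assumption on an exponent d says d₁ ≥ t(n + 1 - d₀), which is at least a(n +
1 - d₀); otherwise d₀ alone suffices. Hence a model of weight t(n + 1) also serves for any a ≤ t. -/
theorem WGE.pair_weight_le {n t a : ℕ} (ha : a ≤ t) {g : (Fin 2 → ℂ) → ℂ}
    (hg : WGE ![t, 1] (t * (n + 1)) g) : WGE ![a, 1] (a * (n + 1)) g := by
  refine hg.of_weight fun d hd => ?_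
  rw [Finsupp.weight_apply, Finsupp.sum_fintype _ _ (by simp), Fin.sum_univ_two] at hd ⊢
  simp only [smul_eq_mul, Matrix.cons_val_zero, Matrix.cons_val_one, mul_one] at hd ⊢
  obtain ⟨e, he⟩ := Nat.exists_eq_add_of_le ha
  rcases le_total (n + 1) (d 0) with h | h
  · nlinarith
  · subst he
    nlinarith

/-- Only the lower bound is a condition: a monomial of degree n + 1 in x₃ and x₄ occurs in h, and
its weight is at most a(n + 1). -/
theorem IsSplitting.weightedOrder_eq {f : MvPolynomial (Fin 4) ℂ}
    {q w p v h : MvPowerSeries (Fin 4) ℂ} (hs : IsSplitting f q w p v h) {n a : ℕ} {m₁ m₂ : ℕ}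
    (hm₁ : m₁ ≠ 0) (hm₂ : m₂ ≠ 0) (ha : 1 ≤ a) (ho : h.order = ((n + 1 : ℕ) : ℕ∞))
    (hw : WGE ![a, 1] (a * (n + 1)) fun s => seriesSum h (slice s)) :
    h.weightedOrder ![m₁, m₂, a, 1] = ((a * (n + 1) : ℕ) : ℕ∞) := by
  refine le_antisymm ?_ ?_
  · obtain ⟨d, hd, hdeg⟩ := MvPowerSeries.exists_coeff_ne_zero_and_order (f := h) (by rw [ho]; rfl)
    rw [ho] at hdeg
    have hdeg' : d.degree = n + 1 := by exact_mod_cast hdeg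
    refine (MvPowerSeries.weightedOrder_le _ hd).trans ?_
    have hsub := hs.vars_h d hd
    have key : Finsupp.weight ![m₁, m₂, a, 1] d ≤ a * d.degree := by
      rw [Finsupp.weight_apply, Finsupp.sum, Finsupp.degree_apply, Finset.mul_sum]
      refine Finset.sum_le_sum fun i hi => ?_
      rw [smul_eq_mul, mul_comm]
      refine Nat.mul_le_mul_right _ ?_
      have := hsub hi
      simp only [Finset.mem_insert, Finset.mem_singleton] at this
      rcases this with rfl | rfl
      · exact le_refl a
      · exact ha
    rw [hdeg'] at key
    exact_mod_cast key
  · refine (hs.vars_h.wge_slice_iff.1 hw).le_weightedOrder (fun i => ?_) hs.conv_h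
    fin_cases i
    · exact hm₁
    · exact hm₂
    · change a ≠ 0
      omega
    · exact one_ne_zero

/-- For a = 1 the required weight is the multiplicity, so nothing has to be changed. For a > 1 the
model provided by the type gives an analytic change of x₃, x₄, which is then replaced by a
polynomial one. -/
theorem exists_coordinate_change {n r₁ r₂ a : ℕ} (hr₁ : r₁ ≠ 0) (hr₂ : r₂ ≠ 0) (ha : 0 < a)
    (hn : 2 ≤ n) (hsum : r₁ + r₂ = a * (n + 1)) {F : MvPolynomial (Fin 4) ℂ}
    (hF : 3 ≤ (F : MvPowerSeries (Fin 4) ℂ).order) (hcA : IsCA n (polyFun (hyp F)))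
    (htype : ∃ t, IsOfType n t (polyFun (hyp F)) ∧ a ≤ t) :
    ∃ σ : MvPolynomial (Fin 2) ℂ ≃ₐ[ℂ] MvPolynomial (Fin 2) ℂ,
      (∀ i, MvPolynomial.constantCoeff (σ (MvPolynomial.X i)) = 0) ∧
      (a = 1 → σ = AlgEquiv.refl) ∧
      ∃ q w p v h : MvPowerSeries (Fin 4) ℂ,
        IsSplitting (hyp (changeCoords σ F)) q w p v h ∧
        h.weightedOrder ![r₁, r₂, a, 1] = ((r₁ + r₂ : ℕ) : ℕ∞) := by
  obtain ⟨q, w, p, v, h, hs⟩ := exists_funSplitting hF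
  have hha : AnalyticAt ℂ (fun s => h (slice s)) 0 :=
    AnalyticAt.fun_comp (f := slice) (by rw [slice_zero]; exact hs.wge_h.analyticAt)
      (slice.analyticAt 0)
  have key : ∃ σ : MvPolynomial (Fin 2) ℂ ≃ₐ[ℂ] MvPolynomial (Fin 2) ℂ, ptMap σ 0 = 0 ∧
      (a = 1 → σ = AlgEquiv.refl) ∧
      (a ≠ 1 → WGE ![a, 1] (a * (n + 1)) fun s => h (slice (ptMap σ s))) := by
    by_cases h1 : a = 1
    · exact ⟨AlgEquiv.refl, ptMap_refl 0, fun _ => rfl, fun h2 => absurd h1 h2⟩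
    · obtain ⟨t, ⟨⟨ht1, g, hg, hgo, hfg⟩, -⟩, hat⟩ := htype
      have hgw : WGE ![a, 1] (a * (n + 1)) (seriesSum g) := (hg.wge hgo.ge).pair_weight_le hat
      obtain ⟨ξ, η, hξ, hw⟩ := exists_germIso_of_contactEquivalent hha ha hn hgw
        (hs.contactEquivalent.trans hfg)
      obtain ⟨σ, hσ, hσw⟩ :=
        exists_ptMap_of_germIso (H := fun s => h (slice s)) hξ ha hw
      exact ⟨σ, hσ, fun h2 => absurd h2 h1, fun _ => hσw⟩
  obtain ⟨σ, hσ, hσ1, hσw⟩ := key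
  -- The given splitting is transported by σ instead of splitting anew, so the new residual term is
  -- known to be h composed with σ.
  obtain ⟨q', w', p', v', h', hs', he⟩ := (hs.changeCoords hσ).exists_isSplitting
  have ho := hs'.order_eq hn (hcA.of_contactEquivalent (contactEquivalent_changeCoords hσ F))
  refine ⟨σ, ptMap_zero_iff.1 hσ, hσ1, q', w', p', v', h', hs', ?_⟩
  rw [hsum]
  refine hs'.weightedOrder_eq hr₁ hr₂ ha ho ?_
  by_cases h1 : a = 1
  · subst h1
    rw [hs'.vars_h.wge_slice_iff (m₁ := 1) (m₂ := 1), vec_ones, one_mul]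
    exact hs'.conv_h.wge ho.ge
  · refine (hσw h1).congr ?_
    filter_upwards [tendsto_slice.eventually he] with s hx
    rw [← hx]
    congr 1
    rw [slice_apply, slice_apply]
    change prolong (ptMap σ) ![0, 0, s 0, s 1] = _
    have e : (![(![0, 0, s 0, s 1] : Fin 4 → ℂ) 2, (![0, 0, s 0, s 1] : Fin 4 → ℂ) 3] :
        Fin 2 → ℂ) = s := vec_pair_eta s
    rw [prolong, e]
    rfl

end Kawakita
end

noncomputable section
namespace Kawakita

/-! ## Normal forms of the last two variables -/

/-- After a biholomorphic coordinate change respecting the weights `(a, 1)`, the function `H` is a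
power series of weight `r₁ + r₂` containing `x₃^((r₁ + r₂) / a)`. -/
def HasGoodForm (r₁ r₂ a : ℕ) (H : (Fin 2 → ℂ) → ℂ) : Prop :=
  ∃ (κ μ : (Fin 2 → ℂ) → Fin 2 → ℂ) (g : MvPowerSeries (Fin 2) ℂ), IsGermIso κ μ ∧
    (∀ i, WGE ![a, 1] ((![a, 1] : Fin 2 → ℕ) i) fun s => κ s i) ∧
    (∀ i, WGE ![a, 1] ((![a, 1] : Fin 2 → ℕ) i) fun s => μ s i) ∧ IsConvergent g ∧
    (∀ᶠ s in 𝓝 0, seriesSum g s = H (μ s)) ∧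
    g.weightedOrder ![a, 1] = ((r₁ + r₂ : ℕ) : ℕ∞) ∧
    MvPowerSeries.coeff (Finsupp.single 0 ((r₁ + r₂) / a)) g ≠ 0

theorem weight_two (b c : ℕ) (d : Fin 2 →₀ ℕ) : Finsupp.weight ![b, c] d = d 0 * b + d 1 * c := by
  rw [Finsupp.weight_apply, Finsupp.sum_fintype _ _ (by simp), Fin.sum_univ_two]
  rfl

theorem degree_two (d : Fin 2 →₀ ℕ) : d.degree = d 0 + d 1 := by
  rw [Finsupp.degree_eq_sum, Fin.sum_univ_two]

theorem eq_single_of_apply_one {d : Fin 2 →₀ ℕ} {k : ℕ} (h0 : d 0 = k) (h1 : d 1 = 0) :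
    d = Finsupp.single 0 k := by
  ext i
  fin_cases i
  · simpa using h0
  · simpa using h1

theorem eq_zero_of_eventually_eq_mul {c : ℂ} {G : ℂ → ℂ} {k : ℕ} (hG : ContinuousAt G 0)
    (h : ∀ᶠ t in 𝓝 0, t ^ k * c = t ^ (k + 1) * G t) : c = 0 := by
  have h4 : ∀ᶠ t in 𝓝[≠] (0 : ℂ), c = t * G t := by
    filter_upwards [h.filter_mono nhdsWithin_le_nhds, self_mem_nhdsWithin] with t ht ht0
    rw [pow_succ, mul_assoc] at ht
    exact mul_left_cancel₀ (pow_ne_zero k ht0) ht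
  have h5 : Filter.Tendsto (fun t => t * G t) (𝓝[≠] (0 : ℂ)) (𝓝 0) := by
    have : ContinuousAt (fun t => t * G t) 0 := continuousAt_id.mul hG
    simpa using this.tendsto.mono_left nhdsWithin_le_nhds
  exact tendsto_nhds_unique (tendsto_const_nhds.congr' (h4.mono fun t ht => ht)) h5

/-- A monomial of degree d₀ + d₁ = n + 1 with a d₀ + d₁ ≥ a(n + 1) has d₁ = 0, because a > 1. So the
leading form itself supplies x₃^(n+1). -/
theorem hasGoodForm_of_one_lt {r₁ r₂ a n : ℕ} (ha : 1 < a) (hsum : r₁ + r₂ = a * (n + 1))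
    {g : MvPowerSeries (Fin 2) ℂ} (hg : IsConvergent g) (ho : g.order = ((n + 1 : ℕ) : ℕ∞))
    (hw : ((r₁ + r₂ : ℕ) : ℕ∞) ≤ g.weightedOrder ![a, 1]) :
    HasGoodForm r₁ r₂ a (seriesSum g) := by
  have hdiv : (r₁ + r₂) / a = n + 1 := by
    rw [hsum, Nat.mul_div_cancel_left _ (by omega)]
  obtain ⟨d, hd, hdeg⟩ := MvPowerSeries.exists_coeff_ne_zero_and_order (f := g) (by rw [ho]; rfl)
  rw [ho] at hdeg
  have hdeg' : d.degree = n + 1 := by exact_mod_cast hdeg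
  have hwd : r₁ + r₂ ≤ Finsupp.weight ![a, 1] d := by
    exact_mod_cast hw.trans (MvPowerSeries.weightedOrder_le _ hd)
  rw [weight_two, hsum] at hwd
  rw [degree_two] at hdeg'
  have h1 : d 1 = 0 := by
    by_contra h1
    have : 1 ≤ d 1 := Nat.one_le_iff_ne_zero.2 h1
    have h2 : d 1 * a ≤ d 1 * 1 := by
      rw [← hdeg'] at hwd
      nlinarith
    nlinarith
  have hds : d = Finsupp.single 0 (n + 1) := eq_single_of_apply_one (by omega) h1
  subst hds
  refine ⟨fun x => x, fun x => x, g, IsGermIso.refl, fun i => WGE.coord i, fun i => WGE.coord i, hg,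
    by simp, le_antisymm ?_ hw, by rwa [hdiv]⟩
  refine (MvPowerSeries.weightedOrder_le _ hd).trans ?_
  rw [weight_two, hsum]
  simp [mul_comm]

/-- The coefficient of x₃^(n+1) after a linear change is the value of the leading form at the image
of the vector (1, 0), and a generic vector makes it nonzero. All linear changes respect the weights
(1, 1). -/
theorem hasGoodForm_one {r₁ r₂ n : ℕ} (hsum : r₁ + r₂ = n + 1)
    {g : MvPowerSeries (Fin 2) ℂ} (hg : IsConvergent g) (ho : g.order = ((n + 1 : ℕ) : ℕ∞)) :
    HasGoodForm r₁ r₂ 1 (seriesSum g) := by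
  have hpos : ∀ i, (![1, 1] : Fin 2 → ℕ) i ≠ 0 := fun i => by fin_cases i <;> simp
  -- As g has order n + 1, this is exactly its leading form.
  set P := truncLT (fun _ => 1) (n + 2) g with hP
  have hPc := coeff_truncLT (fun _ : Fin 2 => 1) (fun _ => one_ne_zero) (n + 2) g
  -- The extra factor makes the first coordinate of the point y below nonzero, so that μ is
  -- invertible.
  have hP0 : P * MvPolynomial.X 0 ≠ 0 := by
    refine mul_ne_zero (fun h0 => ?_) (MvPolynomial.X_ne_zero _)
    obtain ⟨d, hd, hdeg⟩ := MvPowerSeries.exists_coeff_ne_zero_and_order (f := g) (by rw [ho]; rfl)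
    rw [ho] at hdeg
    have hdeg' : d.degree = n + 1 := by exact_mod_cast hdeg
    have h1 := hPc d
    rw [← hP, h0, if_pos] at h1
    · exact hd (by simpa using h1.symm)
    · rw [← Finsupp.degree_eq_weight_one, hdeg']
      omega
  obtain ⟨y, hy⟩ : ∃ y, MvPolynomial.eval y (P * MvPolynomial.X 0) ≠ 0 := by
    by_contra hcon
    push Not at hcon
    exact hP0 (MvPolynomial.funext fun y => by simpa using hcon y)
  rw [map_mul, MvPolynomial.eval_X] at hy
  have hy0 : y 0 ≠ 0 := right_ne_zero_of_mul hy
  have hPy := left_ne_zero_of_mul hy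
  let μ : (Fin 2 → ℂ) → Fin 2 → ℂ := fun s => ![y 0 * s 0, y 1 * s 0 + s 1]
  let κ : (Fin 2 → ℂ) → Fin 2 → ℂ := fun x => ![(y 0)⁻¹ * x 0, x 1 - y 1 * (y 0)⁻¹ * x 0]
  have c0 : WGE ![1, 1] 1 fun s : Fin 2 → ℂ => s 0 := WGE.coord (w := ![1, 1]) 0
  have c1 : WGE ![1, 1] 1 fun s : Fin 2 → ℂ => s 1 := WGE.coord (w := ![1, 1]) 1
  have hμ : ∀ i, WGE ![1, 1] ((![1, 1] : Fin 2 → ℕ) i) fun s => μ s i := by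
    intro i
    fin_cases i
    · exact c0.const_mul _
    · exact (c0.const_mul _).add c1
  have hκ : ∀ i, WGE ![1, 1] ((![1, 1] : Fin 2 → ℕ) i) fun s => κ s i := by
    intro i
    fin_cases i
    · exact c0.const_mul _
    · exact c1.sub (c0.const_mul _)
  have hiso : IsGermIso κ μ := by
    refine ⟨analyticAt_pi_iff.2 fun i => (hκ i).analyticAt,
      analyticAt_pi_iff.2 fun i => (hμ i).analyticAt, ?_, ?_,
      Filter.Eventually.of_forall fun x => ?_, Filter.Eventually.of_forall fun x => ?_⟩
    · exact funext fun i => (hκ i).at_zero (Nat.one_le_iff_ne_zero.2 (hpos i))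
    · exact funext fun i => (hμ i).at_zero (Nat.one_le_iff_ne_zero.2 (hpos i))
    · funext i
      fin_cases i <;> simp [κ, μ] <;> field_simp <;> ring
    · funext i
      fin_cases i <;> simp [κ, μ] <;> field_simp <;> ring
  have hgw : WGE ![1, 1] (n + 1) (seriesSum g) := wge_ones_iff.2 (hg.wge ho.ge)
  have hcomp : WGE ![1, 1] (n + 1) fun s => seriesSum g (μ s) := hgw.comp hiso.inv_zero hμ
  obtain ⟨g', hg', he⟩ := exists_seriesSum_eq hcomp.analyticAt
  have hg'o := (hcomp.congr he.symm).le_weightedOrder hpos hg'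
  have hcoeff : MvPowerSeries.coeff (Finsupp.single 0 (n + 1)) g' ≠ 0 := by
    intro h0
    -- With weight 2 on x₄, every monomial of degree at least n + 1 other than x₃^(n+1) has weight
    -- at least n + 2. So g' would vanish to order n + 2 along the x₃-axis, which μ maps to the line
    -- through y, where the leading form of g is nonzero.
    have k1 : ((n + 2 : ℕ) : ℕ∞) ≤ g'.weightedOrder ![1, 2] := by
      refine MvPowerSeries.nat_le_weightedOrder _ fun d hd => ?_
      rw [weight_two] at hd
      by_cases hd1 : d 1 = 0
      · by_cases hd0 : d 0 = n + 1
        · rw [eq_single_of_apply_one hd0 hd1, h0]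
        · refine MvPowerSeries.coeff_eq_zero_of_lt_weightedOrder ![1, 1] (lt_of_lt_of_le ?_ hg'o)
          rw [weight_two]
          exact_mod_cast (by omega : d 0 * 1 + d 1 * 1 < n + 1)
      · refine MvPowerSeries.coeff_eq_zero_of_lt_weightedOrder ![1, 1] (lt_of_lt_of_le ?_ hg'o)
        rw [weight_two]
        exact_mod_cast (by omega : d 0 * 1 + d 1 * 1 < n + 1)
    obtain ⟨G₁, hG₁, e₁⟩ := (hg'.wge k1).exists_curve (x := ![1, 0])
      (fun i => by fin_cases i <;> simp)
    have k2 : ((n + 2 : ℕ) : ℕ∞) ≤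
        (g - (P : MvPowerSeries (Fin 2) ℂ)).weightedOrder (fun _ => 1) := by
      refine MvPowerSeries.nat_le_weightedOrder _ fun d hd => ?_
      rw [map_sub, MvPolynomial.coeff_coe, hPc, if_pos hd, sub_self]
    obtain ⟨G₂, hG₂, e₂⟩ := ((hg.sub (isConvergent_coe P)).wge k2).exists_curve (x := y)
      (fun i => one_ne_zero)
    have hhom : ∀ t : ℂ, MvPolynomial.eval (fun i => t ^ 1 * y i) P =
        t ^ (n + 1) * MvPolynomial.eval y P := by
      intro t
      rw [MvPolynomial.eval_eq', MvPolynomial.eval_eq', Finset.mul_sum]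
      refine Finset.sum_congr rfl fun d hd => ?_
      have hd' := MvPolynomial.mem_support_iff.1 hd
      have hwd : Finsupp.weight (fun _ : Fin 2 => 1) d = n + 1 := by
        rw [hPc] at hd'
        have h4 : Finsupp.weight (fun _ : Fin 2 => 1) d < n + 2 := by
          by_contra h5
          exact hd' (if_neg h5)
        rw [if_pos h4] at hd'
        have h5 : ¬ Finsupp.weight (fun _ : Fin 2 => 1) d < n + 1 := fun h6 => hd'
          (MvPowerSeries.coeff_eq_zero_of_lt_weightedOrder (fun _ => 1)
            (lt_of_lt_of_le (by exact_mod_cast h6) ho.ge))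
        omega
      change _ * mono d _ = _ * (_ * mono d y)
      rw [mono_mul_pt d (fun _ => t ^ 1) y, mono_weight_pow (fun _ => 1), hwd]
      ring
    have ht1 : Filter.Tendsto (fun (t : ℂ) (i : Fin 2) => t ^ (![1, 2] : Fin 2 → ℕ) i *
        (![1, 0] : Fin 2 → ℂ) i) (𝓝 0) (𝓝 0) := by
      have : Continuous (fun (t : ℂ) (i : Fin 2) => t ^ (![1, 2] : Fin 2 → ℕ) i *
        (![1, 0] : Fin 2 → ℂ) i) := by fun_prop
      have h := this.tendsto 0
      convert h using 2
      funext i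
      fin_cases i <;> simp
    have ht2 : Filter.Tendsto (fun (t : ℂ) (i : Fin 2) => t ^ 1 * y i) (𝓝 0) (𝓝 0) := by
      have : Continuous (fun (t : ℂ) (i : Fin 2) => t ^ 1 * y i) := by fun_prop
      have h := this.tendsto 0
      convert h using 2
      funext i
      simp
    refine hPy (eq_zero_of_eventually_eq_mul (k := n + 1) (G := fun t => G₁ t - G₂ t)
      (hG₁.sub hG₂) ?_)
    filter_upwards [e₁, e₂, ht1.eventually he, ht2.eventually (seriesSum_sub hg
      (isConvergent_coe P))] with t f1 f2 f3 f4
    have f5 : μ (fun i => t ^ (![1, 2] : Fin 2 → ℕ) i * (![1, 0] : Fin 2 → ℂ) i) =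
        fun i => t ^ 1 * y i := by
      funext i
      fin_cases i <;> simp [μ, mul_comm]
    rw [f5] at f3
    rw [seriesSum_coe, hhom, f3, f1, f2] at f4
    linear_combination f4
  refine ⟨κ, μ, g', hiso, hκ, hμ, hg', he.symm, ?_, ?_⟩
  · rw [hsum]
    refine le_antisymm ((MvPowerSeries.weightedOrder_le _ hcoeff).trans ?_) hg'o
    rw [weight_two]
    simp
  · rwa [hsum, Nat.div_one]

/-! ## Weighted blowups of graphs -/

theorem wge_prolong {N : ℕ} {ω : Fin N → ℕ} {r₁ r₂ a : ℕ} (ha : 1 ≤ a)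
    {κ : (Fin 2 → ℂ) → Fin 2 → ℂ}
    (hκ : ∀ i, WGE ![a, 1] ((![a, 1] : Fin 2 → ℕ) i) fun s => κ s i)
    {Θ : (Fin N → ℂ) → Fin 4 → ℂ}
    (hΘ : ∀ i, WGE ω ((![r₁, r₂, a, 1] : Fin 4 → ℕ) i) fun z => Θ z i) (i : Fin 4) :
    WGE ω ((![r₁, r₂, a, 1] : Fin 4 → ℕ) i) fun z => prolong κ (Θ z) i := by
  fin_cases i
  · exact hΘ 0
  · exact hΘ 1
  · exact wge_pair (hκ 0) (hΘ 2) (hΘ 3) ((hΘ 2).at_zero ha) ((hΘ 3).at_zero le_rfl)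
  · exact wge_pair (hκ 1) (hΘ 2) (hΘ 3) ((hΘ 2).at_zero ha) ((hΘ 3).at_zero le_rfl)

instance instNonemptyCone {N : ℕ} [NeZero N] : Nonempty (Cone N) :=
  ⟨⟨(0, Pi.single 0 1), fun h => by
    have := congrFun h 0
    simp at this⟩⟩

/-- Here Z is the image of f = 0 under the embedding ι with retraction π. The comparison maps are Θ
followed by κ in one direction and ι ∘ χ ∘ μ in the other. Only on the graph must Θ agree with the
coordinates X; the freedom off the graph is what allows its components to have the required weights.
-/
theorem isKawakitaBlowup_of_graph {r₁ r₂ a n : ℕ} (hr₁ : 0 < r₁) (hr₂ : 0 < r₂) (ha : 0 < a)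
    (hn : 2 ≤ n) (hsum : r₁ + r₂ = a * (n + 1)) (hcop₁ : a.Coprime r₁) (hcop₂ : a.Coprime r₂)
    {f : (Fin 4 → ℂ) → ℂ} {H : (Fin 2 → ℂ) → ℂ} {X χ : (Fin 4 → ℂ) → Fin 4 → ℂ}
    (hX : IsGermIso X χ) (hf : ∀ᶠ x in 𝓝 0, f x = model H (X x)) (hH0 : H 0 = 0)
    (hfa : AnalyticAt ℂ f 0) (hiso : IsIsolated f) (hH : HasGoodForm r₁ r₂ a H)
    {N : ℕ} [NeZero N] {ω : Fin N → ℕ} (hω : ∀ i, ω i ≠ 0) {Z : Set (Fin N → ℂ)}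
    {ι : (Fin 4 → ℂ) → Fin N → ℂ} {π : (Fin N → ℂ) → Fin 4 → ℂ} {Θ : (Fin N → ℂ) → Fin 4 → ℂ}
    (hZ : ∀ z, z ∈ Z ↔ ι (π z) = z ∧ f (π z) = 0) (hπι : ∀ x, π (ι x) = x)
    (hι0 : ι 0 = 0) (hπ : Filter.Tendsto π (𝓝 0) (𝓝 0))
    (hΘ : ∀ i, WGE ω ((![r₁, r₂, a, 1] : Fin 4 → ℕ) i) fun z => Θ z i)
    (hΘι : ∀ᶠ x in 𝓝 0, Θ (ι x) = X x)
    (hιχ : ∀ i, WGE ![r₁, r₂, a, 1] (ω i) fun y => ι (χ y) i) :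
    IsKawakitaBlowup r₁ r₂ a ω Z := by
  have hdiv : (r₁ + r₂) / a = n + 1 := by
    rw [hsum, Nat.mul_div_cancel_left _ ha]
  obtain ⟨κ, μ, g, hκμ, hκ, hμ, hg, hgH, hgw, hgc⟩ := hH
  have hpos : ∀ i, (![r₁, r₂, a, 1] : Fin 4 → ℕ) i ≠ 0 := fun i => by
    fin_cases i <;> simp <;> omega
  have hmodel : ∀ᶠ y in 𝓝 0, model (seriesSum g) y = model H (prolong μ y) := by
    filter_upwards [tendsto_pair.eventually hgH] with y hy
    rw [model_prolong, model, model, hy]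
  have hcontact : ContactEquivalent f (model (seriesSum g)) :=
    (hX.contactEquivalent hf).symm.trans (hκμ.symm.prolong.contactEquivalent hmodel)
  have hπ0 : π 0 = 0 := by rw [← hι0, hπι]
  have hf0 : f 0 = 0 := by
    rw [hf.self_of_nhds, hX.map_zero, model]
    have : (![(0 : Fin 4 → ℂ) 2, (0 : Fin 4 → ℂ) 3] : Fin 2 → ℂ) = 0 := vec_pair_zero
    rw [this, hH0]
    simp
  refine ⟨hr₁, hr₂, ha, ⟨n + 1, hsum⟩, hcop₁, hcop₂, by omega, g, hg, hgw, hgc,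
    hcontact.isIsolated hfa hiso, ?_⟩
  refine blowupsLocallyEquivalent_of_maps (Θ := fun z => prolong κ (Θ z))
    (Ψ := fun y => ι (χ (prolong μ y))) hω hpos ?_ ?_ (wge_prolong ha hκ hΘ) ?_ ?_ ?_
  · rw [hZ, hπ0, hι0, hf0]
    exact ⟨rfl, rfl⟩
  · have h1 : (0 : Fin 4 → ℂ) ∈ {x : Fin 4 → ℂ | model (seriesSum g) x = 0} := by
      rw [Set.mem_ofPred_eq, hmodel.self_of_nhds, hκμ.symm.prolong.map_zero]
      have h2 := hf.self_of_nhds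
      rwa [hX.map_zero, hf0, eq_comm] at h2
    exact h1
  · intro i
    exact (hιχ i).comp (φ := prolong μ) (w := ![r₁, r₂, a, 1]) hκμ.symm.prolong.map_zero
      (wge_prolong ha hμ fun j => WGE.coord j)
  · filter_upwards [hπ.eventually hΘι, hπ.eventually hf, hπ.eventually hX.left_inv,
      hπ.eventually (hX.tendsto.eventually hκμ.prolong.left_inv),
      hπ.eventually ((hκμ.prolong.comp hX).tendsto.eventually hmodel)] with z h1 h2 h3 h4 h5 hz
    obtain ⟨k1, k2⟩ := (hZ z).1 hz
    rw [k1] at h1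
    rw [h1]
    refine ⟨?_, ?_⟩
    · change model (seriesSum g) _ = 0
      rw [h5, h4, ← h2, k2]
    · rw [h4, h3, k1]
  · filter_upwards [hmodel, hκμ.symm.prolong.tendsto.eventually hX.right_inv,
      hκμ.prolong.right_inv,
      hκμ.symm.prolong.tendsto.eventually (hX.symm.tendsto.eventually hΘι),
      hκμ.symm.prolong.tendsto.eventually (hX.symm.tendsto.eventually hf)] with y h1 h2 h3 h4 h5 hy
    have hy' : model (seriesSum g) y = 0 := hy
    refine ⟨?_, ?_⟩
    · rw [hZ, hπι]
      refine ⟨rfl, ?_⟩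
      rw [h5, h2, ← h1, hy']
    · rw [h4, h2, h3]

/-! ## Isomorphisms of coordinate rings -/

theorem affineIso_of_maps {N M : ℕ} {f : MvPolynomial (Fin N) ℂ}
    {s : Set (MvPolynomial (Fin M) ℂ)} {j : Fin N → Fin M} {S : Set (Fin N)}
    (φ : MvPolynomial (Fin N) ℂ →ₐ[ℂ] MvPolynomial (Fin M) ℂ)
    (ρ : MvPolynomial (Fin M) ℂ →ₐ[ℂ] MvPolynomial (Fin N) ℂ)
    (hφ : φ f ∈ Ideal.span s) (hρ : ∀ P ∈ s, f ∣ ρ P)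
    (hρφ : ∀ i, ρ (φ (MvPolynomial.X i)) = MvPolynomial.X i)
    (hφρ : ∀ k, φ (ρ (MvPolynomial.X k)) - MvPolynomial.X k ∈ Ideal.span s)
    (hS : ∀ i ∈ S, φ (MvPolynomial.X i) = MvPolynomial.X (j i)) :
    AffineIso f (Ideal.span s) j S := by
  let Φ : (MvPolynomial (Fin N) ℂ ⧸ Ideal.span {f}) →ₐ[ℂ] MvPolynomial (Fin M) ℂ ⧸ Ideal.span s :=
    Ideal.quotientMapₐ _ φ (by
      rw [Ideal.span_le, Set.singleton_subset_iff]
      exact hφ)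
  let Ρ : (MvPolynomial (Fin M) ℂ ⧸ Ideal.span s) →ₐ[ℂ] MvPolynomial (Fin N) ℂ ⧸ Ideal.span {f} :=
    Ideal.quotientMapₐ _ ρ (by
      rw [Ideal.span_le]
      exact fun P hP => Ideal.mem_span_singleton.2 (hρ P hP))
  refine ⟨AlgEquiv.ofAlgHom Φ Ρ ?_ ?_, ?_⟩
  · refine Ideal.Quotient.algHom_ext _ (MvPolynomial.algHom_ext fun k => ?_)
    exact Ideal.Quotient.eq.2 (hφρ k)
  · refine Ideal.Quotient.algHom_ext _ (MvPolynomial.algHom_ext fun i => ?_)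
    change Ideal.Quotient.mk _ (ρ (φ (MvPolynomial.X i))) = Ideal.Quotient.mk _ (MvPolynomial.X i)
    rw [hρφ]
  · intro i hi
    change Ideal.Quotient.mk _ (φ (MvPolynomial.X i)) = _
    rw [hS i hi]

/-! ## Splittings without the first variable -/

theorem inVars_coe_iff {N : ℕ} {S : Finset (Fin N)} {P : MvPolynomial (Fin N) ℂ}
    (h : ∀ᶠ x in 𝓝 0, MvPolynomial.eval (restrictPt S x) P = MvPolynomial.eval x P) :
    InVars S (P : MvPowerSeries (Fin N) ℂ) := by
  have h1 : restrictVars S (P : MvPowerSeries (Fin N) ℂ) = P := by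
    refine seriesSum_injective ((isConvergent_coe P).restrictVars S) (isConvergent_coe P) ?_
    filter_upwards [h] with x hx
    rw [seriesSum_restrictVars, seriesSum_coe, seriesSum_coe, hx]
  rw [← h1]
  exact inVars_restrictVars S _

theorem InVars.eval_congr {N : ℕ} {S : Finset (Fin N)} {P : MvPolynomial (Fin N) ℂ}
    (h : InVars S (P : MvPowerSeries (Fin N) ℂ)) {x y : Fin N → ℂ} (hxy : ∀ i ∈ S, x i = y i) :
    MvPolynomial.eval x P = MvPolynomial.eval y P := by
  rw [← seriesSum_coe, ← seriesSum_coe]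
  exact h.seriesSum_congr hxy

theorem InVars.mono {N : ℕ} {S T : Finset (Fin N)} {p : MvPowerSeries (Fin N) ℂ} (h : InVars S p)
    (hST : S ⊆ T) : InVars T p := fun d hd => (h d hd).trans hST

/-- If G is free of x₁, then ((x₁ + q)w)² = x₁² + K with K free of x₁. The left side has a root of
order at least 2 at x₁ = -q. There the value of the right side gives K = -q², and its derivative -2q
must vanish. Hence q = K = 0 and w² = 1, so w = 1 by its constant term. -/
theorem IsSplitting.inVars_iff {G : MvPolynomial (Fin 4) ℂ} {q w p v h : MvPowerSeries (Fin 4) ℂ}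
    (hs : IsSplitting (hyp G) q w p v h) :
    InVars {1, 2, 3} (G : MvPowerSeries (Fin 4) ℂ) ↔ q = 0 ∧ w = 1 := by
  have hp := hs.vars_p.mono (T := {1, 2, 3}) (by decide)
  have hh := hs.vars_h.mono (T := {1, 2, 3}) (by decide)
  constructor
  · intro hG
    set K : (Fin 4 → ℂ) → ℂ := fun x => ((x 1 + seriesSum p x) * seriesSum v x) ^ 2 +
      seriesSum h x - x 1 ^ 2 - polyFun G x with hK
    have hKi : ∀ x t, K (Function.update x 0 t) = K x := by
      intro x t
      have key : ∀ {s : MvPowerSeries (Fin 4) ℂ}, InVars {1, 2, 3} s →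
          seriesSum s (Function.update x 0 t) = seriesSum s x := fun hs =>
        hs.seriesSum_congr fun i hi => Function.update_of_ne (by rintro rfl; simp at hi) _ _
      have hGx : polyFun G (Function.update x 0 t) = polyFun G x :=
        hG.eval_congr fun i hi => Function.update_of_ne (by rintro rfl; simp at hi) _ _
      simp only [hK, key hp, key hs.vars_v, key hh, hGx]
      simp
    have heq : ∀ᶠ x in 𝓝 0, ((x 0 + seriesSum q x) * seriesSum w x) ^ 2 = x 0 ^ 2 + K x := by
      filter_upwards [hs.eventually_eq] with x hx
      rw [polyFun_hyp] at hx
      simp only [hK]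
      linear_combination hx
    have hqi : ∀ x t, seriesSum q (Function.update x 0 t) = seriesSum q x := fun x t =>
      hs.vars_q.seriesSum_congr fun i hi => Function.update_of_ne (by rintro rfl; simp at hi) _ _
    have hqa := hs.conv_q.analyticAt
    have hq0 : seriesSum q 0 = 0 := (hs.conv_q.wge hs.order_q).at_zero one_le_two
    have hφ : AnalyticAt ℂ (fun x : Fin 4 → ℂ => Function.update x 0 (-seriesSum q x)) 0 :=
      analyticAt_update analyticAt_id hqa.fun_neg 0
    have hφ0 : Function.update (0 : Fin 4 → ℂ) 0 (-seriesSum q 0) = 0 := by simp [hq0]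
    have ht := tendsto_of_analyticAt hφ hφ0
    have hqK : ∀ᶠ x in 𝓝 0, seriesSum q x = 0 ∧ K x = 0 := by
      filter_upwards [ht.eventually heq.eventually_nhds,
        ht.eventually hs.conv_w.analyticAt.eventually_analyticAt] with x h1 h2
      set b := seriesSum q x with hb
      have k1 : K x = -b ^ 2 := by
        have := h1.self_of_nhds
        rw [hqi, hKi, ← hb] at this
        simp at this
        linear_combination -this
      have hcont : Continuous (fun t : ℂ => Function.update x 0 (t - b)) :=
        continuous_const.update 0 (continuous_id.sub continuous_const)
      have k2 : Filter.Tendsto (fun t : ℂ => Function.update x 0 (t - b)) (𝓝 0)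
          (𝓝 (Function.update x 0 (-b))) := by
        have := hcont.tendsto 0
        rwa [zero_sub] at this
      -- With x₁ = t - q and K = -q² the identity becomes t²w² = t² - 2qt.
      have k3 : ∀ᶠ t in 𝓝 (0 : ℂ), t ^ 1 * (2 * b) =
          t ^ (1 + 1) * (1 - seriesSum w (Function.update x 0 (t - b)) ^ 2) := by
        filter_upwards [k2.eventually h1] with t ht
        rw [hqi, hKi, k1, ← hb] at ht
        simp at ht
        linear_combination ht
      have k4 : ContinuousAt (fun t : ℂ => 1 - seriesSum w (Function.update x 0 (t - b)) ^ 2) 0 := by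
        refine continuousAt_const.sub (ContinuousAt.pow ?_ 2)
        refine ContinuousAt.comp' (f := fun t : ℂ => Function.update x 0 (t - b)) ?_
          hcont.continuousAt
        rw [zero_sub]
        exact h2.continuousAt
      have k5 := eq_zero_of_eventually_eq_mul k4 k3
      have k6 : b = 0 := by simpa using k5
      exact ⟨k6, by rw [k1, k6]; simp⟩
    have hqz : q = 0 := by
      refine seriesSum_injective hs.conv_q isConvergent_zero ?_
      filter_upwards [hqK] with x hx
      rw [hx.1, seriesSum_zero]
    refine ⟨hqz, ?_⟩
    have hww : (MvPowerSeries.X 0 * w) ^ 2 = (MvPowerSeries.X 0) ^ 2 := by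
      refine seriesSum_injective ((isConvergent_X 0).mul hs.conv_w).pow_two
        (isConvergent_X 0).pow_two ?_
      filter_upwards [heq, hqK, seriesSum_pow_two ((isConvergent_X 0).mul hs.conv_w),
        seriesSum_mul (isConvergent_X 0) hs.conv_w, seriesSum_pow_two (isConvergent_X (N := 4) 0)]
        with x h1 h2 h3 h4 h5
      rw [h3, h4, h5, seriesSum_X]
      rw [h2.1, h2.2] at h1
      simpa using h1
    rw [mul_pow] at hww
    have hX : (MvPowerSeries.X 0 : MvPowerSeries (Fin 4) ℂ) ^ 2 ≠ 0 := by
      refine pow_ne_zero 2 fun h0 => ?_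
      have := congrArg (MvPowerSeries.coeff (Finsupp.single 0 1)) h0
      rw [MvPowerSeries.coeff_index_single_self_X, map_zero] at this
      exact one_ne_zero this
    have hw1 : w ^ 2 = 1 := mul_left_cancel₀ hX (by rw [hww, mul_one])
    rcases mul_self_eq_one_iff.1 ((pow_two w).symm.trans hw1) with h1 | h1
    · exact h1
    · have := hs.const_w
      rw [h1, map_neg, map_one] at this
      norm_num at this
  · rintro ⟨rfl, rfl⟩
    refine inVars_coe_iff ?_
    have hcont : Filter.Tendsto (restrictPt ({1, 2, 3} : Finset (Fin 4))) (𝓝 0) (𝓝 0) := by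
      refine tendsto_pi_nhds.2 fun j => ?_
      by_cases hj : j ∈ ({1, 2, 3} : Finset (Fin 4))
      · simpa only [restrictPt, hj, if_true] using (continuous_apply j).tendsto (0 : Fin 4 → ℂ)
      · simp only [restrictPt, hj, if_false]
        exact tendsto_const_nhds
    filter_upwards [hs.eventually_eq, hcont.eventually hs.eventually_eq] with x h1 h2
    have hone : ∀ x : Fin 4 → ℂ, seriesSum (1 : MvPowerSeries (Fin 4) ℂ) x = 1 := fun x => by
      simpa using seriesSum_coe (1 : MvPolynomial (Fin 4) ℂ) x
    rw [polyFun_hyp, seriesSum_zero, hone] at h1 h2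
    rw [hp.seriesSum_restrictPt, hs.vars_v.seriesSum_restrictPt, hh.seriesSum_restrictPt] at h2
    have e1 : restrictPt ({1, 2, 3} : Finset (Fin 4)) x 1 = x 1 := by simp [restrictPt]
    rw [e1] at h2
    change polyFun G _ = polyFun G _
    linear_combination h2 - h1

end Kawakita
end

noncomputable section
namespace Kawakita

/-! ## Truncations -/

theorem minMult_le (r : ℕ) (p : MvPowerSeries (Fin 4) ℂ) : minMult r p ≤ r :=
  ENat.toNat_le_of_le_natCast (min_le_left _ _)

theorem coe_minMult (r : ℕ) (p : MvPowerSeries (Fin 4) ℂ) :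
    (minMult r p : ℕ∞) = min (r : ℕ∞) p.order :=
  ENat.natCast_toNat (ne_top_of_le_ne_top (ENat.natCast_ne_top r) (min_le_left _ _))

theorem minMult_le_order (r : ℕ) (p : MvPowerSeries (Fin 4) ℂ) : (minMult r p : ℕ∞) ≤ p.order := by
  rw [coe_minMult]
  exact min_le_right _ _

theorem one_le_minMult {r : ℕ} (hr : 0 < r) {p : MvPowerSeries (Fin 4) ℂ} (hp : 2 ≤ p.order) :
    1 ≤ minMult r p := by
  have : ((1 : ℕ) : ℕ∞) ≤ minMult r p := by
    rw [coe_minMult]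
    exact le_min (by exact_mod_cast hr) (le_trans (by norm_num) hp)
  exact_mod_cast this

theorem IsConvergent.wge_sub_truncLT {N : ℕ} {w : Fin N → ℕ} (hw : ∀ i, w i ≠ 0) (k : ℕ)
    {p : MvPowerSeries (Fin N) ℂ} (hp : IsConvergent p) :
    WGE w k fun x => seriesSum p x - MvPolynomial.eval x (truncLT w k p) := by
  have hc := hp.sub (isConvergent_coe (truncLT w k p))
  refine (hc.wge (w := w) (k := k) (MvPowerSeries.le_weightedOrder w fun d hd => ?_)).congr ?_
  · have hd' : Finsupp.weight w d < k := by exact_mod_cast hd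
    rw [map_sub, MvPolynomial.coeff_coe, coeff_truncLT w hw, if_pos hd', sub_self]
  · filter_upwards [seriesSum_sub hp (isConvergent_coe (truncLT w k p))] with x hx
    rw [hx, seriesSum_coe]

theorem IsConvergent.wge_sub_truncUnitLT {N : ℕ} {w : Fin N → ℕ} (hw : ∀ i, w i ≠ 0) (k : ℕ)
    {p : MvPowerSeries (Fin N) ℂ} (hp : IsConvergent p) :
    WGE w k fun x => seriesSum p x - MvPolynomial.eval x (truncUnitLT w k p) := by
  rw [truncUnitLT]
  split_ifs with hk
  -- For k = 0 no weight is required of the difference, so the conventional value 1 is harmless.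
  · subst hk
    exact WGE.of_analyticAt (hp.analyticAt.fun_sub (analyticAt_polyFun _))
  · exact hp.wge_sub_truncLT hw k

theorem InVars.truncLT {N : ℕ} {S : Finset (Fin N)} {p : MvPowerSeries (Fin N) ℂ} (h : InVars S p)
    {w : Fin N → ℕ} (hw : ∀ i, w i ≠ 0) (k : ℕ) :
    InVars S (Kawakita.truncLT w k p : MvPowerSeries (Fin N) ℂ) := by
  intro d hd
  rw [MvPolynomial.coeff_coe, coeff_truncLT w hw] at hd
  exact h d fun h0 => hd (by rw [h0, ite_self])

theorem InVars.truncUnitLT {N : ℕ} {S : Finset (Fin N)} {p : MvPowerSeries (Fin N) ℂ}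
    (h : InVars S p) {w : Fin N → ℕ} (hw : ∀ i, w i ≠ 0) (k : ℕ) :
    InVars S (Kawakita.truncUnitLT w k p : MvPowerSeries (Fin N) ℂ) := by
  rw [Kawakita.truncUnitLT]
  split_ifs with hk
  · intro d hd
    rw [MvPolynomial.coe_one, MvPowerSeries.coeff_one] at hd
    have : d = 0 := by
      by_contra h0
      simp [h0] at hd
    simp [this]
  · exact h.truncLT hw k

theorem truncLT_zero {N : ℕ} (w : Fin N → ℕ) (k : ℕ) :
    truncLT w k (0 : MvPowerSeries (Fin N) ℂ) = 0 := by
  simp [truncLT]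

theorem truncUnitLT_one {N : ℕ} {w : Fin N → ℕ} (hw : ∀ i, w i ≠ 0) (k : ℕ) :
    truncUnitLT w k (1 : MvPowerSeries (Fin N) ℂ) = 1 := by
  classical
  rw [truncUnitLT]
  split_ifs with hk
  · rfl
  · ext d
    rw [coeff_truncLT w hw, MvPowerSeries.coeff_one, MvPolynomial.coeff_one]
    by_cases hd : d = 0
    · subst hd
      simp [Nat.pos_of_ne_zero hk]
    · simp [hd, Ne.symm hd]

/-- The functions `q₁`, `w₁`, `p₁`, `p₂` and `v₁` agree with the parts `q`, `w`, `p` and `v` of a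
splitting up to the weights needed for the blowup. -/
structure IsTruncation (r₁ r₂ : ℕ) (ω : Fin 4 → ℕ) (q w p v q₁ w₁ p₁ p₂ v₁ : (Fin 4 → ℂ) → ℂ) :
    Prop where
  sub_q : WGE ω r₁ fun x => q x - q₁ x
  sub_w : WGE ω (r₁ - ω 0) fun x => w x - w₁ x
  sub_p₁ : WGE ω r₁ fun x => p x - p₁ x
  sub_p₂ : WGE ω r₂ fun x => p x - p₂ x
  sub_v : WGE ω (r₁ - r₂) fun x => v x - v₁ x
  an_w₁ : AnalyticAt ℂ w₁ 0
  an_v₁ : AnalyticAt ℂ v₁ 0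
  wge_q : WGE ![0, ω 1, ω 2, ω 3] (ω 0) q
  wge_p : WGE ![0, 0, ω 2, ω 3] (ω 1) p
  le₀ : ω 0 ≤ r₂
  le₁ : ω 1 ≤ r₂
  pos : ∀ i, ω i ≠ 0
  le : r₂ ≤ r₁

/-- A lift of `splitCoords` to a space with functions `A` and `B` extending the truncations of its
first two coordinates. -/
def liftedCoords (q w p v q₁ w₁ p₁ p₂ v₁ : (Fin 4 → ℂ) → ℂ) (A B : ℂ) (x : Fin 4 → ℂ) :
    Fin 4 → ℂ :=
  ![A + ((x 0 + q x) * (w x - w₁ x) + (q x - q₁ x) * w₁ x) +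
      ((B + (p x - p₂ x)) * (v x - v₁ x) + (p x - p₁ x) * v₁ x),
    2 * ((B + (p x - p₂ x)) * v x) -
      (A + ((x 0 + q x) * (w x - w₁ x) + (q x - q₁ x) * w₁ x) +
        ((B + (p x - p₂ x)) * (v x - v₁ x) + (p x - p₁ x) * v₁ x)), x 2, x 3]

/-- Telescoping: (x₁ + q)w - (x₁ + q₁)w₁ = (x₁ + q)(w - w₁) + (q - q₁)w₁, and likewise for the
second product. There x₂ + p is written as B + (p - p₂), because x₂ alone may have weight less than
r₂ while B has weight r₂. -/
theorem liftedCoords_eq (q w p v q₁ w₁ p₁ p₂ v₁ : (Fin 4 → ℂ) → ℂ) (x : Fin 4 → ℂ) :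
    liftedCoords q w p v q₁ w₁ p₁ p₂ v₁ ((x 0 + q₁ x) * w₁ x + (x 1 + p₁ x) * v₁ x) (x 1 + p₂ x) x =
      splitCoords q w p v x := by
  funext i
  fin_cases i
  · simp only [liftedCoords, splitCoords, Fin.zero_eta, Matrix.cons_val_zero]
    ring
  · simp only [liftedCoords, splitCoords, Fin.mk_one, Matrix.cons_val_one, Matrix.cons_val_zero]
    ring
  · rfl
  · rfl

namespace IsTruncation

variable {r₁ r₂ : ℕ} {ω : Fin 4 → ℕ} {q w p v q₁ w₁ p₁ p₂ v₁ : (Fin 4 → ℂ) → ℂ}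

/-- Every correction term reaches weight r₁: x₁ + q has weight at least ω 0 and w - w₁ at least r₁ -
ω 0, while B + (p - p₂) has weight at least r₂ and v - v₁ at least r₁ - r₂. This is why w and v are
truncated at exactly these weights. -/
theorem wge_liftedCoords (ht : IsTruncation r₁ r₂ ω q w p v q₁ w₁ p₁ p₂ v₁)
    (hv : AnalyticAt ℂ v 0) {N : ℕ} {θ : Fin N → ℕ} {A B : (Fin N → ℂ) → ℂ}
    {π : (Fin N → ℂ) → Fin 4 → ℂ} (hA : WGE θ r₁ A) (hB : WGE θ r₂ B)
    (hπ : ∀ i, WGE θ (ω i) fun z => π z i) (i : Fin 4) :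
    WGE θ ((![r₁, r₂, ω 2, ω 3] : Fin 4 → ℕ) i)
      fun z => liftedCoords q w p v q₁ w₁ p₁ p₂ v₁ (A z) (B z) (π z) i := by
  have hπ0 : π 0 = 0 := funext fun i => (hπ i).at_zero (Nat.one_le_iff_ne_zero.2 (ht.pos i))
  have hπa : AnalyticAt ℂ π 0 := analyticAt_pi_iff.2 fun i => (hπ i).analyticAt
  have han : ∀ {s : (Fin 4 → ℂ) → ℂ}, AnalyticAt ℂ s 0 → AnalyticAt ℂ (fun z => s (π z)) 0 :=
    fun hs => AnalyticAt.fun_comp (by rwa [hπ0]) hπa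
  have hq : WGE θ (ω 0) fun z => q (π z) := ht.wge_q.comp hπ0 fun j => by
    fin_cases j
    · exact (hπ 0).le (Nat.zero_le _)
    · exact hπ 1
    · exact hπ 2
    · exact hπ 3
  have hBp : WGE θ r₂ fun z => B z + (p (π z) - p₂ (π z)) := hB.add (ht.sub_p₂.comp hπ0 hπ)
  have h0 : WGE θ r₁ fun z => liftedCoords q w p v q₁ w₁ p₁ p₂ v₁ (A z) (B z) (π z) 0 := by
    refine (hA.add (WGE.add (WGE.le ?_ (add_tsub_cancel_of_le (ht.le₀.trans ht.le)).ge)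
      ((ht.sub_q.comp hπ0 hπ).mul_right (han ht.an_w₁)))).add (WGE.add (WGE.le ?_
        (add_tsub_cancel_of_le ht.le).ge) ((ht.sub_p₁.comp hπ0 hπ).mul_right (han ht.an_v₁)))
    · exact ((hπ 0).add hq).mul (ht.sub_w.comp hπ0 hπ)
    · exact hBp.mul (ht.sub_v.comp hπ0 hπ)
  fin_cases i
  · exact h0
  · exact ((hBp.mul_right (han hv)).const_mul 2).sub (h0.le ht.le)
  · exact hπ 2
  · exact hπ 3

/-- In the coordinates y one has 2A = y₁ - y₂ and 2B = y₁ + y₂, both of weight at least r₂ because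
r₂ ≤ r₁. Dividing by units gives this bound for x₁ + q and x₂ + p. As p involves only x₃ and x₄, the
weight of x₂ is bounded first; q involves x₂, x₃ and x₄, so that of x₁ follows. Finally α differs
from y₁, and β from x₂ + p, by terms of weight at least r₁ and r₂. -/
theorem exists_inverse {h f : (Fin 4 → ℂ) → ℂ} (hs : FunSplitting f q w p v h)
    (ht : IsTruncation r₁ r₂ ω q w p v q₁ w₁ p₁ p₂ v₁) :
    ∃ χ, IsGermIso (splitCoords q w p v) χ ∧
      (∀ i, WGE ![r₁, r₂, ω 2, ω 3] (ω i) fun y => χ y i) ∧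
      WGE ![r₁, r₂, ω 2, ω 3] r₂ (fun y => χ y 0 + q (χ y)) ∧
      WGE ![r₁, r₂, ω 2, ω 3] r₁ (fun y => (χ y 0 + q₁ (χ y)) * w₁ (χ y) +
        (χ y 1 + p₁ (χ y)) * v₁ (χ y)) ∧
      WGE ![r₁, r₂, ω 2, ω 3] r₂ (fun y => χ y 1 + p₂ (χ y)) := by
  obtain ⟨χ, hχ⟩ := hs.exists_isGermIso
  set R : Fin 4 → ℕ := ![r₁, r₂, ω 2, ω 3] with hR
  have hχ0 := hχ.inv_zero
  have han : ∀ {s : (Fin 4 → ℂ) → ℂ}, AnalyticAt ℂ s 0 → AnalyticAt ℂ (fun z => s (χ z)) 0 :=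
    fun hs => AnalyticAt.fun_comp (by rwa [hχ0]) hχ.analytic_inv
  have hχa : ∀ i, AnalyticAt ℂ (fun y => χ y i) 0 := analyticAt_pi_iff.1 hχ.analytic_inv
  have c0 : WGE R r₁ fun y => y 0 := WGE.coord (w := R) 0
  have c1 : WGE R r₂ fun y => y 1 := WGE.coord (w := R) 1
  have e : ∀ i, ∀ᶠ y in 𝓝 0, splitCoords q w p v (χ y) i = y i := fun i => by
    filter_upwards [hχ.right_inv] with y hy
    rw [hy]
  have d2 : WGE R (ω 2) fun y => χ y 2 := (WGE.coord (w := R) 2).congr (e 2)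
  have d3 : WGE R (ω 3) fun y => χ y 3 := (WGE.coord (w := R) 3).congr (e 3)
  have hne : ∀ {s : (Fin 4 → ℂ) → ℂ}, AnalyticAt ℂ s 0 → s 0 = 1 →
      ∀ᶠ y in 𝓝 0, s (χ y) ≠ 0 := fun {s} hs h1 =>
    (han hs).continuousAt.eventually_ne (by rw [hχ0, h1]; exact one_ne_zero)
  have hB : WGE R r₂ fun y => χ y 1 + p (χ y) := by
    refine (((c0.le ht.le).add c1).mul_right
      ((analyticAt_const (v := (2 : ℂ))).fun_mul (han hs.an_v) |>.fun_inv ?_)).congr ?_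
    · rw [hχ0, hs.v_zero]
      norm_num
    · filter_upwards [e 0, e 1, hne hs.an_v hs.v_zero] with y h0 h1 h2
      change (χ y 0 + q (χ y)) * w (χ y) + (χ y 1 + p (χ y)) * v (χ y) = _ at h0
      change (χ y 1 + p (χ y)) * v (χ y) - (χ y 0 + q (χ y)) * w (χ y) = _ at h1
      rw [← h0, ← h1]
      field_simp
      ring
  have hA : WGE R r₂ fun y => χ y 0 + q (χ y) := by
    refine (((c0.le ht.le).sub c1).mul_right
      ((analyticAt_const (v := (2 : ℂ))).fun_mul (han hs.an_w) |>.fun_inv ?_)).congr ?_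
    · rw [hχ0, hs.w_zero]
      norm_num
    · filter_upwards [e 0, e 1, hne hs.an_w hs.w_zero] with y h0 h1 h2
      change (χ y 0 + q (χ y)) * w (χ y) + (χ y 1 + p (χ y)) * v (χ y) = _ at h0
      change (χ y 1 + p (χ y)) * v (χ y) - (χ y 0 + q (χ y)) * w (χ y) = _ at h1
      rw [← h0, ← h1]
      field_simp
      ring
  -- The weights 0 on the first two variables express that p does not involve them: nothing about χ
  -- y 0 and χ y 1 is needed yet.
  have hp : WGE R (ω 1) fun y => p (χ y) := ht.wge_p.comp hχ0 fun j => by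
    fin_cases j
    · exact WGE.of_analyticAt (hχa 0)
    · exact WGE.of_analyticAt (hχa 1)
    · exact d2
    · exact d3
  have d1 : WGE R (ω 1) fun y => χ y 1 := ((hB.le ht.le₁).sub hp).congr
    (Filter.Eventually.of_forall fun y => by ring)
  have hq : WGE R (ω 0) fun y => q (χ y) := ht.wge_q.comp hχ0 fun j => by
    fin_cases j
    · exact WGE.of_analyticAt (hχa 0)
    · exact d1
    · exact d2
    · exact d3
  have d0 : WGE R (ω 0) fun y => χ y 0 := ((hA.le ht.le₀).sub hq).congr
    (Filter.Eventually.of_forall fun y => by ring)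
  have d : ∀ i, WGE R (ω i) fun y => χ y i := fun i => by
    fin_cases i
    · exact d0
    · exact d1
    · exact d2
    · exact d3
  refine ⟨χ, hχ, d, hA, ?_, ?_⟩
  · have k1 : WGE R r₁ fun y => (χ y 0 + q (χ y)) * (w (χ y) - w₁ (χ y)) :=
      ((hA.le ht.le₀).mul (ht.sub_w.comp hχ0 d)).le
        (add_tsub_cancel_of_le (ht.le₀.trans ht.le)).ge
    have k2 : WGE R r₁ fun y => (χ y 1 + p (χ y)) * (v (χ y) - v₁ (χ y)) :=
      (hB.mul (ht.sub_v.comp hχ0 d)).le (add_tsub_cancel_of_le ht.le).ge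
    refine (((c0.sub k1).sub k2).sub (((ht.sub_q.comp hχ0 d).mul_right (han ht.an_w₁)).add
      ((ht.sub_p₁.comp hχ0 d).mul_right (han ht.an_v₁)))).congr ?_
    filter_upwards [e 0] with y h0
    change (χ y 0 + q (χ y)) * w (χ y) + (χ y 1 + p (χ y)) * v (χ y) = _ at h0
    rw [← h0]
    ring
  · exact (hB.sub (ht.sub_p₂.comp hχ0 d)).congr (Filter.Eventually.of_forall fun y => by ring)

end IsTruncation

/-- For a = 1 the invariance of the multiplicity already gives what is needed, so a weight condition
on h is imposed only for a > 1. -/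
theorem IsSplitting.hasGoodForm {f : MvPolynomial (Fin 4) ℂ} {q w p v h : MvPowerSeries (Fin 4) ℂ}
    (hs : IsSplitting f q w p v h) {n r₁ r₂ a : ℕ} (hn : 2 ≤ n) (ha : 0 < a)
    (hsum : r₁ + r₂ = a * (n + 1)) (hcA : IsCA n (polyFun f))
    (hh : 1 < a → h.weightedOrder ![r₁, r₂, a, 1] = ((r₁ + r₂ : ℕ) : ℕ∞)) :
    HasGoodForm r₁ r₂ a fun s => seriesSum h (slice s) := by
  obtain ⟨g, hg, he⟩ := exists_seriesSum_eq (f := fun s => seriesSum h (slice s))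
    (AnalyticAt.fun_comp (f := slice) (by rw [slice_zero]; exact hs.conv_h.analyticAt)
      (slice.analyticAt 0))
  have hgo : g.order = ((n + 1 : ℕ) : ℕ∞) := by
    rw [← hs.order_eq hn hcA, hs.vars_h.order_eq_of_slice hs.conv_h hg he]
  have hgood : HasGoodForm r₁ r₂ a (seriesSum g) := by
    rcases (Nat.succ_le_of_lt ha).eq_or_lt with h1 | h1
    · obtain rfl : a = 1 := h1.symm
      exact hasGoodForm_one (by rw [hsum, one_mul]) hg hgo
    · refine hasGoodForm_of_one_lt h1 hsum hg hgo
        (WGE.le_weightedOrder (fun i => ?_) hg (WGE.congr ?_ he.symm))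
      · fin_cases i <;> simp <;> omega
      · exact hs.vars_h.wge_slice_iff.2 (hs.conv_h.wge (hh h1).ge)
  obtain ⟨κ, μ, g', h1, h2, h3, h4, h5, h6⟩ := hgood
  refine ⟨κ, μ, g', h1, h2, h3, h4, ?_, h6⟩
  filter_upwards [h5, h1.symm.tendsto.eventually he] with s k1 k2
  rw [k1, ← k2]

end Kawakita
end

noncomputable section
namespace Kawakita

/-! ## The weighted blowups -/

theorem xWeights_ne_zero {r₂ a : ℕ} (hr₂ : 0 < r₂) (ha : 0 < a) {f : MvPolynomial (Fin 4) ℂ}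
    {q w p v h : MvPowerSeries (Fin 4) ℂ} (hs : IsSplitting f q w p v h) (i : Fin 4) :
    xWeights r₂ a q p i ≠ 0 := by
  fin_cases i
  · exact Nat.one_le_iff_ne_zero.1 (one_le_minMult hr₂ hs.order_q)
  · exact Nat.one_le_iff_ne_zero.1 (one_le_minMult hr₂ hs.order_p)
  · exact ha.ne'
  · exact one_ne_zero

theorem IsSplitting.isTruncation {r₁ r₂ a : ℕ} (hr₂ : 0 < r₂) (hr : r₂ ≤ r₁) (ha : 0 < a)
    {f : MvPolynomial (Fin 4) ℂ} {q w p v h : MvPowerSeries (Fin 4) ℂ}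
    (hs : IsSplitting f q w p v h) :
    IsTruncation r₁ r₂ (xWeights r₂ a q p) (seriesSum q) (seriesSum w) (seriesSum p) (seriesSum v)
      (polyFun (truncLT (xWeights r₂ a q p) r₁ q))
      (polyFun (truncUnitLT (xWeights r₂ a q p) (r₁ - minMult r₂ q) w))
      (polyFun (truncLT (xWeights r₂ a q p) r₁ p)) (polyFun (truncLT (xWeights r₂ a q p) r₂ p))
      (polyFun (truncUnitLT (xWeights r₂ a q p) (r₁ - r₂) v)) := by
  have hω := fun i => xWeights_ne_zero hr₂ ha hs i
  have hω1 : ∀ i, 1 ≤ xWeights r₂ a q p i := fun i => Nat.one_le_iff_ne_zero.2 (hω i)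
  refine ⟨hs.conv_q.wge_sub_truncLT hω r₁, hs.conv_w.wge_sub_truncUnitLT hω _,
    hs.conv_p.wge_sub_truncLT hω r₁, hs.conv_p.wge_sub_truncLT hω r₂,
    hs.conv_v.wge_sub_truncUnitLT hω _, analyticAt_polyFun _, analyticAt_polyFun _,
    -- The variables occurring in q have weight at least 1, so its weight is at least its
    -- multiplicity, whatever weight x₁ is given.
    hs.conv_q.wge (hs.vars_q.le_weightedOrder (w := fun _ => 1) ?_ (minMult_le_order r₂ q)),
    hs.conv_p.wge (hs.vars_p.le_weightedOrder (w := fun _ => 1) ?_ (minMult_le_order r₂ p)),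
    minMult_le _ _, minMult_le _ _, hω, hr⟩
  · intro i hi
    fin_cases i
    · simp at hi
    · exact hω1 1
    · exact hω1 2
    · exact hω1 3
  · intro i hi
    fin_cases i
    · simp at hi
    · simp at hi
    · exact hω1 2
    · exact hω1 3

theorem polyFun_firstPart (r₁ r₂ a : ℕ) (q w p : MvPowerSeries (Fin 4) ℂ) (x : Fin 4 → ℂ) :
    polyFun (firstPart r₁ r₂ a q w p) x =
      (x 0 + polyFun (truncLT (xWeights r₂ a q p) r₁ q) x) *
        polyFun (truncUnitLT (xWeights r₂ a q p) (r₁ - minMult r₂ q) w) x := by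
  simp [polyFun, firstPart]

theorem polyFun_secondPart (r₁ r₂ a : ℕ) (q p v : MvPowerSeries (Fin 4) ℂ) (x : Fin 4 → ℂ) :
    polyFun (secondPart r₁ r₂ a q p v) x =
      (x 1 + polyFun (truncLT (xWeights r₂ a q p) r₁ p) x) *
        polyFun (truncUnitLT (xWeights r₂ a q p) (r₁ - r₂) v) x := by
  simp [polyFun, secondPart]

theorem polyFun_betaPart (r₂ a : ℕ) (q p : MvPowerSeries (Fin 4) ℂ) (x : Fin 4 → ℂ) :
    polyFun (betaPart r₂ a q p) x = x 1 + polyFun (truncLT (xWeights r₂ a q p) r₂ p) x := by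
  simp [polyFun, betaPart]

/-- The numerical and geometric hypotheses on a hypersurface with a splitting under which its
weighted blowups are Kawakita blowups. -/
structure BlowupData (r₁ r₂ a n : ℕ) (G : MvPolynomial (Fin 4) ℂ)
    (q w p v h : MvPowerSeries (Fin 4) ℂ) : Prop where
  pos : 0 < r₂
  le : r₂ ≤ r₁
  a_pos : 0 < a
  two_le : 2 ≤ n
  sum_eq : r₁ + r₂ = a * (n + 1)
  cop₁ : a.Coprime r₁
  cop₂ : a.Coprime r₂
  splitting : IsSplitting (hyp G) q w p v h
  isolated : IsIsolated (polyFun (hyp G))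
  good : HasGoodForm r₁ r₂ a fun s => seriesSum h (slice s)

namespace BlowupData

variable {r₁ r₂ a n : ℕ} {G : MvPolynomial (Fin 4) ℂ} {q w p v h : MvPowerSeries (Fin 4) ℂ}

/-- The functions A and B extend the polynomials α and β from the graph, with the right weights. Two
left inverses of ι appear: π describes Z, while the components of π' have the required weights. They
differ for the ideal J, where x₁ as a polynomial in the new coordinates need not have a large enough
weight. -/
theorem isKawakitaBlowup (hd : BlowupData r₁ r₂ a n G q w p v h) {N : ℕ} [NeZero N]
    {θ : Fin N → ℕ} (hθ : ∀ i, θ i ≠ 0) {Z : Set (Fin N → ℂ)}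
    {ι : (Fin 4 → ℂ) → Fin N → ℂ} {π π' : (Fin N → ℂ) → Fin 4 → ℂ} {A B : (Fin N → ℂ) → ℂ}
    (hZ : ∀ z, z ∈ Z ↔ ι (π z) = z ∧ polyFun (hyp G) (π z) = 0) (hπι : ∀ x, π (ι x) = x)
    (hι0 : ι 0 = 0) (hπ : Continuous π) (hA : WGE θ r₁ A) (hB : WGE θ r₂ B)
    (hπ' : ∀ i, WGE θ (xWeights r₂ a q p i) fun z => π' z i) (hπ'ι : ∀ x, π' (ι x) = x)
    (hAι : ∀ x, A (ι x) = polyFun (firstPart r₁ r₂ a q w p + secondPart r₁ r₂ a q p v) x)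
    (hBι : ∀ x, B (ι x) = polyFun (betaPart r₂ a q p) x)
    (hιχ : ∀ χ : (Fin 4 → ℂ) → Fin 4 → ℂ,
      (∀ i, WGE ![r₁, r₂, a, 1] (xWeights r₂ a q p i) fun y => χ y i) →
      WGE ![r₁, r₂, a, 1] r₂ (fun y => χ y 0 + seriesSum q (χ y)) →
      WGE ![r₁, r₂, a, 1] r₁
        (fun y => polyFun (firstPart r₁ r₂ a q w p + secondPart r₁ r₂ a q p v) (χ y)) →
      WGE ![r₁, r₂, a, 1] r₂ (fun y => polyFun (betaPart r₂ a q p) (χ y)) →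
      ∀ i, WGE ![r₁, r₂, a, 1] (θ i) fun y => ι (χ y) i) :
    IsKawakitaBlowup r₁ r₂ a θ Z := by
  have hs := hd.splitting
  have ht := hs.isTruncation (r₁ := r₁) hd.pos hd.le hd.a_pos
  have hα : ∀ x, polyFun (firstPart r₁ r₂ a q w p + secondPart r₁ r₂ a q p v) x =
      (x 0 + polyFun (truncLT (xWeights r₂ a q p) r₁ q) x) *
        polyFun (truncUnitLT (xWeights r₂ a q p) (r₁ - minMult r₂ q) w) x +
      (x 1 + polyFun (truncLT (xWeights r₂ a q p) r₁ p) x) *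
        polyFun (truncUnitLT (xWeights r₂ a q p) (r₁ - r₂) v) x := fun x => by
    rw [← polyFun_firstPart, ← polyFun_secondPart]
    exact map_add _ _ _
  obtain ⟨χ, hχ, d, dA, dα, dβ⟩ := ht.exists_inverse hs.funSplitting
  have hχι := hιχ χ d dA (by simp only [hα]; exact dα) (by simp only [polyFun_betaPart]; exact dβ)
  have hπ0 : π 0 = 0 := by rw [← hι0, hπι]
  refine isKawakitaBlowup_of_graph (hd.pos.trans_le hd.le) hd.pos hd.a_pos hd.two_le hd.sum_eq
    hd.cop₁ hd.cop₂ hχ hs.funSplitting.eventually_model ?_ (analyticAt_polyFun _) hd.isolated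
    hd.good hθ hZ hπι hι0 (by simpa [hπ0] using hπ.tendsto 0)
    (ht.wge_liftedCoords hs.conv_v.analyticAt hA hB hπ') (Filter.Eventually.of_forall fun x => ?_)
    hχι
  · rw [slice_zero]
    exact (hs.conv_h.wge (w := fun _ => 1) (k := 3) hs.order_h).at_zero (by norm_num)
  · simp only [hπ'ι, hAι, hBι, hα, polyFun_betaPart]
    exact liftedCoords_eq ..

end BlowupData

end Kawakita
end

noncomputable section
namespace Kawakita

/-! ### Polynomial functions, and independence of the truncated parts from x₁ -/

theorem polyFun_aeval {N M : ℕ} (g : Fin N → MvPolynomial (Fin M) ℂ) (P : MvPolynomial (Fin N) ℂ)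
    (z : Fin M → ℂ) : polyFun (MvPolynomial.aeval g P) z = polyFun P fun i => polyFun (g i) z := by
  rw [polyFun, polyFun, ← MvPolynomial.coe_aeval_eq_eval, ← MvPolynomial.coe_aeval_eq_eval]
  exact DFunLike.congr_fun (MvPolynomial.comp_aeval g (MvPolynomial.aeval z)) P

theorem polyFun_rename {N M : ℕ} (j : Fin N → Fin M) (P : MvPolynomial (Fin N) ℂ)
    (z : Fin M → ℂ) : polyFun (MvPolynomial.rename j P) z = polyFun P (z ∘ j) :=
  MvPolynomial.eval_rename j z P

theorem polyFun_dropX1 (P : MvPolynomial (Fin 4) ℂ) (z : Fin 5 → ℂ) :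
    polyFun (dropX1 P) z = polyFun P ![0, z 2, z 3, z 4] := by
  rw [dropX1, polyFun_aeval]
  congr 1
  funext i
  fin_cases i <;> simp [polyFun]

theorem polyFun_ext {N : ℕ} {P Q : MvPolynomial (Fin N) ℂ} (h : ∀ x, polyFun P x = polyFun Q x) :
    P = Q :=
  MvPolynomial.funext h

section polyFun

variable {N : ℕ} (P Q : MvPolynomial (Fin N) ℂ) (x : Fin N → ℂ)

theorem polyFun_add : polyFun (P + Q) x = polyFun P x + polyFun Q x := map_add _ _ _

theorem polyFun_sub : polyFun (P - Q) x = polyFun P x - polyFun Q x := map_sub _ _ _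

theorem polyFun_neg : polyFun (-P) x = -polyFun P x := map_neg _ _

theorem polyFun_pow (k : ℕ) : polyFun (P ^ k) x = polyFun P x ^ k := map_pow _ _ _

theorem polyFun_X (i : Fin N) : polyFun (MvPolynomial.X i) x = x i := MvPolynomial.eval_X _

theorem continuous_polyFun : Continuous (polyFun P) := MvPolynomial.continuous_eval P

end polyFun

theorem mem_zeroLocus_span {N : ℕ} {S : Set (MvPolynomial (Fin N) ℂ)} {z : Fin N → ℂ} :
    z ∈ MvPolynomial.zeroLocus ℂ (Ideal.span S) ↔ ∀ P ∈ S, polyFun P z = 0 := by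
  rw [MvPolynomial.zeroLocus_span, Set.mem_ofPred_eq]
  rfl

section congr

variable {r₁ r₂ a : ℕ} {f : MvPolynomial (Fin 4) ℂ} {q w p v h : MvPowerSeries (Fin 4) ℂ}
  {x y : Fin 4 → ℂ}

theorem IsSplitting.truncP_congr (hs : IsSplitting f q w p v h) (hr₂ : 0 < r₂) (ha : 0 < a) (k : ℕ)
    (hxy : ∀ i ∈ ({1, 2, 3} : Finset (Fin 4)), x i = y i) :
    polyFun (truncLT (xWeights r₂ a q p) k p) x = polyFun (truncLT (xWeights r₂ a q p) k p) y :=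
  ((hs.vars_p.mono (T := {1, 2, 3}) (by decide)).truncLT
    (xWeights_ne_zero hr₂ ha hs) k).eval_congr hxy

theorem IsSplitting.truncV_congr (hs : IsSplitting f q w p v h) (hr₂ : 0 < r₂) (ha : 0 < a) (k : ℕ)
    (hxy : ∀ i ∈ ({1, 2, 3} : Finset (Fin 4)), x i = y i) :
    polyFun (truncUnitLT (xWeights r₂ a q p) k v) x =
      polyFun (truncUnitLT (xWeights r₂ a q p) k v) y :=
  (hs.vars_v.truncUnitLT (xWeights_ne_zero hr₂ ha hs) k).eval_congr hxy

theorem IsSplitting.secondPart_congr (hs : IsSplitting f q w p v h) (hr₂ : 0 < r₂) (ha : 0 < a)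
    (hxy : ∀ i ∈ ({1, 2, 3} : Finset (Fin 4)), x i = y i) :
    polyFun (secondPart r₁ r₂ a q p v) x = polyFun (secondPart r₁ r₂ a q p v) y := by
  rw [polyFun_secondPart, polyFun_secondPart, hxy 1 (by decide), hs.truncP_congr hr₂ ha _ hxy,
    hs.truncV_congr hr₂ ha _ hxy]

theorem IsSplitting.betaPart_congr (hs : IsSplitting f q w p v h) (hr₂ : 0 < r₂) (ha : 0 < a)
    (hxy : ∀ i ∈ ({1, 2, 3} : Finset (Fin 4)), x i = y i) :
    polyFun (betaPart r₂ a q p) x = polyFun (betaPart r₂ a q p) y := by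
  rw [polyFun_betaPart, polyFun_betaPart, hxy 1 (by decide), hs.truncP_congr hr₂ ha _ hxy]

theorem firstPart_eq_X (hω : ∀ i, xWeights r₂ a 0 p i ≠ 0) :
    firstPart r₁ r₂ a 0 1 p = MvPolynomial.X 0 := by
  rw [firstPart, truncLT_zero, truncUnitLT_one hω, add_zero, mul_one]

end congr

theorem polyFun_zero_eq_zero {P : MvPolynomial (Fin 4) ℂ} (h : MvPolynomial.constantCoeff P = 0) :
    polyFun P 0 = 0 := by
  rw [polyFun, MvPolynomial.eval_zero, h]

/-! ## The six-dimensional embedding -/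

theorem affineIso_idealI (r₁ r₂ a : ℕ) (G : MvPolynomial (Fin 4) ℂ)
    (q w p v : MvPowerSeries (Fin 4) ℂ) :
    AffineIso (hyp G) (idealI r₁ r₂ a G q w p v) ![2, 3, 4, 5] Set.univ := by
  set α := firstPart r₁ r₂ a q w p + secondPart r₁ r₂ a q p v with hα
  set β := betaPart r₂ a q p with hβ
  have hρ : ∀ P : MvPolynomial (Fin 4) ℂ,
      MvPolynomial.aeval ![α, β, MvPolynomial.X 0, MvPolynomial.X 1, MvPolynomial.X 2,
        MvPolynomial.X 3] (MvPolynomial.rename ![2, 3, 4, 5] P) = P := by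
    intro P
    rw [MvPolynomial.aeval_rename]
    have : (![α, β, MvPolynomial.X 0, MvPolynomial.X 1, MvPolynomial.X 2, MvPolynomial.X 3] ∘
        (![2, 3, 4, 5] : Fin 4 → Fin 6)) = MvPolynomial.X := by
      funext i
      fin_cases i <;> rfl
    rw [this, MvPolynomial.aeval_X_left_apply]
  refine affineIso_of_maps (MvPolynomial.rename ![2, 3, 4, 5])
    (MvPolynomial.aeval ![α, β, MvPolynomial.X 0, MvPolynomial.X 1, MvPolynomial.X 2,
      MvPolynomial.X 3]) (Ideal.subset_span (by simp)) ?_ (fun i => hρ _) ?_ ?_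
  · rintro P (rfl | rfl | rfl)
    · rw [hρ]
    · simp only [map_add (MvPolynomial.aeval _), map_neg, MvPolynomial.aeval_X, ← hα, hρ]
      simp
    · simp only [map_add (MvPolynomial.aeval _), map_neg, MvPolynomial.aeval_X, ← hβ, hρ]
      simp
  · intro k
    fin_cases k
    · refine Ideal.subset_span (Or.inr (Or.inl ?_))
      simp [← hα]
      ring
    · refine Ideal.subset_span (Or.inr (Or.inr ?_))
      simp [← hβ]
      ring
    all_goals simp
  · intro i _
    simp

theorem polyFun_parts_zero {r₁ r₂ a : ℕ} {f : MvPolynomial (Fin 4) ℂ}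
    {q w p v h : MvPowerSeries (Fin 4) ℂ} (hs : IsSplitting f q w p v h) (hr₂ : 0 < r₂)
    (ha : 0 < a) : polyFun (firstPart r₁ r₂ a q w p) 0 = 0 ∧
      polyFun (secondPart r₁ r₂ a q p v) 0 = 0 ∧ polyFun (betaPart r₂ a q p) 0 = 0 := by
  have hω := xWeights_ne_zero (r₂ := r₂) hr₂ ha hs
  have key : ∀ {s : MvPowerSeries (Fin 4) ℂ} (k : ℕ), 2 ≤ s.order →
      polyFun (truncLT (xWeights r₂ a q p) k s) 0 = 0 := by
    intro s k hk
    refine polyFun_zero_eq_zero ?_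
    have h0 : MvPowerSeries.coeff 0 s = 0 :=
      MvPowerSeries.coeff_of_lt_order (lt_of_lt_of_le (by simp) hk)
    rw [MvPolynomial.constantCoeff_eq, coeff_truncLT _ hω, h0, ite_self]
  refine ⟨?_, ?_, ?_⟩
  · rw [polyFun_firstPart, key _ hs.order_q]
    simp
  · rw [polyFun_secondPart, key _ hs.order_p]
    simp
  · rw [polyFun_betaPart, key _ hs.order_p]
    simp

namespace BlowupData

variable {r₁ r₂ a n : ℕ} {G : MvPolynomial (Fin 4) ℂ} {q w p v h : MvPowerSeries (Fin 4) ℂ}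

theorem isKawakitaBlowup_idealI (hd : BlowupData r₁ r₂ a n G q w p v h) :
    IsKawakitaBlowup r₁ r₂ a (bigWeights r₁ r₂ a q p)
      (MvPolynomial.zeroLocus ℂ (idealI r₁ r₂ a G q w p v)) := by
  set α := firstPart r₁ r₂ a q w p + secondPart r₁ r₂ a q p v with hα
  set β := betaPart r₂ a q p with hβ
  obtain ⟨z1, z2, z3⟩ := polyFun_parts_zero (r₁ := r₁) hd.splitting hd.pos hd.a_pos
  have hω := xWeights_ne_zero hd.pos hd.a_pos hd.splitting
  have hcoord : ∀ i, WGE (bigWeights r₁ r₂ a q p) (xWeights r₂ a q p i)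
      fun z => (![z 2, z 3, z 4, z 5] : Fin 4 → ℂ) i := fun i => by
    fin_cases i
    · exact WGE.coord (w := bigWeights r₁ r₂ a q p) 2
    · exact WGE.coord (w := bigWeights r₁ r₂ a q p) 3
    · exact WGE.coord (w := bigWeights r₁ r₂ a q p) 4
    · exact WGE.coord (w := bigWeights r₁ r₂ a q p) 5
  have hπι : ∀ x : Fin 4 → ℂ, (![x 0, x 1, x 2, x 3] : Fin 4 → ℂ) = x := fun x => by
    funext i
    fin_cases i <;> rfl
  refine hd.isKawakitaBlowup (ι := fun x => ![polyFun α x, polyFun β x, x 0, x 1, x 2, x 3])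
    (π := fun z => ![z 2, z 3, z 4, z 5]) (π' := fun z => ![z 2, z 3, z 4, z 5])
    (A := fun z => z 0) (B := fun z => z 1) ?_ ?_ hπι ?_ ?_
    (WGE.coord (w := bigWeights r₁ r₂ a q p) 0) (WGE.coord (w := bigWeights r₁ r₂ a q p) 1)
    hcoord hπι (fun x => rfl) (fun x => rfl) ?_
  · intro i
    fin_cases i
    · exact (hd.pos.trans_le hd.le).ne'
    · exact hd.pos.ne'
    · exact hω 0
    · exact hω 1
    · exact hω 2
    · exact hω 3
  · intro z
    have e : z ∘ (![2, 3, 4, 5] : Fin 4 → Fin 6) = ![z 2, z 3, z 4, z 5] := by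
      funext i
      fin_cases i <;> rfl
    rw [idealI, mem_zeroLocus_span]
    simp only [Set.mem_insert_iff, Set.mem_singleton_iff, forall_eq_or_imp, forall_eq, ← hα, ← hβ,
      polyFun_add, polyFun_neg, polyFun_X, polyFun_rename, e]
    constructor
    · rintro ⟨h1, h2, h3⟩
      refine ⟨?_, h1⟩
      funext i
      fin_cases i
      · change polyFun α _ = z 0
        linear_combination h2
      · change polyFun β _ = z 1
        linear_combination h3
      all_goals rfl
    · rintro ⟨h1, h2⟩
      have k0 : polyFun α ![z 2, z 3, z 4, z 5] = z 0 := congrFun h1 0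
      have k1 : polyFun β ![z 2, z 3, z 4, z 5] = z 1 := congrFun h1 1
      exact ⟨h2, by linear_combination k0, by linear_combination k1⟩
  · funext i
    fin_cases i
    · change polyFun α 0 = 0
      rw [hα, polyFun_add, z1, z2, add_zero]
    · exact z3
    all_goals rfl
  · exact continuous_pi fun i => by fin_cases i <;> exact continuous_apply _
  · intro χ k1 k2 k3 k4 i
    fin_cases i
    · exact k3
    · exact k4
    · exact k1 0
    · exact k1 1
    · exact k1 2
    · exact k1 3

end BlowupData

end Kawakita
end

noncomputable section
namespace Kawakita

/-! ## The five-dimensional embeddings -/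

theorem vec_four_eta (x : Fin 4 → ℂ) : (![x 0, x 1, x 2, x 3] : Fin 4 → ℂ) = x := by
  funext i
  fin_cases i <;> rfl

theorem vec_four_congr (s t b c d : ℂ) :
    ∀ i ∈ ({1, 2, 3} : Finset (Fin 4)), (![s, b, c, d] : Fin 4 → ℂ) i = ![t, b, c, d] i := by
  intro i hi
  fin_cases i
  · simp at hi
  all_goals rfl

theorem vec_update_congr (s : ℂ) (x : Fin 4 → ℂ) :
    ∀ i ∈ ({1, 2, 3} : Finset (Fin 4)), (![s, x 1, x 2, x 3] : Fin 4 → ℂ) i = x i := by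
  intro i hi
  fin_cases i
  · simp at hi
  all_goals rfl

/-- The variable x₁ is eliminated by x₁ = α - γ, which is an invertible substitution because γ is
free of x₁. It is therefore the only variable not sent to a variable of its own. -/
theorem affineIso_idealJ {r₁ r₂ a : ℕ} (hr₂ : 0 < r₂) (ha : 0 < a) {G : MvPolynomial (Fin 4) ℂ}
    {q w p v h : MvPowerSeries (Fin 4) ℂ} (hs : IsSplitting (hyp G) q w p v h)
    (hG : InVars {1, 2, 3} (G : MvPowerSeries (Fin 4) ℂ)) :
    AffineIso (hyp G) (idealJ r₁ r₂ a G q p v) ![0, 2, 3, 4] {1, 2, 3} := by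
  set γ := secondPart r₁ r₂ a q p v with hγ
  set β := betaPart r₂ a q p with hβ
  let φ : MvPolynomial (Fin 4) ℂ →ₐ[ℂ] MvPolynomial (Fin 5) ℂ := MvPolynomial.aeval
    ![MvPolynomial.X 0 - dropX1 γ, MvPolynomial.X 2, MvPolynomial.X 3, MvPolynomial.X 4]
  let ρ : MvPolynomial (Fin 5) ℂ →ₐ[ℂ] MvPolynomial (Fin 4) ℂ := MvPolynomial.aeval
    ![MvPolynomial.X 0 + γ, β, MvPolynomial.X 1, MvPolynomial.X 2, MvPolynomial.X 3]
  have hφ : ∀ (P : MvPolynomial (Fin 4) ℂ) z, polyFun (φ P) z =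
      polyFun P ![z 0 - polyFun γ ![0, z 2, z 3, z 4], z 2, z 3, z 4] := by
    intro P z
    rw [polyFun_aeval]
    congr 1
    funext i
    fin_cases i
    · change polyFun (MvPolynomial.X 0 - dropX1 γ) z = _
      rw [polyFun_sub, polyFun_X, polyFun_dropX1]
      rfl
    all_goals exact polyFun_X _ _
  have hφd : ∀ {P : MvPolynomial (Fin 4) ℂ},
      (∀ {x y}, (∀ i ∈ ({1, 2, 3} : Finset (Fin 4)), x i = y i) → polyFun P x = polyFun P y) →
      φ P = dropX1 P := fun {P} hP => polyFun_ext fun z => by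
    rw [hφ, polyFun_dropX1]
    exact hP (vec_four_congr _ _ _ _ _)
  have hρd : ∀ {P : MvPolynomial (Fin 4) ℂ},
      (∀ {x y}, (∀ i ∈ ({1, 2, 3} : Finset (Fin 4)), x i = y i) → polyFun P x = polyFun P y) →
      ρ (dropX1 P) = P := fun {P} hP => polyFun_ext fun x => by
    rw [polyFun_aeval, polyFun_dropX1]
    refine hP fun i hi => ?_
    fin_cases i
    · simp at hi
    all_goals exact polyFun_X _ _
  have hφγ := hφd (P := γ) fun hxy => hs.secondPart_congr hr₂ ha hxy
  have hφβ := hφd (P := β) fun hxy => hs.betaPart_congr hr₂ ha hxy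
  have hφG := hφd (P := G) fun hxy => hG.eval_congr hxy
  have hργ := hρd (P := γ) fun hxy => hs.secondPart_congr hr₂ ha hxy
  have hρβ := hρd (P := β) fun hxy => hs.betaPart_congr hr₂ ha hxy
  have hρG := hρd (P := G) fun hxy => hG.eval_congr hxy
  have φ0 : φ (MvPolynomial.X 0) = MvPolynomial.X 0 - dropX1 γ := MvPolynomial.aeval_X _ _
  have φ1 : φ (MvPolynomial.X 1) = MvPolynomial.X 2 := MvPolynomial.aeval_X _ _
  have φ2 : φ (MvPolynomial.X 2) = MvPolynomial.X 3 := MvPolynomial.aeval_X _ _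
  have φ3 : φ (MvPolynomial.X 3) = MvPolynomial.X 4 := MvPolynomial.aeval_X _ _
  have ρ0 : ρ (MvPolynomial.X 0) = MvPolynomial.X 0 + γ := MvPolynomial.aeval_X _ _
  have ρ1 : ρ (MvPolynomial.X 1) = β := MvPolynomial.aeval_X _ _
  have ρ2 : ρ (MvPolynomial.X 2) = MvPolynomial.X 1 := MvPolynomial.aeval_X _ _
  have ρ3 : ρ (MvPolynomial.X 3) = MvPolynomial.X 2 := MvPolynomial.aeval_X _ _
  have ρ4 : ρ (MvPolynomial.X 4) = MvPolynomial.X 3 := MvPolynomial.aeval_X _ _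
  refine affineIso_of_maps φ ρ (Ideal.subset_span (Or.inl ?_)) ?_ ?_ ?_ ?_
  · simp only [hyp, map_add, map_neg, map_pow, φ0, φ1, hφG]
    rfl
  · rintro P (rfl | rfl)
    · simp only [map_add, map_neg, map_pow, map_sub, ← hγ, hργ, hρG, ρ0, ρ2, hyp,
        add_sub_cancel_right]
      exact dvd_rfl
    · simp only [map_add, map_neg, ← hβ, hρβ, ρ1]
      simp
  · intro i
    fin_cases i
    · change ρ (φ (MvPolynomial.X 0)) = MvPolynomial.X 0
      rw [φ0, map_sub, ρ0, hργ, add_sub_cancel_right]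
    · exact (congrArg ρ φ1).trans ρ2
    · exact (congrArg ρ φ2).trans ρ3
    · exact (congrArg ρ φ3).trans ρ4
  · intro k
    fin_cases k
    · change φ (ρ (MvPolynomial.X 0)) - MvPolynomial.X 0 ∈ _
      rw [ρ0, map_add, φ0, hφγ, sub_add_cancel, sub_self]
      exact zero_mem _
    · refine Ideal.subset_span (Or.inr ?_)
      change φ (ρ (MvPolynomial.X 1)) - MvPolynomial.X 1 = -MvPolynomial.X 1 + dropX1 β
      rw [ρ1, hφβ]
      ring
    · change φ (ρ (MvPolynomial.X 2)) - MvPolynomial.X 2 ∈ _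
      rw [ρ2, φ1, sub_self]
      exact zero_mem _
    · change φ (ρ (MvPolynomial.X 3)) - MvPolynomial.X 3 ∈ _
      rw [ρ3, φ2, sub_self]
      exact zero_mem _
    · change φ (ρ (MvPolynomial.X 4)) - MvPolynomial.X 4 ∈ _
      rw [ρ4, φ3, sub_self]
      exact zero_mem _
  · rintro i (rfl | rfl | rfl)
    · exact φ1
    · exact φ2
    · exact φ3

theorem affineIso_idealJ' (r₂ a : ℕ) (G : MvPolynomial (Fin 4) ℂ) (q p : MvPowerSeries (Fin 4) ℂ) :
    AffineIso (hyp G) (idealJ' r₂ a G q p) ![0, 2, 3, 4] Set.univ := by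
  set β := betaPart r₂ a q p with hβ
  let ρ : MvPolynomial (Fin 5) ℂ →ₐ[ℂ] MvPolynomial (Fin 4) ℂ := MvPolynomial.aeval
    ![MvPolynomial.X 0, β, MvPolynomial.X 1, MvPolynomial.X 2, MvPolynomial.X 3]
  have hρ : ∀ P : MvPolynomial (Fin 4) ℂ, ρ (MvPolynomial.rename ![0, 2, 3, 4] P) = P := by
    intro P
    refine polyFun_ext fun x => ?_
    rw [polyFun_aeval, polyFun_rename]
    congr 1
    funext i
    fin_cases i <;> exact polyFun_X _ _
  have ρ1 : ρ (MvPolynomial.X 1) = β := MvPolynomial.aeval_X _ _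
  refine affineIso_of_maps (MvPolynomial.rename ![0, 2, 3, 4]) ρ (Ideal.subset_span (Or.inl rfl))
    ?_ (fun i => hρ _) ?_ ?_
  · rintro P (rfl | rfl)
    · rw [hρ]
    · rw [map_add, map_neg, ← hβ, hρ, ρ1, neg_add_cancel]
      exact dvd_zero _
  · intro k
    fin_cases k
    · simp [ρ]
    · refine Ideal.subset_span (Or.inr ?_)
      change MvPolynomial.rename ![0, 2, 3, 4] (ρ (MvPolynomial.X 1)) - MvPolynomial.X 1 = _
      rw [ρ1, ← hβ]
      ring
    all_goals simp [ρ]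
  · intro i _
    simp

namespace BlowupData

variable {r₁ r₂ a n : ℕ} {G : MvPolynomial (Fin 4) ℂ} {p v h : MvPowerSeries (Fin 4) ℂ}

theorem smallWeights_ne_zero (hd : BlowupData r₁ r₂ a n G 0 1 p v h) (i : Fin 5) :
    smallWeights r₁ r₂ a p i ≠ 0 := by
  have hω := xWeights_ne_zero hd.pos hd.a_pos hd.splitting
  fin_cases i
  · exact (hd.pos.trans_le hd.le).ne'
  · exact hd.pos.ne'
  · exact hω 1
  · exact hω 2
  · exact hω 3

/-- The difference of the two truncations of `p`, times the truncation of `v`. -/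
theorem wge_correction (hd : BlowupData r₁ r₂ a n G 0 1 p v h) :
    WGE (smallWeights r₁ r₂ a p) r₂ fun z =>
      (z 1 + (polyFun (truncLT (xWeights r₂ a 0 p) r₁ p) ![0, z 2, z 3, z 4] -
        polyFun (truncLT (xWeights r₂ a 0 p) r₂ p) ![0, z 2, z 3, z 4])) *
      polyFun (truncUnitLT (xWeights r₂ a 0 p) (r₁ - r₂) v) ![0, z 2, z 3, z 4] := by
  have ht := hd.splitting.isTruncation (r₁ := r₁) hd.pos hd.le hd.a_pos
  have hc : ∀ i, WGE (smallWeights r₁ r₂ a p) (xWeights r₂ a 0 p i)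
      fun z => (![0, z 2, z 3, z 4] : Fin 4 → ℂ) i := fun i => by
    fin_cases i
    · exact WGE.zero
    · exact WGE.coord (w := smallWeights r₁ r₂ a p) 2
    · exact WGE.coord (w := smallWeights r₁ r₂ a p) 3
    · exact WGE.coord (w := smallWeights r₁ r₂ a p) 4
  have hc0 : (![0, (0 : Fin 5 → ℂ) 2, (0 : Fin 5 → ℂ) 3, (0 : Fin 5 → ℂ) 4] : Fin 4 → ℂ) = 0 :=
    vec_four_eta 0
  have h1 := (ht.sub_p₂.sub (ht.sub_p₁.le hd.le)).comp
    (φ := fun z : Fin 5 → ℂ => ![0, z 2, z 3, z 4]) hc0 hc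
  have h2 : AnalyticAt ℂ (fun z : Fin 5 → ℂ => (![0, z 2, z 3, z 4] : Fin 4 → ℂ)) 0 :=
    analyticAt_pi_iff.2 fun i => (hc i).analyticAt
  have h3 : AnalyticAt ℂ (fun z : Fin 5 → ℂ =>
      polyFun (truncUnitLT (xWeights r₂ a 0 p) (r₁ - r₂) v) ![0, z 2, z 3, z 4]) 0 :=
    AnalyticAt.fun_comp (f := fun z : Fin 5 → ℂ => (![0, z 2, z 3, z 4] : Fin 4 → ℂ))
      (by rw [hc0]; exact analyticAt_polyFun _) h2
  refine (((WGE.coord (w := smallWeights r₁ r₂ a p) 1).add h1).mul_right h3).congr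
    (Filter.Eventually.of_forall fun z => ?_)
  ring

/-- On the graph β = x₂ + p₂, so β + (p₁ - p₂) = x₂ + p₁. This rewrites γ through β, in a form of
weight at least r₂. -/
theorem correction_eq (hd : BlowupData r₁ r₂ a n G 0 1 p v h) (x : Fin 4 → ℂ) :
    (polyFun (betaPart r₂ a 0 p) x +
        (polyFun (truncLT (xWeights r₂ a 0 p) r₁ p) ![0, x 1, x 2, x 3] -
        polyFun (truncLT (xWeights r₂ a 0 p) r₂ p) ![0, x 1, x 2, x 3])) *
      polyFun (truncUnitLT (xWeights r₂ a 0 p) (r₁ - r₂) v) ![0, x 1, x 2, x 3] =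
    polyFun (secondPart r₁ r₂ a 0 p v) x := by
  rw [polyFun_secondPart, polyFun_betaPart,
    hd.splitting.truncP_congr hd.pos hd.a_pos r₁ (vec_update_congr 0 x),
    hd.splitting.truncP_congr hd.pos hd.a_pos r₂ (vec_update_congr 0 x),
    hd.splitting.truncV_congr hd.pos hd.a_pos (r₁ - r₂) (vec_update_congr 0 x)]
  ring

/-- The function x₁ = α - γ must have weight at least r₂, but γ, as a polynomial in x₂, x₃, x₄, may
have weight only min(r₂, mult p). The retraction π' uses its expression through β instead; it agrees
with π on the graph. -/
theorem isKawakitaBlowup_idealJ (hd : BlowupData r₁ r₂ a n G 0 1 p v h)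
    (hG : InVars {1, 2, 3} (G : MvPowerSeries (Fin 4) ℂ)) :
    IsKawakitaBlowup r₁ r₂ a (smallWeights r₁ r₂ a p)
      (MvPolynomial.zeroLocus ℂ (idealJ r₁ r₂ a G 0 p v)) := by
  set γ := secondPart r₁ r₂ a 0 p v with hγ
  set β := betaPart r₂ a 0 p with hβ
  have hω := xWeights_ne_zero hd.pos hd.a_pos hd.splitting
  have hα : ∀ x, polyFun (firstPart r₁ r₂ a 0 1 p + γ) x = x 0 + polyFun γ x := fun x => by
    rw [firstPart_eq_X hω, polyFun_add, polyFun_X]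
  obtain ⟨-, z2, z3⟩ := polyFun_parts_zero (r₁ := r₁) hd.splitting hd.pos hd.a_pos
  have hγc : ∀ {x y}, (∀ i ∈ ({1, 2, 3} : Finset (Fin 4)), x i = y i) →
    polyFun γ x = polyFun γ y := fun hxy => hd.splitting.secondPart_congr hd.pos hd.a_pos hxy
  have hβc : ∀ {x y}, (∀ i ∈ ({1, 2, 3} : Finset (Fin 4)), x i = y i) →
    polyFun β x = polyFun β y := fun hxy => hd.splitting.betaPart_congr hd.pos hd.a_pos hxy
  have hGc : ∀ {x y}, (∀ i ∈ ({1, 2, 3} : Finset (Fin 4)), x i = y i) →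
    polyFun G x = polyFun G y := fun hxy => hG.eval_congr hxy
  refine hd.isKawakitaBlowup
    (ι := fun x => ![x 0 + polyFun γ x, polyFun β x, x 1, x 2, x 3])
    (π := fun z => ![z 0 - polyFun γ ![0, z 2, z 3, z 4], z 2, z 3, z 4])
    (π' := fun z => ![z 0 -
      (z 1 + (polyFun (truncLT (xWeights r₂ a 0 p) r₁ p) ![0, z 2, z 3, z 4] -
        polyFun (truncLT (xWeights r₂ a 0 p) r₂ p) ![0, z 2, z 3, z 4])) *
      polyFun (truncUnitLT (xWeights r₂ a 0 p) (r₁ - r₂) v) ![0, z 2, z 3, z 4], z 2, z 3, z 4])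
    (A := fun z => z 0) (B := fun z => z 1) hd.smallWeights_ne_zero ?_ ?_ ?_ ?_
    (WGE.coord (w := smallWeights r₁ r₂ a p) 0) (WGE.coord (w := smallWeights r₁ r₂ a p) 1)
    ?_ ?_ (fun x => (hα x).symm) (fun x => rfl) ?_
  · intro z
    rw [idealJ, mem_zeroLocus_span]
    simp only [Set.mem_insert_iff, Set.mem_singleton_iff, forall_eq_or_imp, forall_eq, ← hγ, ← hβ,
      polyFun_add, polyFun_neg, polyFun_X, polyFun_dropX1, polyFun_pow, polyFun_sub, polyFun_hyp]
    set x : Fin 4 → ℂ := ![z 0 - polyFun γ ![0, z 2, z 3, z 4], z 2, z 3, z 4] with hx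
    have e0 : x 0 = z 0 - polyFun γ ![0, z 2, z 3, z 4] := rfl
    have e1 : x 1 = z 2 := rfl
    have eγ : polyFun γ x = polyFun γ ![0, z 2, z 3, z 4] := hγc (vec_four_congr _ _ _ _ _)
    have eβ : polyFun β x = polyFun β ![0, z 2, z 3, z 4] := hβc (vec_four_congr _ _ _ _ _)
    have eG : polyFun G x = polyFun G ![0, z 2, z 3, z 4] := hGc (vec_four_congr _ _ _ _ _)
    constructor
    · rintro ⟨h1, h2⟩
      refine ⟨?_, ?_⟩
      · funext i
        fin_cases i
        · change x 0 + polyFun γ x = z 0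
          rw [eγ, e0, sub_add_cancel]
        · change polyFun β x = z 1
          rw [eβ]
          linear_combination h2
        all_goals rfl
      · rw [eG, e0, e1]
        exact h1
    · rintro ⟨h1, h2⟩
      have k1 : polyFun β x = z 1 := congrFun h1 1
      rw [eG, e0, e1] at h2
      exact ⟨h2, by rw [← eβ, k1, neg_add_cancel]⟩
  · intro x
    change (![x 0 + polyFun γ x - polyFun γ ![0, x 1, x 2, x 3], x 1, x 2, x 3] : Fin 4 → ℂ) = x
    rw [hγc (vec_update_congr 0 x), add_sub_cancel_right, vec_four_eta]
  · funext i
    fin_cases i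
    · change (0 : ℂ) + polyFun γ 0 = 0
      rw [z2, add_zero]
    · exact z3
    all_goals rfl
  · refine continuous_pi fun i => ?_
    fin_cases i
    · refine (continuous_apply 0).sub ((continuous_polyFun γ).comp (continuous_pi fun j => ?_))
      fin_cases j
      · exact continuous_const
      all_goals exact continuous_apply _
    all_goals exact continuous_apply _
  · intro i
    fin_cases i
    -- The weight required of x₁ is bounded by r₂, and both α and the rewritten γ have weight at
    -- least r₂.
    · exact (((WGE.coord (w := smallWeights r₁ r₂ a p) 0).le hd.le).sub hd.wge_correction).le
        (minMult_le r₂ 0)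
    · exact WGE.coord (w := smallWeights r₁ r₂ a p) 2
    · exact WGE.coord (w := smallWeights r₁ r₂ a p) 3
    · exact WGE.coord (w := smallWeights r₁ r₂ a p) 4
  · intro x
    have := hd.correction_eq x
    change (![x 0 + polyFun γ x - _, x 1, x 2, x 3] : Fin 4 → ℂ) = x
    refine Eq.trans ?_ (vec_four_eta x)
    congr 1
    exact sub_eq_of_eq_add (congrArg (x 0 + ·) this.symm)
  · intro χ k1 k2 k3 k4 i
    fin_cases i
    · simp only [← hγ, hα] at k3
      exact k3
    · exact k4
    · exact k1 1
    · exact k1 2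
    · exact k1 3

/-- When r₁ = r₂, the rewritten γ has weight at least r₁, so α and x₁ = α - γ are interchangeable as
coordinates of weight r₁, and γ need not enter the ideal. -/
theorem isKawakitaBlowup_idealJ' (hd : BlowupData r₁ r₂ a n G 0 1 p v h) (hr : r₁ = r₂) :
    IsKawakitaBlowup r₁ r₂ a (smallWeights r₁ r₂ a p)
      (MvPolynomial.zeroLocus ℂ (idealJ' r₂ a G 0 p)) := by
  set γ := secondPart r₁ r₂ a 0 p v with hγ
  set β := betaPart r₂ a 0 p with hβ
  have hω := xWeights_ne_zero hd.pos hd.a_pos hd.splitting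
  have hα : ∀ x, polyFun (firstPart r₁ r₂ a 0 1 p + γ) x = x 0 + polyFun γ x := fun x => by
    rw [firstPart_eq_X hω, polyFun_add, polyFun_X]
  obtain ⟨-, -, z3⟩ := polyFun_parts_zero (r₁ := r₁) hd.splitting hd.pos hd.a_pos
  have hcoord : ∀ i, WGE (smallWeights r₁ r₂ a p) (xWeights r₂ a 0 p i)
      fun z => (![z 0, z 2, z 3, z 4] : Fin 4 → ℂ) i := fun i => by
    fin_cases i
    · exact (WGE.coord (w := smallWeights r₁ r₂ a p) 0).le ((minMult_le r₂ 0).trans hd.le)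
    · exact WGE.coord (w := smallWeights r₁ r₂ a p) 2
    · exact WGE.coord (w := smallWeights r₁ r₂ a p) 3
    · exact WGE.coord (w := smallWeights r₁ r₂ a p) 4
  refine hd.isKawakitaBlowup
    (ι := fun x => ![x 0, polyFun β x, x 1, x 2, x 3])
    (π := fun z => ![z 0, z 2, z 3, z 4]) (π' := fun z => ![z 0, z 2, z 3, z 4])
    (A := fun z => z 0 +
      (z 1 + (polyFun (truncLT (xWeights r₂ a 0 p) r₁ p) ![0, z 2, z 3, z 4] -
        polyFun (truncLT (xWeights r₂ a 0 p) r₂ p) ![0, z 2, z 3, z 4])) *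
      polyFun (truncUnitLT (xWeights r₂ a 0 p) (r₁ - r₂) v) ![0, z 2, z 3, z 4])
    (B := fun z => z 1) hd.smallWeights_ne_zero ?_ vec_four_eta ?_ ?_
    ((WGE.coord (w := smallWeights r₁ r₂ a p) 0).add (hd.wge_correction.le hr.le))
    (WGE.coord (w := smallWeights r₁ r₂ a p) 1)
    hcoord vec_four_eta (fun x => ?_) (fun x => rfl) ?_
  · intro z
    have e : z ∘ (![0, 2, 3, 4] : Fin 4 → Fin 5) = ![z 0, z 2, z 3, z 4] := by
      funext i
      fin_cases i <;> rfl
    rw [idealJ', mem_zeroLocus_span]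
    simp only [Set.mem_insert_iff, Set.mem_singleton_iff, forall_eq_or_imp, forall_eq, ← hβ,
      polyFun_add, polyFun_neg, polyFun_X, polyFun_rename, e]
    constructor
    · rintro ⟨h1, h2⟩
      refine ⟨?_, h1⟩
      funext i
      fin_cases i
      · rfl
      · change polyFun β _ = z 1
        linear_combination h2
      all_goals rfl
    · rintro ⟨h1, h2⟩
      have k1 : polyFun β ![z 0, z 2, z 3, z 4] = z 1 := congrFun h1 1
      exact ⟨h2, by rw [k1, neg_add_cancel]⟩
  · funext i
    fin_cases i
    · rfl
    · exact z3
    all_goals rfl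
  · exact continuous_pi fun i => by fin_cases i <;> exact continuous_apply _
  · rw [hα, hγ, ← hd.correction_eq x]
    rfl
  · intro χ k1 k2 k3 k4 i
    fin_cases i
    -- As q = 0, the bound for x₁ + q in the inverse coordinates is a bound for x₁ itself.
    · refine (k2.le hr.le).congr (Filter.Eventually.of_forall fun y => ?_)
      change χ y 0 = χ y 0 + seriesSum 0 (χ y)
      rw [seriesSum_zero, add_zero]
    · exact k4
    · exact k1 1
    · exact k1 2
    · exact k1 3

end BlowupData

end Kawakita
end

/-! ### The theorem -/

theorem mainTheorem6 (n r₁ r₂ a : ℕ) (hr₂ : 0 < r₂) (hr : r₂ ≤ r₁) (ha : 0 < a) (hn : 2 ≤ n)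
    (hsum : r₁ + r₂ = a * (n + 1)) (hcop₁ : a.Coprime r₁) (hcop₂ : a.Coprime r₂)
    (F : MvPolynomial (Fin 4) ℂ) (hF : 3 ≤ (F : MvPowerSeries (Fin 4) ℂ).order)
    (hiso : Kawakita.IsIsolated (Kawakita.polyFun (Kawakita.hyp F)))
    (hcA : Kawakita.IsCA n (Kawakita.polyFun (Kawakita.hyp F)))
    (htype : ∃ t, Kawakita.IsOfType n t (Kawakita.polyFun (Kawakita.hyp F)) ∧ a ≤ t) :
    -- the required coordinate change of `x₃, x₄` and the splitting exist
    (∃ σ : MvPolynomial (Fin 2) ℂ ≃ₐ[ℂ] MvPolynomial (Fin 2) ℂ,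
      (∀ i, MvPolynomial.constantCoeff (σ (MvPolynomial.X i)) = 0) ∧
      (a = 1 → σ = AlgEquiv.refl) ∧
      ∃ q w p v h : MvPowerSeries (Fin 4) ℂ,
        Kawakita.IsSplitting (Kawakita.hyp (Kawakita.changeCoords σ F)) q w p v h ∧
        h.weightedOrder ![r₁, r₂, a, 1] = ((r₁ + r₂ : ℕ) : ℕ∞)) ∧
    -- and for every such choice the weighted blowups are Kawakita blowups
    (∀ σ : MvPolynomial (Fin 2) ℂ ≃ₐ[ℂ] MvPolynomial (Fin 2) ℂ,
      (∀ i, MvPolynomial.constantCoeff (σ (MvPolynomial.X i)) = 0) →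
      ∀ G : MvPolynomial (Fin 4) ℂ, G = Kawakita.changeCoords σ F →
      ∀ q w p v h : MvPowerSeries (Fin 4) ℂ,
      Kawakita.IsSplitting (Kawakita.hyp G) q w p v h →
      (1 < a → h.weightedOrder ![r₁, r₂, a, 1] = ((r₁ + r₂ : ℕ) : ℕ∞)) →
      Kawakita.AffineIso (Kawakita.hyp G) (Kawakita.idealI r₁ r₂ a G q w p v)
        ![2, 3, 4, 5] Set.univ ∧
      Kawakita.IsKawakitaBlowup r₁ r₂ a (Kawakita.bigWeights r₁ r₂ a q p)
        (MvPolynomial.zeroLocus ℂ (Kawakita.idealI r₁ r₂ a G q w p v)) ∧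
      (Kawakita.InVars {1, 2, 3} (G : MvPowerSeries (Fin 4) ℂ) ↔ q = 0 ∧ w = 1) ∧
      (Kawakita.InVars {1, 2, 3} (G : MvPowerSeries (Fin 4) ℂ) →
        Kawakita.AffineIso (Kawakita.hyp G) (Kawakita.idealJ r₁ r₂ a G q p v)
          ![0, 2, 3, 4] {1, 2, 3} ∧
        Kawakita.IsKawakitaBlowup r₁ r₂ a (Kawakita.smallWeights r₁ r₂ a p)
          (MvPolynomial.zeroLocus ℂ (Kawakita.idealJ r₁ r₂ a G q p v)) ∧
        (r₁ = r₂ →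
          Kawakita.AffineIso (Kawakita.hyp G) (Kawakita.idealJ' r₂ a G q p)
            ![0, 2, 3, 4] Set.univ ∧
          Kawakita.IsKawakitaBlowup r₁ r₂ a (Kawakita.smallWeights r₁ r₂ a p)
            (MvPolynomial.zeroLocus ℂ (Kawakita.idealJ' r₂ a G q p))))) := by
  refine ⟨Kawakita.exists_coordinate_change (hr₂.trans_le hr).ne' hr₂.ne' ha hn hsum hF hcA htype,
    ?_⟩
  rintro σ hσ G rfl q w p v h hs hh
  have hFG := Kawakita.contactEquivalent_changeCoords (Kawakita.ptMap_zero_iff.2 hσ) F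
  have hd : Kawakita.BlowupData r₁ r₂ a n (Kawakita.changeCoords σ F) q w p v h :=
    ⟨hr₂, hr, ha, hn, hsum, hcop₁, hcop₂, hs,
      hFG.isIsolated (Kawakita.analyticAt_polyFun _) hiso,
      hs.hasGoodForm hn ha hsum (hcA.of_contactEquivalent hFG) hh⟩
  refine ⟨Kawakita.affineIso_idealI .., hd.isKawakitaBlowup_idealI, hs.inVars_iff, fun hG => ?_⟩
  obtain ⟨rfl, rfl⟩ := hs.inVars_iff.1 hG
  exact ⟨Kawakita.affineIso_idealJ hr₂ ha hs hG, hd.isKawakitaBlowup_idealJ hG,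
    fun h12 => ⟨Kawakita.affineIso_idealJ' .., hd.isKawakitaBlowup_idealJ' h12⟩⟩
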